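/- **Problem.** Let $d\ge 1$, let $A,W\in\mathbb R^{d\times d}$ be symmetric positive definite, $c\in\mathbb R^d\setminus\{0\}$. Problem $P_B$ is to maximize $x^\top\theta$ over $\|x\|_A\le 1$, $\|\theta-c\|_W\le 1$, where $\|v\|_M=\sqrt{v^\top Mv}$. A feasible pair $(x,\theta)$ is an $\epsilon$-solution of $P_B$ if $x^\top\theta\ge x'^\top\theta'-\epsilon$ for every feasible $(x',\theta')$. Let $A^{1/2}WA^{1/2}=U^\top\mathrm{diag}(\lambda)U$ be an eigenvalue decomposition, $U$ orthogonal, $\lambda_1\ge\dots\ge\lambda_d$; let $b=UA^{-1/2}c$, $\|\cdot\|$ the Euclidean norm, $\rho=\|b\|+\lambda_d^{-1/2}$, $B_i=b_i^2/\rho^2$, $y^0_i=B_i+\lambda_d^{-1}/(2d\rho^2)$, $I=\{i: b_i\ne 0\}$, $$t_0=9\max\Big(\max_{i\in I}(b_i^2B_i)^{-1/2},\ \min_{i\in I}(\lambda_i^{-1}B_i)^{-1/2}\Big),$$ $$F(y)=-\sum_i|b_i|\sqrt{y_i}-\Big(\sum_i\lambda_i^{-1}y_i\Big)^{1/2},\qquad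 F^{(t)}(y)=tF(y)-\sum_i\log(y_i-B_i)-\log\Big(1-\sum_iy_i\Big).$$ **Algorithm** (parameters $\epsilon>0$, $\eta>1$). $\mathrm{Newton}(f,y,\tau)$, with $p=(\nabla^2f(y))^{-1}\nabla f(y)$ and $\lambda_f(y)=(\nabla f(y)^\top p)^{1/2}$ recomputed at every point: while $\lambda_f(y)\ge 1/4$, do the Newton step $y\leftarrow y-p/(1+\lambda_f(y))$; then, while $\lambda_f(y)^2>\tau$, do the Newton step $y\leftarrow y-p/(1+\xi)$ with $\xi=\lambda_f(y)^2/(1+\lambda_f(y))$; return $y$. The algorithm sets $t\leftarrow t_0$, $y\leftarrow\mathrm{Newton}(F^{(t_0)},y^0,\epsilon)$; while $(d+1)/t>\epsilon/2$, it sets $t\leftarrow\eta t$ and $y\leftarrow\mathrm{Newton}(F^{(t)},y,\epsilon/2)$. It outputs $\hat x=A^{-1/2}U^\top\tilde x$ with $\tilde x_i=\sqrt{y_i}\,\mathrm{sign}(b_i)$, where $\mathrm{sign}(0)=1$, and $\hat\theta=c+W^{-1}\hat x/\|\hat x\|_{W^{-1}}$. **Theorem.** For every $\epsilon>0$ and $\eta>1$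 the algorithm terminates, and $(\hat x,\hat\theta)$ is an $\epsilon$-solution of $P_B$. Write $\lceil r\rceil_+=\max(0,\lceil r\rceil)$, $x_0=2(d+1)/(\epsilon t_0)$, $$\Gamma=38\,t_0\rho+38\,d\log\big(2d\lambda_d\rho^2\big)+38\log\Big(\frac{\lambda_d\rho^2}{2\lambda_d^{1/2}\|b\|+1/2}\Big),$$ $$N_{tot}(b,\lambda,\epsilon,\eta)=\Gamma+\log_2\log_2\frac1\epsilon+\Big(38(d+1)(\eta-1-\log\eta)+\log_2\log_2\frac2\epsilon\Big)\Big\lceil\frac{\log x_0}{\log\eta}\Big\rceil_+ .$$ 1. If $\epsilon\le 10^{-6}$, the total number of Newton steps is less than $N_{tot}(b,\lambda,\epsilon,\eta)$. 2. If $\epsilon\le\frac12$ and $\eta=1+1/\sqrt{d+1}$, the total number of Newton steps is less than $$\Gamma+\Big(19+\log_2\log_2\frac2\epsilon\Big)\Big(\big\lceil\sqrt{d+1}\,\log_2x_0\big\rceil_++1\Big).$$ 3. If $\epsilon\le\frac12$, the total running time is at most $C\big(d^2N_{tot}(b,\lambda,\epsilon,\eta)+d^3\big)$ with an absolute constant $C$,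 for an implementation with exact real arithmetic in which every arithmetic operation, square root, comparison and array store costs one unit and the eigenvalue decomposition of a symmetric $d\times d$ matrix costs $d^3$ units. -/

import Mathlib

open scoped Matrix

namespace BilinearNewton

noncomputable section

/-! ### The bilinear problem -/

abbrev Vec (d : ℕ) := Fin d → ℝ

abbrev Mat (d : ℕ) := Matrix (Fin d) (Fin d) ℝ

/-- Euclidean norm. -/
def l2norm {d : ℕ} (v : Vec d) : ℝ := √(v ⬝ᵥ v)

/-- `‖v‖_M = √(vᵀ M v)`. -/
def wnorm {d : ℕ} (M : Mat d) (v : Vec d) : ℝ := √(v ⬝ᵥ (M *ᵥ v))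

/-- `{v | ‖v - z‖_M ≤ 1}`. -/
def ellipsoid {d : ℕ} (M : Mat d) (z : Vec d) : Set (Vec d) := {v | wnorm M (v - z) ≤ 1}

/-- `(x, θ)` is an `ε`-solution of: maximize `xᵀθ` subject to `‖x‖_A ≤ 1`, `‖θ - c‖_W ≤ 1`. -/
def IsEpsSolution {d : ℕ} (A W : Mat d) (c : Vec d) (ε : ℝ) (x θ : Vec d) : Prop :=
  x ∈ ellipsoid A 0 ∧ θ ∈ ellipsoid W c ∧
    ∀ x' ∈ ellipsoid A 0, ∀ θ' ∈ ellipsoid W c, x' ⬝ᵥ θ' - ε ≤ x ⬝ᵥ θ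

/-! ### Eigenvalue decompositions and square roots -/

/-- `M = Uᵀ diag(lam) U` with `U` orthogonal and `lam` nonincreasing. -/
structure IsEigenDecomp {d : ℕ} (M U : Mat d) (lam : Vec d) : Prop where
  orthogonal : U * Uᵀ = 1
  eq : M = Uᵀ * Matrix.diagonal lam * U
  antitone : Antitone lam

theorem exists_eigenDecomp {d : ℕ} (M : Mat d) (hM : M.IsSymm) :
    ∃ p : Mat d × Vec d, IsEigenDecomp M p.1 p.2 := by
  have hH : M.IsHermitian := by
    rw [Matrix.IsHermitian, Matrix.conjTranspose_eq_transpose_of_trivial]; exact hM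
  let V : Mat d := hH.eigenvectorUnitary
  let σ := Tuple.sort (fun i => - hH.eigenvalues i)
  have hV : V * Vᵀ = 1 := by
    have := Matrix.mem_unitaryGroup_iff.1 hH.eigenvectorUnitary.2
    rwa [Matrix.star_eq_conjTranspose, Matrix.conjTranspose_eq_transpose_of_trivial] at this
  have hV' : Vᵀ * V = 1 := mul_eq_one_comm.1 hV
  have hsp : M = V * Matrix.diagonal hH.eigenvalues * Vᵀ := by
    have := hH.spectral_theorem
    rw [Unitary.conjStarAlgAut_apply] at this
    rw [Matrix.star_eq_conjTranspose, Matrix.conjTranspose_eq_transpose_of_trivial] at this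
    exact this
  refine ⟨((V.submatrix id σ)ᵀ, hH.eigenvalues ∘ σ), ?_, ?_, ?_⟩
  · have h : (V.submatrix id σ)ᵀ = Vᵀ.submatrix σ id := rfl
    simp only [h, Matrix.transpose_submatrix, Matrix.transpose_transpose]
    rw [← Matrix.submatrix_mul _ _ σ id σ Function.bijective_id, hV']
    simp
  · have hd : Matrix.diagonal (hH.eigenvalues ∘ σ) =
        (Matrix.diagonal hH.eigenvalues).submatrix σ σ := by
      rw [Matrix.submatrix_diagonal_equiv]
    simp only [Matrix.transpose_transpose, Matrix.transpose_submatrix]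
    rw [hd, ← Matrix.submatrix_mul _ _ id σ σ σ.bijective,
      ← Matrix.submatrix_mul _ _ id σ id σ.bijective, ← hsp]
    simp
  · intro i j hij
    have := Tuple.monotone_sort (fun i => - hH.eigenvalues i) hij
    simpa using this

/-- A routine that computes an eigenvalue decomposition of every symmetric matrix (which
decomposition it returns, where there are several, is left open). -/
structure EigenRoutine (d : ℕ) where
  run : Mat d → Mat d × Vec d
  spec : ∀ M : Mat d, M.IsSymm → IsEigenDecomp M (run M).1 (run M).2

instance (d : ℕ) : Nonempty (EigenRoutine d) := by
  classical
  exact ⟨⟨fun M => if h : M.IsSymm then (exists_eigenDecomp M h).choose else (0, 0),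
    fun M h => by simpa [h] using (exists_eigenDecomp M h).choose_spec⟩⟩

section
open scoped MatrixOrder

/-- `A^{1/2}`: the positive semidefinite square root of a positive semidefinite matrix. -/
def rootMat {d : ℕ} (A : Mat d) : Mat d := CFC.sqrt A

end

/-- The orthogonal matrix `U` of `A^{1/2} W A^{1/2} = Uᵀ diag(λ) U`. -/
def basisOf {d : ℕ} (eig : EigenRoutine d) (A W : Mat d) : Mat d :=
  (eig.run (rootMat A * W * rootMat A)).1

/-- The eigenvalues `λ_1 ≥ ... ≥ λ_d` of `A^{1/2} W A^{1/2}`. -/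
def lamOf {d : ℕ} (eig : EigenRoutine d) (A W : Mat d) : Vec d :=
  (eig.run (rootMat A * W * rootMat A)).2

/-- `b = U A^{-1/2} c`. -/
def centerOf {d : ℕ} (eig : EigenRoutine d) (A W : Mat d) (c : Vec d) : Vec d :=
  basisOf eig A W *ᵥ ((rootMat A)⁻¹ *ᵥ c)

/-! ### The quantities derived from `b` and `λ` -/

def lastIdx (d : ℕ) [NeZero d] : Fin d := ⟨d - 1, Nat.sub_lt (NeZero.pos d) Nat.one_pos⟩

/-- `λ_d`, the smallest eigenvalue. -/
def lamMin {d : ℕ} [NeZero d] (lam : Vec d) : ℝ := lam (lastIdx d)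

/-- `‖b‖ + λ_d^{-1/2}`. -/
def radius {d : ℕ} [NeZero d] (b lam : Vec d) : ℝ := l2norm b + 1 / √(lamMin lam)

/-- `B_i = (b_i / (‖b‖ + λ_d^{-1/2}))²`. -/
def lowerB {d : ℕ} [NeZero d] (b lam : Vec d) : Vec d := fun i => (b i / radius b lam) ^ 2

/-- `y⁰_i = B_i + λ_d^{-1} / (2 d (‖b‖ + λ_d^{-1/2})²)`. -/
def initY {d : ℕ} [NeZero d] (b lam : Vec d) : Vec d :=
  fun i => lowerB b lam i + (1 / lamMin lam) / (2 * d * radius b lam ^ 2)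

/-- `t₀ = 9 max (max_{i ∈ I} (b_i² B_i)^{-1/2}, min_{i ∈ I} (λ_i⁻¹ B_i)^{-1/2})`,
with `I = {i | b_i ≠ 0}`. -/
def tInit {d : ℕ} [NeZero d] (b lam : Vec d) : ℝ :=
  9 * max (⨆ i : {i : Fin d // b i ≠ 0}, 1 / √((b i) ^ 2 * lowerB b lam i))
    (⨅ i : {i : Fin d // b i ≠ 0}, 1 / √((1 / lam i) * lowerB b lam i))

/-- The objective `F(y) = - ∑ |b_i| √y_i - √(∑ λ_i⁻¹ y_i)`, to be minimized over the simplex. -/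
def objF {d : ℕ} (b lam : Vec d) (y : Vec d) : ℝ :=
  -(∑ i, |b i| * √(y i)) - √(∑ i, (1 / lam i) * y i)

/-- `F^{(t)}(y) = t F(y) - ∑ log (y_i - B_i) - log (1 - ∑ y_i)`. -/
def objFt {d : ℕ} [NeZero d] (b lam : Vec d) (t : ℝ) (y : Vec d) : ℝ :=
  t * objF b lam y - (∑ i, Real.log (y i - lowerB b lam i)) - Real.log (1 - ∑ i, y i)

/-- The sign, with `sign 0 = 1`. -/
def sgn (r : ℝ) : ℝ := if r < 0 then -1 else 1

/-! ### Programs with a counter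

A value of type `Counted α` is a result together with what it has cost; `Prog α` describes
computations that may fail to terminate, by the pairs (result, cost) of their finished runs.
The counter is used twice: to count Newton steps, and to count elementary operations. -/

structure Counted (α : Type) where
  val : α
  cost : ℕ

instance : Monad Counted where
  pure a := ⟨a, 0⟩
  bind m f := ⟨(f m.val).val, m.cost + (f m.val).cost⟩

structure Prog (α : Type) where
  /-- `runs a k`: the computation ends with result `a` at cost `k`. -/
  runs : α → ℕ → Prop

instance : Monad Prog where
  pure a := ⟨fun a' k => a' = a ∧ k = 0⟩
  bind m f := ⟨fun b k => ∃ a k₁ k₂, m.runs a k₁ ∧ (f a).runs b k₂ ∧ k = k₁ + k₂⟩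

instance : MonadLift Counted Prog where
  monadLift m := ⟨fun a k => a = m.val ∧ k = m.cost⟩

/-- Finished runs of `while test s do s ← body s`. -/
inductive WhileRuns {σ : Type} (test : σ → Counted Prop) (body : σ → Prog σ) :
    σ → σ → ℕ → Prop
  | halt (s : σ) : ¬ (test s).val → WhileRuns test body s s (test s).cost
  | again (s s' s'' : σ) (k k' : ℕ) : (test s).val → (body s).runs s' k →
      WhileRuns test body s' s'' k' → WhileRuns test body s s'' ((test s).cost + k + k')

def whileDo {σ : Type} (test : σ → Counted Prop) (body : σ → Prog σ) (s : σ) : Prog σ :=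
  ⟨fun s' k => WhileRuns test body s s' k⟩

/-! ### Newton's method for self-concordant functions (the counter counts Newton steps) -/

def grad {d : ℕ} (f : Vec d → ℝ) (y : Vec d) : Vec d := fun i => fderiv ℝ f y (Pi.single i 1)

def hess {d : ℕ} (f : Vec d → ℝ) (y : Vec d) : Mat d :=
  Matrix.of fun i j => fderiv ℝ (fun z => grad f z j) y (Pi.single i 1)

/-- `(∇²f(y))⁻¹ ∇f(y)`. -/
def newtonDir {d : ℕ} (f : Vec d → ℝ) (y : Vec d) : Vec d := (hess f y)⁻¹ *ᵥ grad f y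

/-- `λ_f(y) = (∇f(y)ᵀ (∇²f(y))⁻¹ ∇f(y))^{1/2}`. -/
def decrement {d : ℕ} (f : Vec d → ℝ) (y : Vec d) : ℝ := √(grad f y ⬝ᵥ newtonDir f y)

def dampedStep {d : ℕ} (f : Vec d → ℝ) (y : Vec d) : Vec d :=
  y - (1 / (1 + decrement f y)) • newtonDir f y

def intermediateStep {d : ℕ} (f : Vec d → ℝ) (y : Vec d) : Vec d :=
  y - (1 / (1 + decrement f y ^ 2 / (1 + decrement f y))) • newtonDir f y

/-- Charges one Newton step. -/
def newtonStep {α : Type} (a : α) : Prog α := liftM (⟨a, 1⟩ : Counted α)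

/-- Damped steps while `λ_f(y) ≥ 1/4`, then intermediate steps while `λ_f(y)² > tol`. -/
def newtonMethod {d : ℕ} (f : Vec d → ℝ) (y₀ : Vec d) (tol : ℝ) : Prog (Vec d) := do
  let y ← whileDo (fun y => pure (1 / 4 ≤ decrement f y)) (fun y => newtonStep (dampedStep f y)) y₀
  whileDo (fun y => pure (tol < decrement f y ^ 2)) (fun y => newtonStep (intermediateStep f y)) y

/-- Centering at `t₀`, then `t ← η t` and a new call of Newton's method on `F^{(t)}`, from the
current point, as long as `(d + 1) / t > ε / 2`. -/
def barrierMethod {d : ℕ} [NeZero d] (b lam : Vec d) (ε η : ℝ) : Prog (Vec d) := do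
  let y ← newtonMethod (objFt b lam (tInit b lam)) (initY b lam) ε
  let s ← whileDo (σ := ℝ × Vec d) (fun s => pure (ε / 2 < ((d : ℝ) + 1) / s.1))
    (fun s => do
      let y' ← newtonMethod (objFt b lam (η * s.1)) s.2 (ε / 2)
      pure (η * s.1, y'))
    (tInit b lam, y)
  pure s.2

/-- The Newton algorithm on input `A, W, c, ε` with barrier increase parameter `η`;
the counter of a run is the total number of Newton steps. -/
def newtonAlgorithm {d : ℕ} [NeZero d] (eig : EigenRoutine d) (A W : Mat d) (c : Vec d)
    (ε η : ℝ) : Prog (Vec d × Vec d) := do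
  let b := centerOf eig A W c
  let y ← barrierMethod b (lamOf eig A W) ε η
  let x : Vec d := (rootMat A)⁻¹ *ᵥ ((basisOf eig A W)ᵀ *ᵥ fun i => √(y i) * sgn (b i))
  pure (x, c + (1 / wnorm W⁻¹ x) • (W⁻¹ *ᵥ x))

/-! ### Implementation on a real-number machine (the counter counts elementary operations)

Each `+`, `-`, `*`, `/`, square root, comparison and each store into an array costs one unit.
The only other primitive is an eigenvalue decomposition of a `d × d` matrix, which is charged
`d³` units. -/

/-- Reading a stored number or a constant is free. -/
def rd (x : ℝ) : Counted ℝ := ⟨x, 0⟩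

instance : Add (Counted ℝ) := ⟨fun x y => ⟨x.val + y.val, x.cost + y.cost + 1⟩⟩
instance : Sub (Counted ℝ) := ⟨fun x y => ⟨x.val - y.val, x.cost + y.cost + 1⟩⟩
instance : Mul (Counted ℝ) := ⟨fun x y => ⟨x.val * y.val, x.cost + y.cost + 1⟩⟩
instance : Div (Counted ℝ) := ⟨fun x y => ⟨x.val / y.val, x.cost + y.cost + 1⟩⟩

def sqrtC (x : Counted ℝ) : Counted ℝ := ⟨√x.val, x.cost + 1⟩

def ltC (x y : Counted ℝ) : Counted Prop := ⟨x.val < y.val, x.cost + y.cost + 1⟩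

def leC (x y : Counted ℝ) : Counted Prop := ⟨x.val ≤ y.val, x.cost + y.cost + 1⟩

open Classical in
def iteC (p : Counted Prop) (x y : Counted ℝ) : Counted ℝ :=
  if p.val then ⟨x.val, p.cost + x.cost⟩ else ⟨y.val, p.cost + y.cost⟩

def absC (x : ℝ) : Counted ℝ := iteC (ltC (rd x) (rd 0)) (rd 0 - rd x) (rd x)

def maxC (x y : ℝ) : Counted ℝ := iteC (ltC (rd x) (rd y)) (rd y) (rd x)

/-- Fill an array by a loop over its indices. -/
def tabC {d : ℕ} (f : Fin d → Counted ℝ) : Counted (Vec d) :=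
  ⟨fun i => (f i).val, ∑ i, ((f i).cost + 1)⟩

def tab2C {d : ℕ} (f : Fin d → Fin d → Counted ℝ) : Counted (Mat d) :=
  ⟨Matrix.of fun i j => (f i j).val, ∑ i, ∑ j, ((f i j).cost + 1)⟩

/-- Summation loop. -/
def sumC {d : ℕ} (f : Fin d → Counted ℝ) : Counted ℝ :=
  ⟨∑ i, (f i).val, ∑ i, ((f i).cost + 1)⟩

/-- Loop that computes the maximum of `0` and the values. -/
def maxLoopC {d : ℕ} (f : Fin d → Counted ℝ) : Counted ℝ :=
  (List.finRange d).foldlM (fun m i => do let v ← f i; maxC m v) 0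

def mulVecC {d : ℕ} (M : Mat d) (v : Vec d) : Counted (Vec d) :=
  tabC fun i => sumC fun j => rd (M i j) * rd (v j)

def mulMatC {d : ℕ} (M N : Mat d) : Counted (Mat d) :=
  tab2C fun i j => sumC fun k => rd (M i k) * rd (N k j)

/-- `Uᵀ diag(v) U`. -/
def conjDiagC {d : ℕ} (U : Mat d) (v : Vec d) : Counted (Mat d) :=
  tab2C fun i j => sumC fun k => rd (U k i) * rd (v k) * rd (U k j)

def eigC {d : ℕ} (eig : EigenRoutine d) (M : Mat d) : Counted (Mat d × Vec d) :=
  ⟨eig.run M, d ^ 3⟩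

/-- Sherman-Morrison: from a symmetric `M = H⁻¹`, the inverse of `H + u uᵀ`. -/
def shermanMorrisonC {d : ℕ} (M : Mat d) (u : Vec d) : Counted (Mat d) := do
  let w ← mulVecC M u
  let s ← rd 1 + sumC fun i => rd (u i) * rd (w i)
  tab2C fun i j => rd (M i j) - rd (w i) * rd (w j) / rd s

/-- Current point, Newton direction and Newton decrement. -/
structure NewtonState (d : ℕ) where
  pt : Vec d
  dir : Vec d
  dec : ℝ

/-- Newton direction and decrement of `F^{(t)}` at `y`. The Hessian is a diagonal matrix plus two
matrices of rank one; it is inverted by two Sherman-Morrison updates. -/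
def newtonDataC {d : ℕ} (b lam B : Vec d) (t : ℝ) (y : Vec d) : Counted (NewtonState d) := do
  let S ← sumC fun j => rd (y j) / rd (lam j)
  let rS ← sqrtC (rd S)
  let gap ← rd 1 - sumC fun j => rd (y j)
  let a ← tabC fun i => absC (b i)
  let r ← tabC fun i => sqrtC (rd (y i))
  let g ← tabC fun i =>
    rd 1 / rd gap - rd 1 / (rd (y i) - rd (B i)) - rd t * rd (a i) / (rd 2 * rd (r i))
      - rd t / (rd 2 * rd rS * rd (lam i))
  let D ← tabC fun i =>
    rd t * rd (a i) / (rd 4 * rd (y i) * rd (r i))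
      + rd 1 / ((rd (y i) - rd (B i)) * (rd (y i) - rd (B i)))
  let M₀ ← tab2C fun i j => if i = j then rd 1 / rd (D i) else rd 0
  let q ← sqrtC (rd t / (rd 4 * rd S * rd rS))
  let u ← tabC fun i => rd q / rd (lam i)
  let M₁ ← shermanMorrisonC M₀ u
  let v ← tabC fun _ => rd 1 / rd gap
  let M₂ ← shermanMorrisonC M₁ v
  let p ← mulVecC M₂ g
  let l ← sqrtC (sumC fun i => rd (g i) * rd (p i))
  pure ⟨y, p, l⟩

def dampedC {d : ℕ} (b lam B : Vec d) (t : ℝ) (s : NewtonState d) : Counted (NewtonState d) := do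
  let h ← rd 1 / (rd 1 + rd s.dec)
  let y ← tabC fun i => rd (s.pt i) - rd h * rd (s.dir i)
  newtonDataC b lam B t y

def intermediateC {d : ℕ} (b lam B : Vec d) (t : ℝ) (s : NewtonState d) :
    Counted (NewtonState d) := do
  let h ← rd 1 / (rd 1 + rd s.dec * rd s.dec / (rd 1 + rd s.dec))
  let y ← tabC fun i => rd (s.pt i) - rd h * rd (s.dir i)
  newtonDataC b lam B t y

def newtonMethodC {d : ℕ} (b lam B : Vec d) (t : ℝ) (y₀ : Vec d) (tol : ℝ) : Prog (Vec d) := do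
  let s₀ ← (newtonDataC b lam B t y₀ : Prog (NewtonState d))
  let s₁ ← whileDo (fun s => leC (rd (1 / 4)) (rd s.dec)) (fun s => liftM (dampedC b lam B t s)) s₀
  let s₂ ← whileDo (fun s => ltC (rd tol) (rd s.dec * rd s.dec))
    (fun s => liftM (intermediateC b lam B t s)) s₁
  pure s₂.pt

def barrierMethodC {d : ℕ} (b lam B y₀ : Vec d) (t₀ ε η : ℝ) : Prog (Vec d) := do
  let y ← newtonMethodC b lam B t₀ y₀ ε
  let s ← whileDo (σ := ℝ × Vec d) (fun s => ltC (rd ε / rd 2) ((rd d + rd 1) / rd s.1))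
    (fun s => do
      let t ← (rd η * rd s.1 : Counted ℝ)
      let tol ← (rd ε / rd 2 : Counted ℝ)
      let y' ← newtonMethodC b lam B t s.2 tol
      pure (t, y'))
    (t₀, y)
  pure s.2

/-- The values computed before the first call of Newton's method. -/
structure Setup (d : ℕ) where
  root : Mat d
  rootInv : Mat d
  basis : Mat d
  lam : Vec d
  b : Vec d
  B : Vec d
  y₀ : Vec d
  t₀ : ℝ

def setupC {d : ℕ} [NeZero d] (eig : EigenRoutine d) (A W : Mat d) (c : Vec d) :
    Counted (Setup d) := do
  let e ← eigC eig A
  let sq ← tabC fun i => sqrtC (rd (e.2 i))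
  let sqInv ← tabC fun i => rd 1 / rd (sq i)
  let R ← conjDiagC e.1 sq
  let Rinv ← conjDiagC e.1 sqInv
  let RW ← mulMatC R W
  let RWR ← mulMatC RW R
  let f ← eigC eig RWR
  let lam := f.2
  let lmin := lam (lastIdx d)
  let z ← mulVecC Rinv c
  let b ← mulVecC f.1 z
  let ρ ← sqrtC (sumC fun i => rd (b i) * rd (b i)) + rd 1 / sqrtC (rd lmin)
  let B ← tabC fun i => (rd (b i) / rd ρ) * (rd (b i) / rd ρ)
  let y₀ ← tabC fun i => rd (B i) + (rd 1 / rd lmin) / (rd 2 * rd d * (rd ρ * rd ρ))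
  let m₁ ← maxLoopC fun i => do
    let a ← absC (b i)
    iteC (ltC (rd 0) (rd a)) (rd 1 / sqrtC (rd (b i) * rd (b i) * rd (B i))) (rd 0)
  let m₂ ← maxLoopC fun i => (rd 1 / rd (lam i)) * rd (B i)
  let m₃ ← rd 1 / sqrtC (rd m₂)
  let t₀ ← rd 9 * maxC m₁ m₃
  pure ⟨R, Rinv, f.1, lam, b, B, y₀, t₀⟩

/-- `x̂ = A^{-1/2} Uᵀ x̃` and `θ̂ = c + W⁻¹ x̂ / ‖x̂‖_{W⁻¹}`, where `x̃_i = √y_i sign(b_i)`. -/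
def outputC {d : ℕ} (eig : EigenRoutine d) (W : Mat d) (c : Vec d) (S : Setup d) (y : Vec d) :
    Counted (Vec d × Vec d) := do
  let xt ← tabC fun i => sqrtC (rd (y i)) * iteC (ltC (rd (S.b i)) (rd 0)) (rd (-1)) (rd 1)
  let Ux ← mulVecC S.basisᵀ xt
  let x ← mulVecC S.rootInv Ux
  let e ← eigC eig W
  let inv ← tabC fun i => rd 1 / rd (e.2 i)
  let Winv ← conjDiagC e.1 inv
  let w ← mulVecC Winv x
  let nx ← sqrtC (sumC fun i => rd (x i) * rd (w i))
  let θ ← tabC fun i => rd (c i) + rd (w i) / rd nx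
  pure (x, θ)

/-- The Newton algorithm as a program; the counter of a run is its running time. -/
def newtonProgram {d : ℕ} [NeZero d] (eig : EigenRoutine d) (A W : Mat d) (c : Vec d)
    (ε η : ℝ) : Prog (Vec d × Vec d) := do
  let S ← (setupC eig A W c : Prog (Setup d))
  let y ← barrierMethodC S.b S.lam S.B S.y₀ S.t₀ ε η
  liftM (outputC eig W c S y)

/-! ### The bounds -/

/-- The bound for the centering phase, up to its double logarithm. -/
def centeringBound {d : ℕ} [NeZero d] (b lam : Vec d) : ℝ :=
  38 * tInit b lam * radius b lam
    + 38 * d * Real.log (2 * d * lamMin lam * radius b lam ^ 2)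
    + 38 * Real.log (lamMin lam * radius b lam ^ 2 / (2 * √(lamMin lam) * l2norm b + 1 / 2))

/-- `N_tot(b, λ, ε, η)`. The last factor is the number of barrier phases; `⌈r⌉₊` is
`max (0, ⌈r⌉)`. -/
def nTot {d : ℕ} [NeZero d] (b lam : Vec d) (ε η : ℝ) : ℝ :=
  centeringBound b lam + Real.logb 2 (Real.logb 2 (1 / ε))
    + (38 * ((d : ℝ) + 1) * (η - 1 - Real.log η) + Real.logb 2 (Real.logb 2 (2 / ε)))
      * ⌈Real.log (2 * ((d : ℝ) + 1) / (ε * tInit b lam)) / Real.log η⌉₊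

/-- The bound for `η = 1 + 1 / √(d + 1)`. -/
def nTotSqrt {d : ℕ} [NeZero d] (b lam : Vec d) (ε : ℝ) : ℝ :=
  centeringBound b lam
    + (19 + Real.logb 2 (Real.logb 2 (2 / ε)))
      * (⌈√((d : ℝ) + 1) * Real.logb 2 (2 * ((d : ℝ) + 1) / (ε * tInit b lam))⌉₊ + 1)

end

end BilinearNewton

open BilinearNewton

open scoped Matrix

namespace BilinearNewton

/-! ### Self-concordance in one variable -/

noncomputable section

/-! For fixed `x` the best `θ` has value `xᵀc + ‖x‖_{W⁻¹}`. The substitution `x = A^{-1/2} Uᵀ w`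
diagonalizes both quadratic forms, and with `y_i = w_i²` and the signs of `w` matched to `b` the
task is to minimize the convex function `F` over `y ≥ 0`, `∑ y_i ≤ 1` (`isEpsSolution_of`). A
perturbation argument shows that some minimizer satisfies `y_i ≥ B_i` (`exists_maximizer`), so the
barrier may be placed at `B_i`. This matters because `-a√s` behaves like a self-concordant function
only where `a√s` is bounded below: on `y ≥ B` and for `t ≥ t₀` both `t|b_i|√y_i` (for `b_i ≠ 0`) and
`t√(∑ y_i/λ_i)` are at least 9. So `F^{(t)}` is a sum of self-concordant functions of affine forms
(`isDomain`).

Self-concordance is used only through three scalar inequalities (`ScalarSC`), which are summed over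
the affine forms. With `l` the Newton decrement they give three facts: a damped step lowers the
value by at least `l - log (1 + l)` (`fn_dampedStep_le`); if `l < 1`, no point of the domain is
lower by more than `l² / (2(1 - l))` (`fn_sub_fn_le`); and an intermediate step leads to a decrement
of at most `(1 + l) l²` (`decrement_intermediateStep_le`). Hence the number of damped steps is at
most 37.3 times the initial gap (`damped_phase`), and the number of intermediate steps is doubly
logarithmic in the tolerance (`intermediate_phase`).

What remains is to bound gaps. At `y⁰` the gap is at most `Γ/38` (`init_gap`). For the later calls
the identity `∇²F^{(t)} p = ∇F^{(t)}` is split into objective and barrier parts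
(`exists_relative_dir`); without any reference to an exact center this bounds both the suboptimality
of `y` for `F` (`accuracy`) and the gap after `t ← ηt`, whose main term is `(d+1)(η - 1 - log η)`
(`path_step`). The slack between 37.3 and 38, together with half a step in the double logarithm,
absorbs the terms due to inexact centering.

For the running time, the Hessian is diagonal plus two rank-one matrices, so a Newton step costs
`O(d²)`; only the setup and the output cost `O(d³)`. The program is shown to pass through the same
points as the algorithm, so one analysis serves both. -/

/-- Self-concordance estimates for a function `φ` of one variable on `D`, with its first two
derivatives `φ₁`, `φ₂`: comparison of second derivatives, of slopes, and a lower bound for the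
Bregman distance. -/
structure ScalarSC (D : Set ℝ) (φ φ₁ φ₂ : ℝ → ℝ) : Prop where
  hasDeriv : ∀ s ∈ D, HasDerivAt φ (φ₁ s) s
  hasDeriv₁ : ∀ s ∈ D, HasDerivAt φ₁ (φ₂ s) s
  nonneg : ∀ s ∈ D, 0 ≤ φ₂ s
  ratio : ∀ s ∈ D, ∀ s' ∈ D, ∀ m, 0 ≤ m → φ₂ s * (s' - s) ^ 2 ≤ m ^ 2 →
    φ₂ s ≤ (1 + m) ^ 2 * φ₂ s'
  slope : ∀ s ∈ D, ∀ s' ∈ D, ∀ m, 0 ≤ m → m < 1 → φ₂ s * (s' - s) ^ 2 ≤ m ^ 2 →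
    ∃ θ, φ₁ s' - φ₁ s = θ * (φ₂ s * (s' - s)) ∧ 1 / (1 + m) ≤ θ ∧ θ ≤ 1 / (1 - m)
  bregman : ∀ s ∈ D, ∀ s' ∈ D, ∀ κ π, 0 ≤ κ → κ < 1 → φ₂ s * π ^ 2 ≤ κ ^ 2 →
    φ s - φ s' + φ₁ s * (s' - s) - φ₂ s * π * (s' - s) ≤ φ₂ s * π ^ 2 / (2 * (1 - κ))

/-- The one estimate on the logarithm behind every second-order error term `l² / (2(1 - l))` below.
-/
theorem sub_log_one_add_le {κ P : ℝ} (hκ : κ < 1) (hP : |P| ≤ κ) :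
    P - Real.log (1 + P) ≤ P ^ 2 / (2 * (1 - κ)) := by
  have hP1 := (abs_le.1 hP).1
  have hpos : 0 < 1 + P := by linarith
  have h1κ : 0 < 1 - κ := by linarith
  rcases le_total 0 P with h | h
  · have h1 := Real.le_log_one_add_of_nonneg h
    have h2 : P - 2 * P / (P + 2) ≤ P ^ 2 / 2 := by
      have : P - 2 * P / (P + 2) = P ^ 2 / (P + 2) := by field_simp; ring
      rw [this]
      gcongr
      linarith
    have hκ0 : 0 ≤ κ := (abs_nonneg P).trans hP
    have h3 : P ^ 2 / 2 ≤ P ^ 2 / (2 * (1 - κ)) := by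
      gcongr; linarith
    linarith
  · have hsq : 0 < √(1 + P) := Real.sqrt_pos.2 hpos
    have hs2 : √(1 + P) ^ 2 = 1 + P := Real.sq_sqrt hpos.le
    have hP0 : 0 ≤ -P := by linarith
    -- `-log (1 + P) = log (1 + (-P / (1 + P)))`
    have h1 : -Real.log (1 + P) ≤ -P + P ^ 2 / (2 * (1 + P)) := by
      -- Both sides vanish at 0, and the derivative of their difference is `x² / (2(1 - x)²) ≥ 0`.
      have key : ∀ x ∈ Set.Icc (0 : ℝ) (-P), -Real.log (1 - x) ≤ x + x ^ 2 / (2 * (1 - x)) := by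
        have hmono : MonotoneOn (fun x : ℝ => x + x ^ 2 / (2 * (1 - x)) + Real.log (1 - x))
            (Set.Icc 0 (-P)) := by
          have hd : ∀ x ∈ Set.Icc (0 : ℝ) (-P), HasDerivAt
              (fun x : ℝ => x + x ^ 2 / (2 * (1 - x)) + Real.log (1 - x))
              (x ^ 2 / (2 * (1 - x) ^ 2)) x := by
            intro x hx
            have hx1 : 1 - x ≠ 0 := by have := hx.2; linarith
            have e1 : HasDerivAt (fun x : ℝ => 1 - x) (-1) x := by
              simpa using (hasDerivAt_id x).const_sub 1
            have e2 := ((hasDerivAt_id' x).fun_add (((hasDerivAt_id' x).fun_pow 2).fun_div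
              (e1.const_mul 2) (mul_ne_zero two_ne_zero hx1))).fun_add (e1.log hx1)
            refine e2.congr_deriv ?_
            push_cast
            field_simp
            ring
          apply monotoneOn_of_deriv_nonneg (convex_Icc _ _)
          · exact fun x hx => (hd x hx).continuousAt.continuousWithinAt
          · exact fun x hx => (hd x (interior_subset hx)).differentiableAt.differentiableWithinAt
          · intro x hx
            rw [(hd x (interior_subset hx)).deriv]
            positivity
        intro x hx
        have := hmono (Set.left_mem_Icc.2 hP0) hx hx.1
        simp at this
        linarith
      have := key (-P) ⟨hP0, le_rfl⟩
      simpa using this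
    have h3 : P ^ 2 / (2 * (1 + P)) ≤ P ^ 2 / (2 * (1 - κ)) := by
      gcongr; linarith
    linarith

theorem scalarSC_negLog :
    ScalarSC (Set.Ioi 0) (fun s => -Real.log s) (fun s => -(1 / s)) (fun s => 1 / s ^ 2) where
  hasDeriv s hs := by
    have := (Real.hasDerivAt_log (ne_of_gt hs)).fun_neg
    simpa using this
  hasDeriv₁ s hs := by
    have := (hasDerivAt_inv (𝕜 := ℝ) (ne_of_gt hs)).fun_neg
    simpa using this
  nonneg s hs := by positivity
  ratio s hs s' hs' m hm h := by
    rw [Set.mem_Ioi] at hs hs'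
    have h1 : (s' - s) ^ 2 ≤ (m * s) ^ 2 := by
      rw [one_div, inv_mul_le_iff₀ (by positivity)] at h; nlinarith
    have h2 := (abs_le.1 (abs_le_of_sq_le_sq h1 (by positivity))).2
    rw [mul_one_div, div_le_div_iff₀ (by positivity) (by positivity), one_mul, ← mul_pow]
    gcongr; linarith
  slope s hs s' hs' m hm hm1 h := by
    rw [Set.mem_Ioi] at hs hs'
    have h1 : (s' - s) ^ 2 ≤ (m * s) ^ 2 := by
      rw [one_div, inv_mul_le_iff₀ (by positivity)] at h; nlinarith
    have h2 := abs_le.1 (abs_le_of_sq_le_sq h1 (by positivity))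
    refine ⟨s / s', ?_, ?_, ?_⟩
    · field_simp; ring
    · rw [div_le_div_iff₀ (by positivity) hs']; linarith [h2.2]
    · rw [div_le_div_iff₀ hs' (by linarith)]; linarith [h2.1]
  bregman s hs s' hs' κ π hκ hκ1 h := by
    rw [Set.mem_Ioi] at hs hs'
    have hP : |π / s| ≤ κ := by
      apply abs_le_of_sq_le_sq _ hκ
      rw [div_pow, div_eq_inv_mul, ← one_div]; exact h
    have h1 := sub_log_one_add_le hκ1 hP
    have hpos : 0 < 1 + π / s := by have := (abs_le.1 hP).1; linarith
    -- With `P = π / s`, equality holds at `s' = s / (1 + P)`, which maximizes the left side of the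
    -- claim over `s'`; the value there is `P - log (1 + P)`.
    have h2 := Real.log_le_sub_one_of_pos (mul_pos (div_pos hs' hs) hpos)
    rw [Real.log_mul (by positivity) hpos.ne', Real.log_div hs'.ne' hs.ne'] at h2
    have e1 : 1 / s ^ 2 * π ^ 2 / (2 * (1 - κ)) = (π / s) ^ 2 / (2 * (1 - κ)) := by
      rw [div_pow]; ring
    rw [e1]
    refine le_trans ?_ h1
    have e2 : -(1 / s) * (s' - s) = 1 - s' / s := by field_simp; ring
    have e3 : 1 / s ^ 2 * π * (s' - s) = π / s * (s' / s) - π / s := by field_simp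
    simp only [e2, e3]
    nlinarith

/-- The branch `a = 0` of the domain serves coordinates with `b i = 0`, where the summand vanishes
and `y i` may be 0. Otherwise everything is computed in `x = √s`. -/
theorem scalarSC_negSqrt {a : ℝ} (ha : 0 ≤ a) :
    ScalarSC {s | a = 0 ∨ (0 < s ∧ 9 ≤ a * √s)} (fun s => -(a * √s)) (fun s => -(a / (2 * √s)))
      (fun s => a / (4 * (s * √s))) := by
  rcases ha.eq_or_lt with rfl | ha
  · refine ⟨?_, ?_, ?_, ?_, ?_, ?_⟩
    · intro s _; simpa using hasDerivAt_const s (0 : ℝ)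
    · intro s _; simpa using hasDerivAt_const s (0 : ℝ)
    · simp
    · simp
    · intro s _ s' _ m hm hm1 _
      refine ⟨1, by simp, ?_, ?_⟩
      · rw [div_le_one (by linarith)]; linarith
      · rw [le_div_iff₀ (by linarith)]; linarith
    · simp
  have hD : ∀ s ∈ {s | a = 0 ∨ (0 < s ∧ 9 ≤ a * √s)}, ∃ x, 0 < x ∧ s = x ^ 2 ∧ 9 ≤ a * x := by
    rintro s (h | ⟨h, h'⟩)
    · exact absurd h ha.ne'
    · exact ⟨√s, Real.sqrt_pos.2 h, (Real.sq_sqrt h.le).symm, h'⟩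
  have hsq : ∀ {x : ℝ}, 0 < x → √(x ^ 2) = x := fun h => Real.sqrt_sq h.le
  -- The only use of the threshold 9: local length `m` means a relative displacement of at most
  -- `2m/3`, small enough to make up for the exponent `3/2` in the second derivative.
  have bound : ∀ {x m δ : ℝ}, 0 < x → 9 ≤ a * x → 0 ≤ m →
      a / (4 * (x ^ 2 * x)) * δ ^ 2 ≤ m ^ 2 → |δ| ≤ 2 * m / 3 * x ^ 2 := by
    intro x m δ hx hax hm h
    apply abs_le_of_sq_le_sq _ (by positivity)
    have h1 : a * δ ^ 2 ≤ m ^ 2 * (4 * (x ^ 2 * x)) := by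
      rw [div_mul_eq_mul_div, div_le_iff₀ (by positivity)] at h; exact h
    have h2 : 9 * δ ^ 2 ≤ (m ^ 2 * (4 * (x ^ 2 * x))) * x := by
      calc 9 * δ ^ 2 ≤ a * x * δ ^ 2 := by gcongr
        _ = a * δ ^ 2 * x := by ring
        _ ≤ _ := by gcongr
    nlinarith
  refine ⟨?_, ?_, ?_, ?_, ?_, ?_⟩
  · intro s hs
    obtain ⟨x, hx, rfl, -⟩ := hD s hs
    have := ((Real.hasDerivAt_sqrt (by positivity : x ^ 2 ≠ 0)).const_mul a).fun_neg
    refine this.congr_deriv ?_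
    rw [mul_one_div]
  · intro s hs
    obtain ⟨x, hx, rfl, -⟩ := hD s hs
    have h1 := (Real.hasDerivAt_sqrt (by positivity : x ^ 2 ≠ 0)).const_mul 2
    have := ((hasDerivAt_const (x ^ 2) a).fun_div h1 (by rw [hsq hx]; positivity)).fun_neg
    refine this.congr_deriv ?_
    rw [hsq hx]
    field_simp
    ring
  · intro s hs
    obtain ⟨x, hx, rfl, -⟩ := hD s hs
    positivity
  · intro s hs s' hs' m hm h
    obtain ⟨x, hx, rfl, hax⟩ := hD s hs
    obtain ⟨x', hx', rfl, -⟩ := hD s' hs'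
    simp only [hsq hx, hsq hx'] at h ⊢
    have h1 := (abs_le.1 (bound hx hax hm h)).2
    have h2 : x' ^ 2 ≤ (1 + m) * x ^ 2 := by nlinarith [sq_nonneg x]
    have h3 : x' ≤ (1 + m) * x := by
      apply (sq_le_sq₀ hx'.le (by positivity)).1
      nlinarith [mul_nonneg hm (sq_nonneg x), mul_nonneg (mul_nonneg hm hm) (sq_nonneg x)]
    rw [mul_div_assoc', div_le_div_iff₀ (by positivity) (by positivity)]
    have h4 : x' ^ 2 * x' ≤ (1 + m) * x ^ 2 * ((1 + m) * x) := by gcongr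
    nlinarith
  · intro s hs s' hs' m hm hm1 h
    obtain ⟨x, hx, rfl, hax⟩ := hD s hs
    obtain ⟨x', hx', rfl, -⟩ := hD s' hs'
    simp only [hsq hx, hsq hx'] at h ⊢
    have h1 := abs_le.1 (bound hx hax hm h)
    have hmx := mul_nonneg hm (sq_nonneg x)
    refine ⟨2 * x ^ 2 / (x' * (x + x')), ?_, ?_, ?_⟩
    · field_simp
      ring
    · rw [div_le_div_iff₀ (by positivity) (by positivity)]
      nlinarith [sq_nonneg (x - x')]
    · rw [div_le_div_iff₀ (by positivity) (by linarith)]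
      rcases le_total x x' with hxx | hxx
      · nlinarith
      · nlinarith
  · intro s hs s' hs' κ π hκ hκ1 h
    obtain ⟨x, hx, rfl, hax⟩ := hD s hs
    obtain ⟨x', hx', rfl, -⟩ := hD s' hs'
    simp only [hsq hx, hsq hx'] at h ⊢
    have h1 := (abs_le.1 (bound hx hax hκ h)).1
    have h1κ : 0 < 1 - κ := by linarith
    -- With `u = x' - x` the left side is `-4x²u² - 4πxu - 2πu²`. Since `π ≥ -2κx²`, the last term
    -- is at most `4κx²u²`, and what is left is a completed square.
    have key : -(4 * x ^ 2 * (x' - x) ^ 2) - 2 * π * ((x' - x) * (x' + x)) ≤ π ^ 2 / (1 - κ) := by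
      rw [le_div_iff₀ h1κ]
      have h2 : 0 ≤ (π + 2 * κ * x ^ 2) * (x' - x) ^ 2 * (1 - κ) := by
        have : 0 ≤ π + 2 * κ * x ^ 2 := by nlinarith [mul_nonneg hκ (sq_nonneg x)]
        positivity
      nlinarith [sq_nonneg (2 * (1 - κ) * x * (x' - x) + π)]
    have e : a / (4 * (x ^ 2 * x)) * π ^ 2 / (2 * (1 - κ))
        = a / (8 * x ^ 3) * (π ^ 2 / (1 - κ)) := by field_simp; ring
    rw [e]
    refine le_trans (le_of_eq ?_) (mul_le_mul_of_nonneg_left key (by positivity))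
    field_simp
    ring

end

/-! ### Newton steps for sums of self-concordant functions of affine forms -/

noncomputable section

/-- A sum of self-concordant functions of affine forms `y ↦ gₖ ⬝ y + cₖ`. -/
structure RidgeSum (d : ℕ) (ι : Type) where
  φ : ι → ℝ → ℝ
  φ₁ : ι → ℝ → ℝ
  φ₂ : ι → ℝ → ℝ
  D : ι → Set ℝ
  sc : ∀ k, ScalarSC (D k) (φ k) (φ₁ k) (φ₂ k)
  g : ι → Vec d
  c : ι → ℝ

theorem decrement_nonneg {d : ℕ} (f : Vec d → ℝ) (y : Vec d) : 0 ≤ decrement f y :=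
  Real.sqrt_nonneg _

namespace RidgeSum

variable {d : ℕ} {ι : Type} (R : RidgeSum d ι)

def arg (k : ι) (y : Vec d) : ℝ := R.g k ⬝ᵥ y + R.c k

theorem arg_add (k : ι) (y v : Vec d) : R.arg k (y + v) = R.arg k y + R.g k ⬝ᵥ v := by
  simp only [arg, dotProduct_add]; ring

theorem arg_sub_arg (k : ι) (y z : Vec d) : R.arg k z - R.arg k y = R.g k ⬝ᵥ (z - y) := by
  simp only [arg, dotProduct_sub]; ring

variable [Fintype ι]

def fn (y : Vec d) : ℝ := ∑ k, R.φ k (R.arg k y)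

/-- The bilinear form of the Hessian at `y`. -/
def form (y v w : Vec d) : ℝ := ∑ k, R.φ₂ k (R.arg k y) * ((R.g k ⬝ᵥ v) * (R.g k ⬝ᵥ w))

/-- An open domain that contains the Dikin ellipsoids of its points, with nondegenerate Hessian. -/
structure IsDomain (Q : Set (Vec d)) : Prop where
  isOpen : IsOpen Q
  mem : ∀ y ∈ Q, ∀ k, R.arg k y ∈ R.D k
  dikin : ∀ y ∈ Q, ∀ v, R.form y v v < 1 → y + v ∈ Q
  nondeg : ∀ y ∈ Q, ∀ v, R.form y v v = 0 → v = 0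

theorem form_smul_smul (y v w : Vec d) (a b : ℝ) :
    R.form y (a • v) (b • w) = a * b * R.form y v w := by
  simp only [form, dotProduct_smul, smul_eq_mul, Finset.mul_sum]
  exact Finset.sum_congr rfl fun k _ => by ring

def dotCLM (g : Vec d) : Vec d →L[ℝ] ℝ := ∑ i, g i • ContinuousLinearMap.proj (R := ℝ) i

theorem dotCLM_apply (g v : Vec d) : dotCLM g v = g ⬝ᵥ v := by
  simp [dotCLM, dotProduct]

omit [Fintype ι] in
theorem hasFDerivAt_arg (k : ι) (y : Vec d) : HasFDerivAt (R.arg k) (dotCLM (R.g k)) y := by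
  have h := ((dotCLM (R.g k)).hasFDerivAt (x := y)).add_const (R.c k)
  have e : R.arg k = fun x => dotCLM (R.g k) x + R.c k := by
    funext x; rw [dotCLM_apply, arg]
  rw [e]; exact h

theorem hasFDerivAt_sum {ψ ψ' : ι → ℝ → ℝ} {a : ι → ℝ} {y : Vec d}
    (h : ∀ k, HasDerivAt (ψ k) (ψ' k (R.arg k y)) (R.arg k y)) :
    HasFDerivAt (fun z => ∑ k, ψ k (R.arg k z) * a k)
      (∑ k, (a k * ψ' k (R.arg k y)) • dotCLM (R.g k)) y := by
  refine HasFDerivAt.fun_sum fun k _ => ?_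
  have := ((h k).comp_hasFDerivAt y (R.hasFDerivAt_arg k y)).mul_const (a k)
  rw [smul_smul] at this
  exact this

variable {R} {Q : Set (Vec d)}

section
variable (hQ : R.IsDomain Q) {y : Vec d} (hy : y ∈ Q)
include hQ hy

theorem IsDomain.grad_eq : grad R.fn y = fun i => ∑ k, R.φ₁ k (R.arg k y) * R.g k i := by
  have h := R.hasFDerivAt_sum (a := fun _ => 1) fun k => (R.sc k).hasDeriv _ (hQ.mem y hy k)
  have e : R.fn = fun z => ∑ k, R.φ k (R.arg k z) * 1 := by funext z; simp [fn]
  funext i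
  rw [grad, e, h.fderiv]
  simp [dotCLM_apply]

theorem IsDomain.hess_eq : hess R.fn y =
    Matrix.of fun i j => ∑ k, R.φ₂ k (R.arg k y) * (R.g k i * R.g k j) := by
  ext i j
  have h := R.hasFDerivAt_sum (a := fun k => R.g k j)
    fun k => (R.sc k).hasDeriv₁ _ (hQ.mem y hy k)
  have e : (fun z => grad R.fn z j) =ᶠ[nhds y] fun z => ∑ k, R.φ₁ k (R.arg k z) * R.g k j := by
    filter_upwards [hQ.isOpen.mem_nhds hy] with z hz
    rw [hQ.grad_eq hz]
  simp only [hess, Matrix.of_apply]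
  rw [e.fderiv_eq, h.fderiv]
  simp only [_root_.sum_apply, _root_.smul_apply, dotCLM_apply,
    dotProduct_single, smul_eq_mul]
  exact Finset.sum_congr rfl fun k _ => by ring

theorem IsDomain.grad_dot (v : Vec d) :
    grad R.fn y ⬝ᵥ v = ∑ k, R.φ₁ k (R.arg k y) * (R.g k ⬝ᵥ v) := by
  rw [hQ.grad_eq hy]
  simp only [dotProduct, Finset.sum_mul, Finset.mul_sum]
  rw [Finset.sum_comm]
  exact Finset.sum_congr rfl fun k _ => Finset.sum_congr rfl fun i _ => by ring

theorem IsDomain.dot_hess (v w : Vec d) : v ⬝ᵥ (hess R.fn y *ᵥ w) = R.form y v w := by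
  rw [hQ.hess_eq hy]
  simp only [dotProduct, Matrix.mulVec, form, Matrix.of_apply, Finset.sum_mul,
    Finset.mul_sum]
  rw [eq_comm, Finset.sum_comm]
  conv_rhs => rw [Finset.sum_comm]
  refine Finset.sum_congr rfl fun i _ => ?_
  rw [Finset.sum_comm]
  exact Finset.sum_congr rfl fun j _ => Finset.sum_congr rfl fun k _ => by ring

theorem IsDomain.φ₂_nonneg (k : ι) : 0 ≤ R.φ₂ k (R.arg k y) := (R.sc k).nonneg _ (hQ.mem y hy k)

theorem IsDomain.form_nonneg (v : Vec d) : 0 ≤ R.form y v v :=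
  Finset.sum_nonneg fun k _ => mul_nonneg (hQ.φ₂_nonneg hy k) (mul_self_nonneg _)

theorem IsDomain.term_le_form (k : ι) (v : Vec d) :
    R.φ₂ k (R.arg k y) * (R.g k ⬝ᵥ v) ^ 2 ≤ R.form y v v := by
  have := Finset.single_le_sum (f := fun k => R.φ₂ k (R.arg k y) * ((R.g k ⬝ᵥ v) * (R.g k ⬝ᵥ v)))
    (fun k _ => mul_nonneg (hQ.φ₂_nonneg hy k) (mul_self_nonneg _)) (Finset.mem_univ k)
  rw [pow_two]; exact this

/-- Cauchy-Schwarz with absolute values inside the sum, because the slope factors `θ` differ from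
summand to summand. -/
theorem IsDomain.sum_abs_le (v w : Vec d) :
    ∑ k, R.φ₂ k (R.arg k y) * (|R.g k ⬝ᵥ v| * |R.g k ⬝ᵥ w|) ≤
      √(R.form y v v) * √(R.form y w w) := by
  have h := Real.sum_mul_le_sqrt_mul_sqrt Finset.univ
    (fun k => √(R.φ₂ k (R.arg k y)) * |R.g k ⬝ᵥ v|) (fun k => √(R.φ₂ k (R.arg k y)) * |R.g k ⬝ᵥ w|)
  have e : ∀ v, ∑ k, (√(R.φ₂ k (R.arg k y)) * |R.g k ⬝ᵥ v|) ^ 2 = R.form y v v := fun v =>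
    Finset.sum_congr rfl fun k _ => by
      rw [mul_pow, Real.sq_sqrt (hQ.φ₂_nonneg hy k), sq_abs]; ring
  rw [e, e] at h
  refine le_trans (le_of_eq (Finset.sum_congr rfl fun k _ => ?_)) h
  nth_rewrite 1 [← Real.mul_self_sqrt (hQ.φ₂_nonneg hy k)]
  ring

theorem IsDomain.isUnit_hess : IsUnit (hess R.fn y).det := by
  rw [isUnit_iff_ne_zero]
  intro h
  obtain ⟨v, hv, hv'⟩ := Matrix.exists_mulVec_eq_zero_iff.2 h
  apply hv
  apply hQ.nondeg y hy
  rw [← hQ.dot_hess hy, hv', dotProduct_zero]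

/-- `∇²f(y) p = ∇f(y)`: the gradient is traded for the Newton direction in the Hessian form. All
estimates that involve the decrement rest on this. -/
theorem IsDomain.form_newtonDir (v : Vec d) :
    R.form y v (newtonDir R.fn y) = grad R.fn y ⬝ᵥ v := by
  rw [← hQ.dot_hess hy, newtonDir, Matrix.mulVec_mulVec, Matrix.mul_nonsing_inv _ (hQ.isUnit_hess hy),
    Matrix.one_mulVec, dotProduct_comm]

theorem IsDomain.decrement_eq : decrement R.fn y =
    √(R.form y (newtonDir R.fn y) (newtonDir R.fn y)) := by
  rw [hQ.form_newtonDir hy, decrement]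

theorem IsDomain.decrement_sq : decrement R.fn y ^ 2 =
    R.form y (newtonDir R.fn y) (newtonDir R.fn y) := by
  rw [hQ.decrement_eq hy, Real.sq_sqrt (hQ.form_nonneg hy _)]

/-- Upper bound for a self-concordant function inside a Dikin ellipsoid. -/
theorem IsDomain.fn_add_le {v : Vec d} {r : ℝ} (hr : 0 ≤ r) (hr1 : r < 1)
    (hv : R.form y v v = r ^ 2) :
    R.fn (y + v) ≤ R.fn y + grad R.fn y ⬝ᵥ v + (-r - Real.log (1 - r)) := by
  have hmem : ∀ x ∈ Set.Icc (0 : ℝ) 1, y + x • v ∈ Q := fun x hx => by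
    apply hQ.dikin y hy
    rw [form_smul_smul, hv]
    nlinarith [mul_nonneg hx.1 hr, mul_le_one₀ hx.2 hr hr1.le,
      mul_le_of_le_one_left hr hx.2]
  set G' : ℝ → ℝ := fun x => ∑ k, R.φ₁ k (R.arg k (y + x • v)) * (R.g k ⬝ᵥ v) with hG'
  have hG : ∀ x ∈ Set.Icc (0 : ℝ) 1, HasDerivAt (fun x => R.fn (y + x • v)) (G' x) x := by
    intro x hx
    refine HasDerivAt.fun_sum fun k _ => ?_
    have h1 : HasDerivAt (fun x : ℝ => R.arg k (y + x • v)) (R.g k ⬝ᵥ v) x := by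
      have : (fun x : ℝ => R.arg k (y + x • v)) = fun x => R.arg k y + x * (R.g k ⬝ᵥ v) := by
        funext x; rw [arg_add, dotProduct_smul, smul_eq_mul]
      rw [this]
      simpa using ((hasDerivAt_id' x).mul_const (R.g k ⬝ᵥ v)).const_add (R.arg k y)
    exact ((R.sc k).hasDeriv _ (hQ.mem _ (hmem x hx) k)).comp x h1
  -- Use `slope` with `m = x * r` in each summand. The excess `x r² / (1 - x r)` integrates over
  -- `[0, 1]` to `-r - log (1 - r)`.
  have hG'le : ∀ x ∈ Set.Icc (0 : ℝ) 1, G' x ≤ grad R.fn y ⬝ᵥ v + x * r ^ 2 / (1 - x * r) := by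
    intro x hx
    have hxr : x * r < 1 := lt_of_le_of_lt (mul_le_of_le_one_left hr hx.2) hr1
    rw [hQ.grad_dot hy, ← sub_le_iff_le_add', hG', ← Finset.sum_sub_distrib]
    have : x * r ^ 2 / (1 - x * r) = ∑ k, x / (1 - x * r) *
        (R.φ₂ k (R.arg k y) * ((R.g k ⬝ᵥ v) * (R.g k ⬝ᵥ v))) := by
      rw [← Finset.mul_sum, ← form, hv]; ring
    rw [this]
    refine Finset.sum_le_sum fun k _ => ?_
    have hs : R.arg k (y + x • v) - R.arg k y = x * (R.g k ⬝ᵥ v) := by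
      rw [arg_add, dotProduct_smul, smul_eq_mul]; ring
    obtain ⟨θ, h1, -, h2⟩ := (R.sc k).slope _ (hQ.mem y hy k) _ (hQ.mem _ (hmem x hx) k) (x * r)
      (mul_nonneg hx.1 hr) hxr (by
        rw [hs, mul_pow, mul_pow, ← hv]
        have := hQ.term_le_form hy k v
        nlinarith [sq_nonneg x])
    rw [← sub_mul, h1, hs]
    have h3 : 0 ≤ R.φ₂ k (R.arg k y) * ((R.g k ⬝ᵥ v) * (R.g k ⬝ᵥ v)) * x :=
      mul_nonneg (mul_nonneg (hQ.φ₂_nonneg hy k) (mul_self_nonneg _)) hx.1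
    calc _ = θ * (R.φ₂ k (R.arg k y) * ((R.g k ⬝ᵥ v) * (R.g k ⬝ᵥ v)) * x) := by ring
      _ ≤ 1 / (1 - x * r) * (R.φ₂ k (R.arg k y) * ((R.g k ⬝ᵥ v) * (R.g k ⬝ᵥ v)) * x) := by gcongr
      _ = _ := by ring
  have hmono : MonotoneOn (fun x : ℝ => R.fn y + x * (grad R.fn y ⬝ᵥ v) +
      (-(x * r) - Real.log (1 - x * r)) - R.fn (y + x • v)) (Set.Icc 0 1) := by
    have hd : ∀ x ∈ Set.Icc (0 : ℝ) 1, HasDerivAt (fun x : ℝ => R.fn y +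
        x * (grad R.fn y ⬝ᵥ v) + (-(x * r) - Real.log (1 - x * r)) - R.fn (y + x • v))
        (grad R.fn y ⬝ᵥ v + x * r ^ 2 / (1 - x * r) - G' x) x := by
      intro x hx
      have hxr : 1 - x * r ≠ 0 := by
        have : x * r < 1 := lt_of_le_of_lt (mul_le_of_le_one_left hr hx.2) hr1
        linarith
      have e1 := (hasDerivAt_id' x).mul_const r
      have e2 := (((hasDerivAt_id' x).mul_const (grad R.fn y ⬝ᵥ v)).const_add (R.fn y)).fun_add
        (e1.fun_neg.fun_sub ((e1.const_sub 1).log hxr))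
      refine (e2.fun_sub (hG x hx)).congr_deriv ?_
      have : x * r ^ 2 / (1 - x * r) = -r + r / (1 - x * r) := by field_simp; ring
      rw [this]
      ring
    apply monotoneOn_of_deriv_nonneg (convex_Icc _ _)
    · exact fun x hx => (hd x hx).continuousAt.continuousWithinAt
    · exact fun x hx => (hd x (interior_subset hx)).differentiableAt.differentiableWithinAt
    · intro x hx
      rw [(hd x (interior_subset hx)).deriv]
      linarith [hG'le x (interior_subset hx)]
  have := hmono (Set.left_mem_Icc.2 zero_le_one) (Set.right_mem_Icc.2 zero_le_one) zero_le_one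
  simp at this
  linarith

omit hQ hy in
theorem step_eq (a : ℝ) : y - a • newtonDir R.fn y = y + (-a) • newtonDir R.fn y := by
  rw [neg_smul, sub_eq_add_neg]

theorem IsDomain.dampedStep_mem : dampedStep R.fn y ∈ Q := by
  have h0 := decrement_nonneg R.fn y
  rw [dampedStep, step_eq]
  apply hQ.dikin y hy
  rw [form_smul_smul, ← hQ.decrement_sq hy]
  rw [show -(1 / (1 + decrement R.fn y)) * -(1 / (1 + decrement R.fn y)) * decrement R.fn y ^ 2
    = (decrement R.fn y / (1 + decrement R.fn y)) ^ 2 by field_simp]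
  rw [sq_lt_one_iff₀ (by positivity), div_lt_one (by positivity)]
  linarith

/-- The step length `1 / (1 + l)` minimizes the upper bound of `fn_add_le` along the Newton
direction; the local length is then `r = l / (1 + l)`. -/
theorem IsDomain.fn_dampedStep_le : R.fn (dampedStep R.fn y) ≤
    R.fn y - (decrement R.fn y - Real.log (1 + decrement R.fn y)) := by
  have h0 := decrement_nonneg R.fn y
  set l := decrement R.fn y with hl
  have h1 : l / (1 + l) < 1 := by rw [div_lt_one (by positivity)]; linarith
  have h := hQ.fn_add_le hy (v := (-(1 / (1 + l))) • newtonDir R.fn y) (r := l / (1 + l))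
    (by positivity) h1 (by rw [form_smul_smul, ← hQ.decrement_sq hy, ← hl]; field_simp)
  rw [dampedStep, step_eq, ← hl]
  refine h.trans (le_of_eq ?_)
  rw [← hQ.form_newtonDir hy]
  have e := R.form_smul_smul y (newtonDir R.fn y) (newtonDir R.fn y) (-(1 / (1 + l))) 1
  rw [one_smul, ← hQ.decrement_sq hy, ← hl] at e
  rw [e, show 1 - l / (1 + l) = (1 + l)⁻¹ by field_simp; ring, Real.log_inv]
  field_simp
  ring

/-- Lower bound for a self-concordant function in terms of the Newton decrement. -/
theorem IsDomain.fn_sub_fn_le {z : Vec d} (hz : z ∈ Q) (h1 : decrement R.fn y < 1) :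
    R.fn y - R.fn z ≤ decrement R.fn y ^ 2 / (2 * (1 - decrement R.fn y)) := by
  set l := decrement R.fn y with hl
  have h := Finset.sum_le_sum (s := Finset.univ) fun k _ => (R.sc k).bregman _ (hQ.mem y hy k) _
    (hQ.mem z hz k) l (R.g k ⬝ᵥ newtonDir R.fn y) (decrement_nonneg _ _) h1
    (by rw [hl, hQ.decrement_sq hy]; exact hQ.term_le_form hy k _)
  rw [← Finset.sum_div] at h
  have e1 : ∑ k, R.φ₂ k (R.arg k y) * (R.g k ⬝ᵥ newtonDir R.fn y) ^ 2 = l ^ 2 := by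
    rw [hl, hQ.decrement_sq hy]
    exact Finset.sum_congr rfl fun k _ => by ring
  rw [e1, Finset.sum_sub_distrib, Finset.sum_add_distrib, Finset.sum_sub_distrib] at h
  -- After summation the two linear terms of `bregman` cancel, because `∇²f(y) p = ∇f(y)`.
  have e2 : ∑ k, R.φ₁ k (R.arg k y) * (R.arg k z - R.arg k y) =
      ∑ k, R.φ₂ k (R.arg k y) * (R.g k ⬝ᵥ newtonDir R.fn y) * (R.arg k z - R.arg k y) := by
    simp only [arg_sub_arg]
    rw [← hQ.grad_dot hy, ← hQ.form_newtonDir hy]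
    exact Finset.sum_congr rfl fun k _ => by ring
  rw [e2] at h
  simpa [fn] using h

theorem IsDomain.intermediateStep_mem (h1 : decrement R.fn y < 1) :
    intermediateStep R.fn y ∈ Q := by
  have h0 := decrement_nonneg R.fn y
  rw [intermediateStep, step_eq]
  apply hQ.dikin y hy
  rw [form_smul_smul, ← hQ.decrement_sq hy]
  set l := decrement R.fn y
  have hξ : 0 ≤ l ^ 2 / (1 + l) := by positivity
  rw [show -(1 / (1 + l ^ 2 / (1 + l))) * -(1 / (1 + l ^ 2 / (1 + l))) * l ^ 2
    = (l / (1 + l ^ 2 / (1 + l))) ^ 2 by generalize 1 + l ^ 2 / (1 + l) = q; ring]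
  rw [sq_lt_one_iff₀ (by positivity), div_lt_one (by positivity)]
  linarith

/-- One factor `l²` bounds the new gradient in the old local norm, and `1 + r ≤ 1 + l` is the price
of passing to the new local norm. Testing the new gradient on the new Newton direction gives the
square of the new decrement. -/
theorem IsDomain.decrement_intermediateStep_le (h1 : decrement R.fn y < 1) :
    decrement R.fn (intermediateStep R.fn y) ≤
      (1 + decrement R.fn y) * decrement R.fn y ^ 2 := by
  have h0 := decrement_nonneg R.fn y
  have hz := hQ.intermediateStep_mem hy h1
  set l := decrement R.fn y with hl
  set ξ := l ^ 2 / (1 + l) with hξ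
  have hξ0 : 0 ≤ ξ := by positivity
  set z := intermediateStep R.fn y with hzdef
  set p := newtonDir R.fn y with hp
  have hzy : z = y + (-(1 / (1 + ξ))) • p := by rw [hzdef, intermediateStep, step_eq]
  set r := l / (1 + ξ) with hr
  have hr0 : 0 ≤ r := by positivity
  have hrl : r ≤ l := div_le_self h0 (by linarith)
  set v := (-(1 / (1 + ξ))) • p with hv
  have hvv : R.form y v v = r ^ 2 := by
    rw [hv, form_smul_smul, ← hQ.decrement_sq hy, hr, ← hl]
    generalize 1 + ξ = q
    ring
  have hξl : ξ * (1 + l) = l ^ 2 := by rw [hξ]; field_simp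
  have hrξ : r * (1 + ξ) = l := by rw [hr]; field_simp
  -- the gradient at the new point in the old local norm
  have hgrad : ∀ h : Vec d, grad R.fn z ⬝ᵥ h ≤ l ^ 2 * √(R.form y h h) := by
    intro h
    have e1 : grad R.fn z ⬝ᵥ h = ∑ k, (R.φ₁ k (R.arg k z) - R.φ₁ k (R.arg k y)
        - (1 + ξ) * (R.φ₂ k (R.arg k y) * (R.g k ⬝ᵥ v))) * (R.g k ⬝ᵥ h) := by
      simp only [sub_mul, Finset.sum_sub_distrib]
      rw [← hQ.grad_dot hz, ← hQ.grad_dot hy, ← hQ.form_newtonDir hy]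
      have : ∑ k, (1 + ξ) * (R.φ₂ k (R.arg k y) * (R.g k ⬝ᵥ v)) * (R.g k ⬝ᵥ h)
          = - R.form y h p := by
        rw [form, ← Finset.sum_neg_distrib]
        refine Finset.sum_congr rfl fun k _ => ?_
        rw [hv, dotProduct_smul, smul_eq_mul]
        field_simp
      rw [this]; ring
    have e2 : ∑ k, (R.φ₁ k (R.arg k z) - R.φ₁ k (R.arg k y)
        - (1 + ξ) * (R.φ₂ k (R.arg k y) * (R.g k ⬝ᵥ v))) * (R.g k ⬝ᵥ h) ≤
        ∑ k, (1 + ξ) * l * (R.φ₂ k (R.arg k y) * (|R.g k ⬝ᵥ v| * |R.g k ⬝ᵥ h|)) := by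
      refine Finset.sum_le_sum fun k _ => ?_
      have hs : R.arg k z - R.arg k y = R.g k ⬝ᵥ v := by rw [hzy, arg_add]; ring
      obtain ⟨θ, ht, ht1, ht2⟩ := (R.sc k).slope _ (hQ.mem y hy k) _ (hQ.mem z hz k) r hr0
        (by linarith) (by rw [hs, ← hvv]; exact hQ.term_le_form hy k v)
      rw [ht, hs, ← sub_mul]
      -- Here `ξ = l² / (1 + l)` pays off: `1 + ξ - l = 1 / (1 + l)`, so that `1 / (1 - r)` equals
      -- `(1 + ξ)(1 + l)` exactly.
      have hθ : |θ - (1 + ξ)| ≤ (1 + ξ) * l := by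
        have a1 : 1 / (1 - r) = (1 + ξ) * (1 + l) := by
          rw [div_eq_iff (by linarith)]
          linear_combination (1 + l) * hrξ - hξl
        have a2 : 1 + ξ - l ≤ 1 / (1 + r) := by
          have : 1 + ξ - l = 1 / (1 + l) := by rw [hξ]; field_simp; ring
          rw [this]
          gcongr
        rw [abs_le]
        constructor
        · nlinarith [mul_nonneg hξ0 h0]
        · rw [a1] at ht2; linarith
      have hφ := hQ.φ₂_nonneg hy k
      calc _ ≤ |(θ - (1 + ξ)) * (R.φ₂ k (R.arg k y) * (R.g k ⬝ᵥ v)) * (R.g k ⬝ᵥ h)| :=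
            le_abs_self _
        _ = |θ - (1 + ξ)| * (R.φ₂ k (R.arg k y) * (|R.g k ⬝ᵥ v| * |R.g k ⬝ᵥ h|)) := by
            rw [abs_mul, abs_mul, abs_mul, abs_of_nonneg hφ]; ring
        _ ≤ _ := by gcongr
    have e3 := hQ.sum_abs_le hy v h
    rw [hvv, Real.sqrt_sq hr0] at e3
    rw [e1]
    refine e2.trans ?_
    rw [← Finset.mul_sum]
    calc _ ≤ (1 + ξ) * l * (r * √(R.form y h h)) := by gcongr
      _ = _ := by rw [show (1 + ξ) * l * (r * √(R.form y h h)) = (r * (1 + ξ)) * l * √(R.form y h h)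
                    by ring, hrξ]; ring
  have hnorm : ∀ h : Vec d, √(R.form y h h) ≤ (1 + r) * √(R.form z h h) := by
    intro h
    rw [show (1 + r) * √(R.form z h h) = √((1 + r) ^ 2 * R.form z h h) by
      rw [Real.sqrt_mul (by positivity), Real.sqrt_sq (by positivity)]]
    apply Real.sqrt_le_sqrt
    rw [form, form, Finset.mul_sum]
    refine Finset.sum_le_sum fun k _ => ?_
    have hs : R.arg k z - R.arg k y = R.g k ⬝ᵥ v := by rw [hzy, arg_add]; ring
    rw [← mul_assoc ((1 + r) ^ 2)]
    exact mul_le_mul_of_nonneg_right ((R.sc k).ratio _ (hQ.mem y hy k) _ (hQ.mem z hz k) r hr0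
      (by rw [hs, ← hvv]; exact hQ.term_le_form hy k v)) (mul_self_nonneg _)
  have h2 := hgrad (newtonDir R.fn z)
  rw [← hQ.form_newtonDir hz, ← hQ.decrement_sq hz] at h2
  have h3 := hnorm (newtonDir R.fn z)
  rw [← hQ.decrement_eq hz] at h3
  have h4 : decrement R.fn z * decrement R.fn z ≤ ((1 + l) * l ^ 2) * decrement R.fn z := by
    have hz0 := decrement_nonneg R.fn z
    calc _ = decrement R.fn z ^ 2 := by ring
      _ ≤ l ^ 2 * √(R.form y (newtonDir R.fn z) (newtonDir R.fn z)) := h2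
      _ ≤ l ^ 2 * ((1 + r) * decrement R.fn z) := by gcongr
      _ ≤ l ^ 2 * ((1 + l) * decrement R.fn z) := by gcongr
      _ = _ := by ring
  rcases (decrement_nonneg R.fn z).eq_or_lt with h | h
  · rw [← h]; positivity
  · exact le_of_mul_le_mul_right h4 h

end

end RidgeSum

end

/-! ### The barrier function: self-concordance, accuracy, and change of the barrier parameter -/

noncomputable section

namespace RidgeSum

variable {d : ℕ} {ι : Type} {R : RidgeSum d ι} [Fintype ι] {Q : Set (Vec d)}

/-- The Newton equation tested on `z - y` and left as a sum, so that the objective part can be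
replaced by minus the barrier part. -/
theorem IsDomain.sum_newton (hQ : R.IsDomain Q) {y : Vec d} (hy : y ∈ Q) (z : Vec d) :
    ∑ k, (R.φ₁ k (R.arg k y) * (R.arg k z - R.arg k y) -
      R.φ₂ k (R.arg k y) * (R.g k ⬝ᵥ newtonDir R.fn y) * (R.arg k z - R.arg k y)) = 0 := by
  rw [Finset.sum_sub_distrib, sub_eq_zero]
  simp only [arg_sub_arg]
  rw [← hQ.grad_dot hy, ← hQ.form_newtonDir hy]
  exact Finset.sum_congr rfl fun k _ => by ring

end RidgeSum

variable {d : ℕ} [NeZero d] {b lam : Vec d}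

/-- The assumptions on `b` and `λ`. -/
structure IsData (b lam : Vec d) : Prop where
  lam_pos : ∀ i, 0 < lam i
  antitone : Antitone lam
  b_ne : ∃ i, b i ≠ 0

theorem dot_self_nonneg {d : ℕ} (v : Vec d) : 0 ≤ v ⬝ᵥ v :=
  Finset.sum_nonneg fun i _ => mul_self_nonneg (v i)

theorem l2norm_sq {d : ℕ} (v : Vec d) : l2norm v ^ 2 = ∑ i, v i ^ 2 := by
  rw [l2norm, Real.sq_sqrt (dot_self_nonneg v), dotProduct]
  exact Finset.sum_congr rfl fun i _ => by ring

theorem l2norm_nonneg {d : ℕ} (v : Vec d) : 0 ≤ l2norm v := Real.sqrt_nonneg _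

namespace IsData

variable (h : IsData b lam)
include h

theorem lamMin_pos : 0 < lamMin lam := h.lam_pos _

theorem lamMin_le (i : Fin d) : lamMin lam ≤ lam i := by
  apply h.antitone
  rw [Fin.le_def]
  simp only [lastIdx]
  have := i.isLt
  omega

theorem radius_pos : 0 < radius b lam := by
  have := l2norm_nonneg b
  have := Real.sqrt_pos.2 h.lamMin_pos
  rw [radius]; positivity

omit h in
theorem lowerB_nonneg (i : Fin d) : 0 ≤ lowerB b lam i := sq_nonneg _

theorem lowerB_pos {i : Fin d} (hi : b i ≠ 0) : 0 < lowerB b lam i := by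
  have := h.radius_pos
  rw [lowerB]; positivity

omit h in
theorem sum_lowerB : ∑ i, lowerB b lam i = l2norm b ^ 2 / radius b lam ^ 2 := by
  simp only [lowerB, div_pow, l2norm_sq, Finset.sum_div]

theorem tInit_ge {i : Fin d} (hi : b i ≠ 0) : 9 ≤ tInit b lam * (|b i| * √(lowerB b lam i)) := by
  have hB := Real.sqrt_pos.2 (h.lowerB_pos hi)
  have hb := abs_pos.2 hi
  have h1 : 1 / √((b i) ^ 2 * lowerB b lam i) ≤
      ⨆ i : {i : Fin d // b i ≠ 0}, 1 / √((b i) ^ 2 * lowerB b lam i) :=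
    le_ciSup (f := fun i : {i : Fin d // b i ≠ 0} => 1 / √((b i) ^ 2 * lowerB b lam i))
      (Set.finite_range _).bddAbove ⟨i, hi⟩
  rw [Real.sqrt_mul (sq_nonneg _), Real.sqrt_sq_eq_abs] at h1
  have h2 : 9 * (1 / (|b i| * √(lowerB b lam i))) ≤ tInit b lam := by
    rw [tInit]
    gcongr
    exact h1.trans (le_max_left _ _)
  calc (9 : ℝ) = 9 * (1 / (|b i| * √(lowerB b lam i))) * (|b i| * √(lowerB b lam i)) := by
        field_simp
    _ ≤ _ := by gcongr

/-- One index suffices here, since a single term bounds `∑ y_i / λ_i` from below. This is why `t₀`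
has a minimum in its second entry but a maximum in the first. -/
theorem tInit_ge' : ∃ i, b i ≠ 0 ∧ 9 ≤ tInit b lam * √(1 / lam i * lowerB b lam i) := by
  have : Nonempty {i : Fin d // b i ≠ 0} := by
    obtain ⟨i, hi⟩ := h.b_ne; exact ⟨⟨i, hi⟩⟩
  obtain ⟨⟨i, hi⟩, hi'⟩ := exists_eq_ciInf_of_finite
    (f := fun i : {i : Fin d // b i ≠ 0} => 1 / √((1 / lam i) * lowerB b lam i))
  refine ⟨i, hi, ?_⟩
  have hB := h.lowerB_pos hi
  have hl := h.lam_pos i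
  have hpos : 0 < √(1 / lam i * lowerB b lam i) := Real.sqrt_pos.2 (by positivity)
  have h2 : 9 * (1 / √(1 / lam i * lowerB b lam i)) ≤ tInit b lam := by
    rw [tInit]
    gcongr
    exact (le_of_eq hi').trans (le_max_right _ _)
  calc (9 : ℝ) = 9 * (1 / √(1 / lam i * lowerB b lam i)) * √(1 / lam i * lowerB b lam i) := by
        field_simp
    _ ≤ _ := by gcongr

theorem tInit_pos : 0 < tInit b lam := by
  obtain ⟨i, hi, h9⟩ := h.tInit_ge'
  by_contra hc
  have := mul_nonpos_of_nonpos_of_nonneg (not_lt.1 hc) (Real.sqrt_nonneg (1 / lam i * lowerB b lam i))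
  linarith

end IsData

/-- The domain of the barrier function. -/
def barrierDom (b lam : Vec d) : Set (Vec d) := {y | (∀ i, lowerB b lam i < y i) ∧ ∑ i, y i < 1}

/-- The minimizer of `F` may lie on the boundary, where the logarithms of the barrier are useless
but the objective summands still satisfy their estimates. -/
def closedDom (b lam : Vec d) : Set (Vec d) := {y | (∀ i, lowerB b lam i ≤ y i) ∧ ∑ i, y i ≤ 1}

theorem barrierDom_subset : barrierDom b lam ⊆ closedDom b lam :=
  fun _ hy => ⟨fun i => (hy.1 i).le, hy.2.le⟩

/-- The index set: first the summands of the objective, then those of the barrier. -/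
abbrev Idx (d : ℕ) := (Fin d ⊕ Unit) ⊕ (Fin d ⊕ Unit)

/-- `F^{(t)}` as a sum of functions of affine forms. -/
def ridge (b lam : Vec d) {t : ℝ} (ht : 0 ≤ t) : RidgeSum d (Idx d) where
  φ := Sum.elim (Sum.elim (fun i s => -(t * |b i| * √s)) (fun _ s => -(t * √s)))
    (fun _ s => -Real.log s)
  φ₁ := Sum.elim (Sum.elim (fun i s => -(t * |b i| / (2 * √s))) (fun _ s => -(t / (2 * √s))))
    (fun _ s => -(1 / s))
  φ₂ := Sum.elim (Sum.elim (fun i s => t * |b i| / (4 * (s * √s))) (fun _ s => t / (4 * (s * √s))))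
    (fun _ s => 1 / s ^ 2)
  D := Sum.elim (Sum.elim (fun i => {s | t * |b i| = 0 ∨ (0 < s ∧ 9 ≤ t * |b i| * √s)})
    (fun _ => {s | t = 0 ∨ (0 < s ∧ 9 ≤ t * √s)})) (fun _ => Set.Ioi 0)
  sc := by
    rintro ((i | _) | _)
    · exact scalarSC_negSqrt (by positivity)
    · exact scalarSC_negSqrt ht
    · exact scalarSC_negLog
  g := Sum.elim (Sum.elim (fun i => Pi.single i 1) (fun _ i => 1 / lam i))
    (Sum.elim (fun i => Pi.single i 1) (fun _ _ => -1))
  c := Sum.elim (fun _ => 0) (Sum.elim (fun i => -lowerB b lam i) (fun _ => 1))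

section
variable {t : ℝ} (ht : 0 ≤ t) (y : Vec d)

@[simp] theorem ridge_arg_obj (i : Fin d) : (ridge b lam ht).arg (.inl (.inl i)) y = y i := by
  simp [ridge, RidgeSum.arg]

@[simp] theorem ridge_arg_obj' (u : Unit) :
    (ridge b lam ht).arg (.inl (.inr u)) y = ∑ i, 1 / lam i * y i := by
  simp [ridge, RidgeSum.arg, dotProduct]

@[simp] theorem ridge_arg_bar (i : Fin d) :
    (ridge b lam ht).arg (.inr (.inl i)) y = y i - lowerB b lam i := by
  simp [ridge, RidgeSum.arg, sub_eq_add_neg]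

@[simp] theorem ridge_arg_bar' (u : Unit) :
    (ridge b lam ht).arg (.inr (.inr u)) y = 1 - ∑ i, y i := by
  simp [ridge, RidgeSum.arg, dotProduct]; ring

theorem sum_obj_ridge :
    ∑ k, (ridge b lam ht).φ (.inl k) ((ridge b lam ht).arg (.inl k) y) = t * objF b lam y := by
  rw [Fintype.sum_sum_type]
  simp only [ridge_arg_obj, ridge_arg_obj']
  simp only [ridge, Sum.elim_inl, Sum.elim_inr, objF, Finset.univ_unique, Finset.sum_singleton,
    Finset.sum_neg_distrib, mul_assoc, ← Finset.mul_sum]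
  ring

theorem sum_bar_ridge (t' : ℝ) :
    t' * objF b lam y + ∑ k, -Real.log ((ridge b lam ht).arg (.inr k) y) = objFt b lam t' y := by
  rw [Fintype.sum_sum_type]
  simp only [ridge_arg_bar, ridge_arg_bar', objFt, Finset.univ_unique, Finset.sum_singleton,
    Finset.sum_neg_distrib]
  ring

theorem objFt_eq : objFt b lam t = (ridge b lam ht).fn := by
  funext y
  rw [RidgeSum.fn, Fintype.sum_sum_type, sum_obj_ridge, ← sum_bar_ridge ht y t]
  simp [ridge]

end

namespace IsData

variable (h : IsData b lam) {t : ℝ} (ht : tInit b lam ≤ t)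
include h ht

theorem nonneg_of_tInit_le : 0 ≤ t := h.tInit_pos.le.trans ht

theorem mem_obj {y : Vec d} (hy : y ∈ closedDom b lam) (k : Fin d ⊕ Unit) :
    (ridge b lam (h.nonneg_of_tInit_le ht)).arg (.inl k) y ∈
      (ridge b lam (h.nonneg_of_tInit_le ht)).D (.inl k) := by
  have hy0 : ∀ i, 0 ≤ y i := fun i => (lowerB_nonneg i).trans (hy.1 i)
  rcases k with i | u
  · rw [ridge_arg_obj]
    simp only [ridge, Sum.elim_inl, Set.mem_ofPred_eq]
    by_cases hi : b i = 0
    · left; simp [hi]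
    · right
      refine ⟨(h.lowerB_pos hi).trans_le (hy.1 i), (h.tInit_ge hi).trans ?_⟩
      rw [← mul_assoc]
      have := hy.1 i
      have := h.nonneg_of_tInit_le ht
      gcongr
  · rw [ridge_arg_obj']
    simp only [ridge, Sum.elim_inl, Sum.elim_inr, Set.mem_ofPred_eq]
    right
    obtain ⟨i, hi, h9⟩ := h.tInit_ge'
    have hl := h.lam_pos
    have h1 : 1 / lam i * lowerB b lam i ≤ ∑ i, 1 / lam i * y i := by
      have h2 := hy.1 i
      have h3 := hl i
      refine le_trans ?_ (Finset.single_le_sum (f := fun i => 1 / lam i * y i)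
        (fun j _ => ?_) (Finset.mem_univ i))
      · gcongr
      · have := hl j; have := hy0 j; positivity
    have h0 : 0 < 1 / lam i * lowerB b lam i := by
      have := hl i; have := h.lowerB_pos hi; positivity
    refine ⟨h0.trans_le h1, h9.trans ?_⟩
    gcongr
    exact h.nonneg_of_tInit_le ht

omit h ht in
theorem arg_bar_pos {y : Vec d} (hy : y ∈ barrierDom b lam) (ht : 0 ≤ t) (k : Fin d ⊕ Unit) :
    0 < (ridge b lam ht).arg (.inr k) y := by
  rcases k with i | u
  · rw [ridge_arg_bar]; linarith [hy.1 i]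
  · rw [ridge_arg_bar']; linarith [hy.2]

omit h ht in
theorem mem_barrierDom {y : Vec d} (ht : 0 ≤ t)
    (hy : ∀ k, 0 < (ridge b lam ht).arg (.inr k) y) : y ∈ barrierDom b lam := by
  constructor
  · intro i
    have := hy (.inl i)
    rw [ridge_arg_bar] at this; linarith
  · have := hy (.inr ())
    rw [ridge_arg_bar'] at this; linarith

/-- The barrier summands alone give both properties: a local length below 1 keeps every `1 / s² * (g
⬝ᵥ v)²` below 1, so no slack `s` changes sign, and the slacks `y i - B i` make the Hessian
nondegenerate. -/
theorem isDomain : (ridge b lam (h.nonneg_of_tInit_le ht)).IsDomain (barrierDom b lam) := by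
  have ht0 := h.nonneg_of_tInit_le ht
  have mem : ∀ y ∈ barrierDom b lam, ∀ k, (ridge b lam ht0).arg k y ∈ (ridge b lam ht0).D k := by
    rintro y hy (k | k)
    · exact h.mem_obj ht (barrierDom_subset hy) k
    · exact arg_bar_pos hy ht0 k
  have φ₂_nn : ∀ y ∈ barrierDom b lam, ∀ k, 0 ≤ (ridge b lam ht0).φ₂ k ((ridge b lam ht0).arg k y) :=
    fun y hy k => ((ridge b lam ht0).sc k).nonneg _ (mem y hy k)
  have term : ∀ y ∈ barrierDom b lam, ∀ v k, 1 / (ridge b lam ht0).arg (.inr k) y ^ 2 *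
      ((ridge b lam ht0).g (.inr k) ⬝ᵥ v) ^ 2 ≤ (ridge b lam ht0).form y v v := by
    intro y hy v k
    have := Finset.single_le_sum (f := fun k => (ridge b lam ht0).φ₂ k ((ridge b lam ht0).arg k y) *
      (((ridge b lam ht0).g k ⬝ᵥ v) * ((ridge b lam ht0).g k ⬝ᵥ v)))
      (fun k _ => mul_nonneg (φ₂_nn y hy k) (mul_self_nonneg _)) (Finset.mem_univ (.inr k))
    rw [pow_two (_ ⬝ᵥ _)]
    exact this
  refine ⟨?_, mem, ?_, ?_⟩
  · have e : barrierDom b lam = (⋂ i, {y : Vec d | lowerB b lam i < y i}) ∩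
        {y : Vec d | ∑ i, y i < 1} := by
      ext y; simp [barrierDom]
    rw [e]
    refine (isOpen_iInter_of_finite fun i => ?_).inter ?_
    · exact isOpen_lt continuous_const (continuous_apply i)
    · exact isOpen_lt (by fun_prop) continuous_const
  · intro y hy v hv
    apply mem_barrierDom ht0
    intro k
    have hk := arg_bar_pos hy ht0 k
    have h1 := (term y hy v k).trans_lt hv
    rw [one_div, inv_mul_lt_iff₀ (by positivity), mul_one] at h1
    have h2 := (abs_lt.1 (abs_lt_of_sq_lt_sq h1 hk.le)).1
    rw [RidgeSum.arg_add]
    linarith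
  · intro y hy v hv
    funext i
    have h1 := term y hy v (.inl i)
    have hk := arg_bar_pos hy ht0 (.inl i)
    rw [hv, one_div, inv_mul_le_iff₀ (by positivity), mul_zero] at h1
    have h2 : (ridge b lam ht0).g (.inr (.inl i)) ⬝ᵥ v = v i := by simp [ridge]
    rw [h2] at h1
    exact pow_eq_zero_iff two_ne_zero |>.1 (le_antisymm h1 (sq_nonneg _))

section
variable {y : Vec d} (hy : y ∈ barrierDom b lam) (h1 : decrement (objFt b lam t) y < 1)
include hy h1

/-- The Newton direction in units of the distance to the boundary. -/
theorem exists_relative_dir : ∃ P : Fin d ⊕ Unit → ℝ,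
    (∀ k, |P k| ≤ decrement (objFt b lam t) y) ∧
    |∑ k, P k| ≤ √((d : ℝ) + 1) * decrement (objFt b lam t) y ∧
    ∀ z ∈ closedDom b lam, ∀ ht0 : 0 ≤ t,
      t * objF b lam y - t * objF b lam z + ∑ k, P k ^ 2 / (2 * (1 - decrement (objFt b lam t) y)) ≤
        decrement (objFt b lam t) y ^ 2 / (2 * (1 - decrement (objFt b lam t) y)) +
        ∑ k, (1 + P k) * (1 - (ridge b lam ht0).arg (.inr k) z / (ridge b lam ht0).arg (.inr k) y) := by
  have ht0 := h.nonneg_of_tInit_le ht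
  have hQ := h.isDomain ht
  set R := ridge b lam ht0 with hR
  rw [objFt_eq ht0] at *
  set l := decrement R.fn y with hl
  set p := newtonDir R.fn y with hp
  set P : Fin d ⊕ Unit → ℝ := fun k => (R.g (.inr k) ⬝ᵥ p) / R.arg (.inr k) y with hP
  have hl0 : 0 ≤ l := decrement_nonneg _ _
  have hsplit : l ^ 2 = ∑ k, R.φ₂ (.inl k) (R.arg (.inl k) y) * (R.g (.inl k) ⬝ᵥ p) ^ 2 +
      ∑ k, P k ^ 2 := by
    rw [hl, hQ.decrement_sq hy, RidgeSum.form, Fintype.sum_sum_type]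
    congr 1
    · exact Finset.sum_congr rfl fun k _ => by ring
    · refine Finset.sum_congr rfl fun k _ => ?_
      have e2 : R.φ₂ (.inr k) (R.arg (.inr k) y) = 1 / R.arg (.inr k) y ^ 2 := rfl
      rw [e2, hP, div_pow, ← pow_two, one_div, inv_mul_eq_div]
  have hP2 : ∑ k, P k ^ 2 ≤ l ^ 2 := by
    rw [hsplit, le_add_iff_nonneg_left]
    exact Finset.sum_nonneg fun k _ => mul_nonneg (hQ.φ₂_nonneg hy _) (sq_nonneg _)
  refine ⟨P, fun k => ?_, ?_, ?_⟩
  · apply abs_le_of_sq_le_sq _ hl0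
    exact (Finset.single_le_sum (f := fun k => P k ^ 2) (fun k _ => sq_nonneg _)
      (Finset.mem_univ k)).trans hP2
  · apply abs_le_of_sq_le_sq _ (by positivity)
    rw [mul_pow, Real.sq_sqrt (by positivity)]
    refine (sq_sum_le_card_mul_sum_sq (s := Finset.univ) (f := P)).trans ?_
    simp only [Finset.card_univ, Fintype.card_sum, Fintype.card_fin, Fintype.card_unit]
    push_cast
    gcongr
  · intro z hz _
    -- This lets `bregman` be applied to the objective summands only; their linear terms are
    -- expressed through the slacks.
    have hsum := hQ.sum_newton hy z
    rw [Fintype.sum_sum_type] at hsum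
    have hbar : ∑ k, (R.φ₁ (.inr k) (R.arg (.inr k) y) * (R.arg (.inr k) z - R.arg (.inr k) y) -
        R.φ₂ (.inr k) (R.arg (.inr k) y) * (R.g (.inr k) ⬝ᵥ p) *
          (R.arg (.inr k) z - R.arg (.inr k) y)) =
        -∑ k, (1 + P k) * (R.arg (.inr k) z / R.arg (.inr k) y - 1) := by
      rw [← Finset.sum_neg_distrib]
      refine Finset.sum_congr rfl fun k _ => ?_
      have hs : 0 < R.arg (.inr k) y := arg_bar_pos hy ht0 k
      have e1 : R.φ₁ (.inr k) (R.arg (.inr k) y) = -(1 / R.arg (.inr k) y) := rfl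
      have e2 : R.φ₂ (.inr k) (R.arg (.inr k) y) = 1 / R.arg (.inr k) y ^ 2 := rfl
      rw [e1, e2]
      simp only [hP]
      generalize R.arg (.inr k) y = s at hs
      generalize R.arg (.inr k) z = s'
      generalize R.g (.inr k) ⬝ᵥ p = q
      field_simp
      ring
    rw [hbar] at hsum
    have hobj := Finset.sum_le_sum (s := Finset.univ) fun k _ => (R.sc (.inl k)).bregman _
      (hQ.mem y hy _) _ (h.mem_obj ht hz k) l (R.g (.inl k) ⬝ᵥ p) hl0 h1
      (by rw [hl, hQ.decrement_sq hy]; exact hQ.term_le_form hy _ _)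
    rw [← Finset.sum_div] at hobj
    simp only [add_sub_assoc] at hobj
    rw [Finset.sum_add_distrib, Finset.sum_sub_distrib, sum_obj_ridge, sum_obj_ridge] at hobj
    have h2 : l ^ 2 / (2 * (1 - l)) = (∑ k, R.φ₂ (.inl k) (R.arg (.inl k) y) *
        (R.g (.inl k) ⬝ᵥ p) ^ 2) / (2 * (1 - l)) + (∑ k, P k ^ 2) / (2 * (1 - l)) := by
      rw [← add_div, ← hsplit]
    have h3 : ∑ k, (1 + P k) * (1 - R.arg (.inr k) z / R.arg (.inr k) y) =
        -∑ k, (1 + P k) * (R.arg (.inr k) z / R.arg (.inr k) y - 1) := by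
      rw [← Finset.sum_neg_distrib]
      exact Finset.sum_congr rfl fun k _ => by ring
    change _ ≤ _ + ∑ k, (1 + P k) * (1 - R.arg (.inr k) z / R.arg (.inr k) y)
    rw [h3]
    rw [← Finset.sum_div]
    linarith

/-- Suboptimality of an approximately centered point. -/
theorem accuracy {z : Vec d} (hz : z ∈ closedDom b lam) :
    t * (objF b lam y - objF b lam z) ≤ ((d : ℝ) + 1) +
      √((d : ℝ) + 1) * decrement (objFt b lam t) y +
      decrement (objFt b lam t) y ^ 2 / (2 * (1 - decrement (objFt b lam t) y)) := by
  have ht0 := h.nonneg_of_tInit_le ht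
  obtain ⟨P, hP, hPs, hPz⟩ := h.exists_relative_dir ht hy h1
  have h2 := hPz z hz ht0
  set l := decrement (objFt b lam t) y
  have h1l : 0 < 1 - l := by linarith
  have h3 : 0 ≤ ∑ k, P k ^ 2 / (2 * (1 - l)) := Finset.sum_nonneg fun k _ => by positivity
  -- The slacks of `z` are nonnegative and `1 + P k ≥ 0`, so the quotients can be dropped; what is
  -- left is `d + 1` plus `∑ P k`.
  have h4 : ∑ k, (1 + P k) * (1 - (ridge b lam ht0).arg (.inr k) z /
      (ridge b lam ht0).arg (.inr k) y) ≤ ∑ k, (1 + P k) := by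
    refine Finset.sum_le_sum fun k _ => ?_
    have hPk : 0 ≤ 1 + P k := by have := (abs_le.1 (hP k)).1; linarith
    have hz0 : 0 ≤ (ridge b lam ht0).arg (.inr k) z := by
      rcases k with i | u
      · rw [ridge_arg_bar]; linarith [hz.1 i]
      · rw [ridge_arg_bar']; linarith [hz.2]
    have := div_nonneg hz0 (arg_bar_pos hy ht0 k).le
    nlinarith
  have h5 : ∑ k, (1 + P k) = (d : ℝ) + 1 + ∑ k, P k := by
    rw [Finset.sum_add_distrib]
    simp
  have h6 := (abs_le.1 hPs).2
  linarith

/-- Suboptimality of an approximately centered point after the update of the barrier parameter. -/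
theorem path_step {z : Vec d} (hz : z ∈ barrierDom b lam) {η : ℝ} (hη : 1 < η) :
    objFt b lam (η * t) y - objFt b lam (η * t) z ≤ ((d : ℝ) + 1) * (η - 1 - Real.log η) +
      (η - 1) * √((d : ℝ) + 1) * decrement (objFt b lam t) y +
      η * (decrement (objFt b lam t) y ^ 2 / (2 * (1 - decrement (objFt b lam t) y))) := by
  have ht0 := h.nonneg_of_tInit_le ht
  obtain ⟨P, hP, hPs, hPz⟩ := h.exists_relative_dir ht hy h1
  have h2 := hPz z (barrierDom_subset hz) ht0
  set l := decrement (objFt b lam t) y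
  have h1l : 0 < 1 - l := by linarith
  have hη0 : 0 < η := by linarith
  rw [← sum_bar_ridge ht0 y, ← sum_bar_ridge ht0 z]
  set s := fun k => (ridge b lam ht0).arg (.inr k) y
  set s' := fun k => (ridge b lam ht0).arg (.inr k) z
  have key : ∑ k, (-Real.log (s k) + Real.log (s' k) + η * ((1 + P k) * (1 - s' k / s k))) ≤
      ∑ k, (η - 1 - Real.log η + (η - 1) * P k + P k ^ 2 / (2 * (1 - l))) := by
    refine Finset.sum_le_sum fun k _ => ?_
    have hs : 0 < s k := arg_bar_pos hy ht0 k
    have hs' : 0 < s' k := arg_bar_pos hz ht0 k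
    have hPk : 0 < 1 + P k := by have := (abs_le.1 (hP k)).1; linarith
    have e1 := sub_log_one_add_le h1 (hP k)
    -- The tangent to the logarithm at 1 eliminates the unknown ratio `s' k / s k` and leaves `η(1 +
    -- P) - 1 - log η - log (1 + P)`.
    have e2 := Real.log_le_sub_one_of_pos (x := η * (s' k / s k) * (1 + P k)) (by positivity)
    rw [Real.log_mul (by positivity) hPk.ne', Real.log_mul hη0.ne' (by positivity),
      Real.log_div hs'.ne' hs.ne'] at e2
    linarith
  simp only [Finset.sum_add_distrib, Finset.sum_neg_distrib, ← Finset.mul_sum] at key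
  have h5 : ∑ _k : Fin d ⊕ Unit, (η - 1 - Real.log η) = ((d : ℝ) + 1) * (η - 1 - Real.log η) := by
    simp [-Finset.sum_sub_distrib]
  rw [h5] at key
  have h6 := (abs_le.1 hPs).2
  have h7 : (η - 1) * ∑ k, P k ≤ (η - 1) * (√((d : ℝ) + 1) * l) := by
    gcongr
  have h8 : 0 ≤ ∑ k, P k ^ 2 / (2 * (1 - l)) := Finset.sum_nonneg fun k _ => by positivity
  have h9 := mul_le_mul_of_nonneg_left h2 hη0.le
  simp only [Finset.sum_neg_distrib]
  -- The quadratic terms in `P` from `key` are outweighed by `η` times those on the left of `h2`.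
  have h10 : 0 ≤ (η - 1) * ∑ k, P k ^ 2 / (2 * (1 - l)) := mul_nonneg (by linarith) h8
  linarith

end

end IsData

end

/-! ### The initial gap, and localization of the optimum -/

noncomputable section

variable {d : ℕ} [NeZero d] {b lam : Vec d}

namespace IsData

variable (h : IsData b lam)
include h

omit h [NeZero d] in
theorem objF_nonpos (y : Vec d) : objF b lam y ≤ 0 := by
  have h1 : 0 ≤ ∑ i, |b i| * √(y i) := Finset.sum_nonneg fun i _ => by positivity
  have h2 := Real.sqrt_nonneg (∑ i, 1 / lam i * y i)
  rw [objF]; linarith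

theorem neg_radius_le_objF {y : Vec d} (hy : ∀ i, 0 ≤ y i) (hy1 : ∑ i, y i ≤ 1) :
    -radius b lam ≤ objF b lam y := by
  have h1 : ∑ i, |b i| * √(y i) ≤ l2norm b := by
    refine (Real.sum_mul_le_sqrt_mul_sqrt _ _ _).trans ?_
    have e1 : ∑ i, |b i| ^ 2 = l2norm b ^ 2 := by
      rw [l2norm_sq]; exact Finset.sum_congr rfl fun i _ => sq_abs _
    have e2 : ∑ i, √(y i) ^ 2 = ∑ i, y i := Finset.sum_congr rfl fun i _ => Real.sq_sqrt (hy i)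
    rw [e1, e2, Real.sqrt_sq (l2norm_nonneg b)]
    exact mul_le_of_le_one_right (l2norm_nonneg b) (Real.sqrt_le_one.2 hy1)
  have h2 : √(∑ i, 1 / lam i * y i) ≤ 1 / √(lamMin lam) := by
    rw [one_div, ← Real.sqrt_inv]
    apply Real.sqrt_le_sqrt
    calc ∑ i, 1 / lam i * y i ≤ ∑ i, 1 / lamMin lam * y i := by
          refine Finset.sum_le_sum fun i _ => mul_le_mul_of_nonneg_right ?_ (hy i)
          exact one_div_le_one_div_of_le h.lamMin_pos (h.lamMin_le i)
      _ = 1 / lamMin lam * ∑ i, y i := by rw [Finset.mul_sum]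
      _ ≤ 1 / lamMin lam * 1 := by
          have := h.lamMin_pos
          gcongr
      _ = _ := by rw [mul_one, one_div]
  rw [objF, radius]; linarith

theorem initY_sub (i : Fin d) :
    initY b lam i - lowerB b lam i = (2 * d * lamMin lam * radius b lam ^ 2)⁻¹ := by
  have := h.lamMin_pos
  have := h.radius_pos
  have : (0 : ℝ) < d := by exact_mod_cast NeZero.pos d
  rw [initY]; field_simp; ring

/-- From `ρ√λ_d = ‖b‖√λ_d + 1` one gets `λ_d ρ² - λ_d ‖b‖² = 2√λ_d ‖b‖ + 1`. The additions to `B_i`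
in `y⁰` use up one half, which leaves the `1/2` in the denominator of `Γ`. -/
theorem one_sub_sum_initY : 1 - ∑ i, initY b lam i =
    (lamMin lam * radius b lam ^ 2 / (2 * √(lamMin lam) * l2norm b + 1 / 2))⁻¹ := by
  have hl := h.lamMin_pos
  have hr := h.radius_pos
  have hd : (0 : ℝ) < d := by exact_mod_cast NeZero.pos d
  have hs := Real.sqrt_pos.2 hl
  have hb := l2norm_nonneg b
  have e : ∑ i, initY b lam i =
      l2norm b ^ 2 / radius b lam ^ 2 + d * (2 * d * lamMin lam * radius b lam ^ 2)⁻¹ := by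
    rw [← sum_lowerB]
    have : ∀ i, initY b lam i = lowerB b lam i + (2 * d * lamMin lam * radius b lam ^ 2)⁻¹ :=
      fun i => by rw [← h.initY_sub i]; ring
    simp only [this, Finset.sum_add_distrib, Finset.sum_const, Finset.card_univ, Fintype.card_fin,
      nsmul_eq_mul]
  rw [e, inv_div]
  have hr2 : radius b lam * √(lamMin lam) = l2norm b * √(lamMin lam) + 1 := by
    rw [radius]; field_simp
  have hs2 := Real.sq_sqrt hl.le
  field_simp
  generalize radius b lam = ρ at *
  generalize √(lamMin lam) = s at *
  rw [← hs2]
  have : ρ ^ 2 * s ^ 2 = (l2norm b * s + 1) ^ 2 := by rw [← hr2]; ring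
  linear_combination 2 * this

theorem initY_mem : initY b lam ∈ barrierDom b lam := by
  have hl := h.lamMin_pos
  have hr := h.radius_pos
  have hd : (0 : ℝ) < d := by exact_mod_cast NeZero.pos d
  have hs := Real.sqrt_pos.2 hl
  have hb := l2norm_nonneg b
  constructor
  · intro i
    rw [← sub_pos, h.initY_sub]
    positivity
  · rw [← sub_pos, h.one_sub_sum_initY]
    positivity

theorem neg_mul_radius_le_objFt {t : ℝ} (ht : 0 ≤ t) {z : Vec d} (hz : z ∈ barrierDom b lam) :
    -(t * radius b lam) ≤ objFt b lam t z := by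
  have hz0 : ∀ i, 0 ≤ z i := fun i => (lowerB_nonneg i).trans (hz.1 i).le
  have h1 := mul_le_mul_of_nonneg_left (h.neg_radius_le_objF hz0 hz.2.le) ht
  have h2 : ∑ i, Real.log (z i - lowerB b lam i) ≤ 0 := by
    refine Finset.sum_nonpos fun i _ => Real.log_nonpos (by linarith [hz.1 i]) ?_
    have := Finset.single_le_sum (f := z) (fun i _ => hz0 i) (Finset.mem_univ i)
    linarith [lowerB_nonneg (b := b) (lam := lam) i, hz.2]
  have h3 : Real.log (1 - ∑ i, z i) ≤ 0 := by
    refine Real.log_nonpos (by linarith [hz.2]) ?_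
    linarith [Finset.sum_nonneg (f := z) (s := Finset.univ) fun i _ => hz0 i]
  rw [objFt]; linarith

/-- The initial gap. -/
theorem init_gap {z : Vec d} (hz : z ∈ barrierDom b lam) :
    38 * (objFt b lam (tInit b lam) (initY b lam) - objFt b lam (tInit b lam) z) ≤
      centeringBound b lam := by
  have h1 := h.neg_mul_radius_le_objFt h.tInit_pos.le hz
  have h2 : objFt b lam (tInit b lam) (initY b lam) ≤
      d * Real.log (2 * d * lamMin lam * radius b lam ^ 2) +
      Real.log (lamMin lam * radius b lam ^ 2 / (2 * √(lamMin lam) * l2norm b + 1 / 2)) := by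
    rw [objFt, h.one_sub_sum_initY]
    simp only [h.initY_sub, Real.log_inv, Finset.sum_const, Finset.card_univ, Fintype.card_fin,
      nsmul_eq_mul]
    -- The objective part at `y⁰` is just dropped, as `F ≤ 0`; the term `t₀ρ` of `Γ` comes from the
    -- lower bound at `z`.
    have := mul_nonpos_of_nonneg_of_nonpos h.tInit_pos.le (objF_nonpos (b := b) (lam := lam) (initY b lam))
    linarith
  rw [centeringBound]
  linarith

theorem centeringBound_nonneg : 0 ≤ centeringBound b lam := by
  have := h.init_gap h.initY_mem
  simpa using this

omit h [NeZero d] in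
theorem neg_objF_sq (w : Vec d) : -objF b lam (fun i => w i ^ 2) =
    ∑ i, |b i| * |w i| + √(∑ i, 1 / lam i * w i ^ 2) := by
  simp only [objF, Real.sqrt_sq_eq_abs]; ring

/-- The maximum over the unit ball is attained with `B_i ≤ w_i²`. -/
theorem exists_maximizer : ∃ z ∈ closedDom b lam, ∀ w : Vec d, ∑ i, w i ^ 2 ≤ 1 →
    objF b lam z ≤ objF b lam (fun i => w i ^ 2) := by
  set K : Set (Vec d) := {w | ∑ i, w i ^ 2 ≤ 1} with hK
  have hKc : IsCompact K := by
    apply Metric.isCompact_of_isClosed_isBounded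
    · exact isClosed_le (by fun_prop) continuous_const
    · apply (Metric.isBounded_closedBall (x := (0 : Vec d)) (r := 1)).subset
      intro w hw
      rw [mem_closedBall_zero_iff, pi_norm_le_iff_of_nonneg zero_le_one]
      intro i
      have := Finset.single_le_sum (f := fun i => w i ^ 2) (fun i _ => sq_nonneg _)
        (Finset.mem_univ i)
      rw [Real.norm_eq_abs, ← sq_le_one_iff_abs_le_one]
      exact this.trans hw
  obtain ⟨x, hx, hmax⟩ := hKc.exists_isMaxOn (f := fun w : Vec d => -objF b lam (fun i => w i ^ 2))
    ⟨0, by simp [hK]⟩ (by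
      simp only [neg_objF_sq]
      fun_prop)
  set G := -objF b lam (fun i => x i ^ 2) with hG
  have hGmax : ∀ w : Vec d, ∑ i, w i ^ 2 ≤ 1 → -objF b lam (fun i => w i ^ 2) ≤ G :=
    fun w hw => hmax hw
  have hG0 : 0 ≤ G := by have := objF_nonpos (b := b) (lam := lam) (fun i => x i ^ 2); linarith
  have hGρ : G ≤ radius b lam := by
    have := h.neg_radius_le_objF (y := fun i => x i ^ 2) (fun i => sq_nonneg _) hx
    linarith
  -- First-order optimality without derivatives: `-F(w²)` is homogeneous of degree 1 in `w`. Raising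
  -- `|x i|` by `s` gains at least `s|b i|`, and rescaling to the unit ball costs at most the factor
  -- `N`; then `s → 0`. With `G ≤ ρ` this yields `B_i ≤ x_i²`.
  have hbi : ∀ i, |b i| ≤ G * |x i| := by
    intro i
    apply le_of_forall_pos_le_add
    intro ε hε
    obtain ⟨s, hs, hsε⟩ : ∃ s > 0, G * (s / 2) ≤ ε := by
      refine ⟨2 * ε / (G + 1), by positivity, ?_⟩
      rw [show G * (2 * ε / (G + 1) / 2) = ε * (G / (G + 1)) by field_simp]
      exact mul_le_of_le_one_right hε.le (by rw [div_le_one (by linarith)]; linarith)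
    set x' : Vec d := fun j => |x j| + (if j = i then s else 0) with hx'
    -- `√(1 + u) ≤ 1 + u/2` with `u = 2s|x i| + s²` bounds the norm of `x'`.
    set N := 1 + s * |x i| + s ^ 2 / 2 with hN
    have hN0 : 0 < N := by positivity
    have hx'x : ∀ j, |x j| ≤ x' j := fun j => by
      simp only [hx']; split_ifs <;> linarith
    have hsum : ∑ j, x' j ^ 2 = ∑ j, x j ^ 2 + (2 * s * |x i| + s ^ 2) := by
      have : ∀ j, x' j ^ 2 = x j ^ 2 + if j = i then (2 * s * |x i| + s ^ 2) else 0 := fun j => by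
        simp only [hx']; split_ifs with hj
        · subst hj; rw [← sq_abs (x j)]; ring
        · simp
      simp [this, Finset.sum_add_distrib]
    have hle : ∑ j, (x' j / N) ^ 2 ≤ 1 := by
      simp only [div_pow]
      rw [← Finset.sum_div, div_le_one (by positivity), hsum]
      have hx1 : ∑ j, x j ^ 2 ≤ 1 := hx
      rw [hN]
      have : 0 ≤ s * |x i| := by positivity
      nlinarith [sq_nonneg s]
    have h1 := hGmax _ hle
    have h2 : -objF b lam (fun j => (x' j / N) ^ 2) =
        -objF b lam (fun j => x' j ^ 2) / N := by
      rw [neg_objF_sq (fun j => x' j / N), neg_objF_sq]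
      have e1 : ∑ j, |b j| * |x' j / N| = (∑ j, |b j| * |x' j|) / N := by
        rw [Finset.sum_div]
        exact Finset.sum_congr rfl fun j _ => by rw [abs_div, abs_of_pos hN0]; ring
      have e2 : ∑ j, 1 / lam j * (x' j / N) ^ 2 = (∑ j, 1 / lam j * x' j ^ 2) / N ^ 2 := by
        rw [Finset.sum_div]
        exact Finset.sum_congr rfl fun j _ => by rw [div_pow, mul_div_assoc]
      rw [e1, e2, Real.sqrt_div' _ (sq_nonneg _), Real.sqrt_sq hN0.le]; ring
    rw [h2, div_le_iff₀ hN0] at h1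
    have h3 : G + s * |b i| ≤ -objF b lam (fun j => x' j ^ 2) := by
      rw [hG, neg_objF_sq, neg_objF_sq]
      have e1 : ∑ j, |b j| * |x' j| = ∑ j, |b j| * |x j| + s * |b i| := by
        have : ∀ j, |b j| * |x' j| = |b j| * |x j| + if j = i then s * |b i| else 0 := fun j => by
          rw [abs_of_nonneg ((abs_nonneg _).trans (hx'x j))]
          simp only [hx']
          split_ifs with hj
          · subst hj; ring
          · simp
        simp [this, Finset.sum_add_distrib]
      have e2 : √(∑ i, 1 / lam i * x i ^ 2) ≤ √(∑ i, 1 / lam i * x' i ^ 2) := by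
        apply Real.sqrt_le_sqrt
        refine Finset.sum_le_sum fun j _ => ?_
        have := h.lam_pos j
        have := hx'x j
        rw [← sq_abs (x j)]
        gcongr
      linarith
    have h4 : s * |b i| ≤ s * (G * |x i| + G * (s / 2)) := by
      rw [hN] at h1; linarith
    have := le_of_mul_le_mul_left h4 hs
    linarith
  refine ⟨fun i => x i ^ 2, ⟨fun i => ?_, hx⟩, fun w hw => ?_⟩
  · change lowerB b lam i ≤ x i ^ 2
    rw [lowerB, div_pow, div_le_iff₀ (by have := h.radius_pos; positivity), ← sq_abs, ← sq_abs (x i),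
      ← mul_pow]
    have : |b i| ≤ |x i| * radius b lam := by
      rw [mul_comm]
      exact (hbi i).trans (by gcongr)
    gcongr
  · linarith [hGmax w hw]

/-- An approximately centered point is nearly optimal. -/
theorem nearly_optimal {t ε : ℝ} (ht : tInit b lam ≤ t)
    (htε : ((d : ℝ) + 1) / t ≤ ε / 2) {y : Vec d} (hy : y ∈ barrierDom b lam)
    (h1 : decrement (objFt b lam t) y < 1 / 4) {w : Vec d} (hw : ∑ i, w i ^ 2 ≤ 1) :
    ∑ i, |b i| * |w i| + √(∑ i, 1 / lam i * w i ^ 2) ≤ -objF b lam y + ε := by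
  obtain ⟨z, hz, hzmax⟩ := h.exists_maximizer
  have ht0 : 0 < t := h.tInit_pos.trans_le ht
  have h2 := h.accuracy ht hy (by linarith) hz
  have hl0 := decrement_nonneg (objFt b lam t) y
  set l := decrement (objFt b lam t) y
  have h3 : l ^ 2 / (2 * (1 - l)) ≤ 1 / 4 := by
    rw [div_le_iff₀ (by linarith)]; nlinarith
  have hd : (0 : ℝ) ≤ d := Nat.cast_nonneg d
  have h4 : √((d : ℝ) + 1) ≤ d + 1 := by
    apply Real.sqrt_le_iff.2; constructor <;> nlinarith
  have h5 : √((d : ℝ) + 1) * l ≤ (d + 1) * (1 / 4) := by gcongr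
  rw [div_le_iff₀ ht0] at htε
  -- The three terms add up to at most `5(d+1)/4 + 1/4 ≤ 2(d+1) ≤ tε`. A decrement below `1/4` is
  -- enough here, whatever the Newton tolerance was.
  have h6 : t * (objF b lam y - objF b lam z) ≤ t * ε := by linarith
  have h7 := le_of_mul_le_mul_left h6 ht0
  have h8 := hzmax w hw
  have h9 := neg_objF_sq (b := b) (lam := lam) w
  linarith

end IsData

end

/-! ### The number of Newton steps in one call -/

noncomputable section

/-- Termination: a uniform bound on how long a loop test can stay true forces it to fail. -/
theorem exists_first {T : ℕ → Prop} {K : ℝ} (hK : ∀ n : ℕ, (∀ k < n, T k) → (n : ℝ) ≤ K) :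
    ∃ n : ℕ, (∀ k < n, T k) ∧ ¬ T n := by
  classical
  have hex : ∃ n, ¬ T n := by
    by_contra hc
    push Not at hc
    obtain ⟨n, hn⟩ := exists_nat_gt K
    exact absurd (hK n fun k _ => hc k) (not_le.2 hn)
  exact ⟨Nat.find hex, fun k hk => not_not.1 (Nat.find_min hex hk), Nat.find_spec hex⟩

/-- This bound and the next one give the step constants: `1/4 - log (5/4) ≥ 1/37.3` and `2/5 - log
(7/5) ≥ 1/15.76`. -/
theorem log_five_quarters_le : Real.log (5 / 4) ≤ 0.22318 := by
  rw [Real.log_le_iff_le_exp (by norm_num)]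
  refine le_trans ?_ (Real.sum_le_exp_of_nonneg (by norm_num) 6)
  norm_num [Finset.sum_range_succ, Nat.factorial]

theorem log_seven_fifths_le : Real.log (7 / 5) ≤ 0.3365 := by
  rw [Real.log_le_iff_le_exp (by norm_num)]
  refine le_trans ?_ (Real.sum_le_exp_of_nonneg (by norm_num) 7)
  norm_num [Finset.sum_range_succ, Nat.factorial]

theorem sub_log_mono {a l : ℝ} (ha : 0 ≤ a) (hl : a ≤ l) :
    a - Real.log (1 + a) ≤ l - Real.log (1 + l) := by
  have hl0 : 0 ≤ l := ha.trans hl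
  have h1 := Real.log_le_sub_one_of_pos (x := (1 + l) / (1 + a)) (by positivity)
  rw [Real.log_div (by positivity) (by positivity)] at h1
  have h2 : (1 + l) / (1 + a) - 1 ≤ l - a := by
    rw [div_sub_one (by positivity), div_le_iff₀ (by positivity)]
    nlinarith
  linarith

variable {d : ℕ} [NeZero d] {b lam : Vec d}

namespace IsData

variable (h : IsData b lam) {t : ℝ} (ht : tInit b lam ≤ t)
include h ht

/-- The number of damped Newton steps. -/
theorem damped_phase {y : Vec d} (hy : y ∈ barrierDom b lam) {G : ℝ}
    (hG : ∀ z ∈ barrierDom b lam, objFt b lam t y - objFt b lam t z ≤ G) :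
    ∃ n : ℕ, (∀ k < n, 1 / 4 ≤ decrement (objFt b lam t) ((dampedStep (objFt b lam t))^[k] y)) ∧
      ¬ 1 / 4 ≤ decrement (objFt b lam t) ((dampedStep (objFt b lam t))^[n] y) ∧
      (∀ k, (dampedStep (objFt b lam t))^[k] y ∈ barrierDom b lam) ∧
      (n : ℝ) ≤ 37.3 * G ∧ (n : ℝ) ≤ 2.9 + 15.76 * G := by
  have e := objFt_eq (b := b) (lam := lam) (h.nonneg_of_tInit_le ht)
  have hlow := fun z => h.neg_mul_radius_le_objFt (h.nonneg_of_tInit_le ht) (z := z)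
  set f := objFt b lam t with hf
  have hmem : ∀ k, (dampedStep f)^[k] y ∈ barrierDom b lam := by
    intro k
    induction k with
    | zero => exact hy
    | succ k ih =>
      rw [Function.iterate_succ_apply', e]
      rw [e] at ih
      exact (h.isDomain ht).dampedStep_mem ih
  -- The infimum stands in for a minimizer, whose existence is not needed.
  set m := sInf (f '' barrierDom b lam) with hm
  have hbdd : BddBelow (f '' barrierDom b lam) :=
    ⟨-(t * radius b lam), by rintro _ ⟨z, hz, rfl⟩; exact hlow z hz⟩
  have hm_le : ∀ z ∈ barrierDom b lam, m ≤ f z := fun z hz => csInf_le hbdd ⟨z, hz, rfl⟩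
  have hm_ge : ∀ {w K}, (∀ z ∈ barrierDom b lam, f w - f z ≤ K) → f w - m ≤ K := by
    intro w K hK
    have : f w - K ≤ m := le_csInf ⟨_, y, hy, rfl⟩ (by
      rintro _ ⟨z, hz, rfl⟩; linarith [hK z hz])
    linarith
  -- A potential that drops by at least 1 per damped step. For decrements of at least `2/5` both
  -- branches drop by 1.
  set P : ℝ → ℝ := fun g => min (37.3 * g) (2.9 + 15.76 * g) with hP
  have hstep : ∀ w ∈ barrierDom b lam, 1 / 4 ≤ decrement f w →
      P (f (dampedStep f w) - m) + 1 ≤ P (f w - m) := by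
    intro w hw hwl
    have hdec : f (dampedStep f w) ≤ f w - (decrement f w - Real.log (1 + decrement f w)) := by
      rw [e]; exact (h.isDomain ht).fn_dampedStep_le hw
    rcases le_or_gt (2 / 5) (decrement f w) with h2 | h2
    · have h3 := sub_log_mono (by norm_num) h2
      have h4 := log_seven_fifths_le
      norm_num at h3 h4
      rw [hP, ← min_add_add_right]
      apply min_le_min <;> linarith
    · have h3 := sub_log_mono (by norm_num) hwl
      have h4 := log_five_quarters_le
      norm_num at h3 h4
      -- For decrements in `[1/4, 2/5)` the gap is at most `0.16 / 1.2 = 2/15`. There the branch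
      -- `37.3 g` is the smaller one, since the branches cross at `2.9 / 21.54 > 2/15`; and this
      -- branch drops by 1.
      have h5 : f w - m ≤ 2 / 15 := by
        refine hm_ge fun z hz => ?_
        have : f w - f z ≤ decrement f w ^ 2 / (2 * (1 - decrement f w)) := by
          have h6 : decrement f w < 1 := by linarith
          rw [e] at h6 ⊢
          exact (h.isDomain ht).fn_sub_fn_le hw hz h6
        refine this.trans ?_
        rw [div_le_iff₀ (by linarith)]
        nlinarith
      simp only [hP]
      rw [min_eq_left (a := 37.3 * (f w - m)) (by linarith)]
      refine (add_le_add_left (min_le_left _ _) 1).trans ?_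
      linarith
  have hcount : ∀ n : ℕ, (∀ k < n, 1 / 4 ≤ decrement f ((dampedStep f)^[k] y)) →
      P (f ((dampedStep f)^[n] y) - m) + n ≤ P (f y - m) := by
    intro n
    induction n with
    | zero => intro _; simp
    | succ n ih =>
      intro hn
      have h1 := ih fun k hk => hn k (hk.trans (Nat.lt_succ_self n))
      have h2 := hstep _ (hmem n) (hn n (Nat.lt_succ_self n))
      rw [Function.iterate_succ_apply']
      push_cast
      linarith
  have hP0 : ∀ g, 0 ≤ g → 0 ≤ P g := fun g hg => le_min (by positivity) (by positivity)
  have hcount' : ∀ n : ℕ, (∀ k < n, 1 / 4 ≤ decrement f ((dampedStep f)^[k] y)) →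
      (n : ℝ) ≤ P (f y - m) := fun n hn => by
    have := hP0 _ (sub_nonneg.2 (hm_le _ (hmem n)))
    linarith [hcount n hn]
  obtain ⟨n, hn, hn'⟩ := exists_first hcount'
  have h1 := hcount' n hn
  have h2 := hm_ge hG
  refine ⟨n, hn, hn', hmem, ?_, ?_⟩
  · have := h1.trans (min_le_left _ _); linarith
  · have := h1.trans (min_le_right _ _); linarith

-- The gain of `1/2` comes from `log₂ (16/5) ≥ 3/2 ≥ 2^{1/2}`. It later yields strict inequalities
-- and absorbs the error terms of a phase.
omit h ht [NeZero d] in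
theorem loglog_bound {τ : ℝ} (hτ : 0 < τ) {n : ℕ} (hn : τ < (5 / 16) ^ 2 ^ n) :
    (n : ℝ) + 1 / 2 ≤ Real.logb 2 (Real.logb 2 (1 / τ)) := by
  have h1 : (3 / 2 : ℝ) ≤ Real.logb 2 (16 / 5) := by
    rw [Real.le_logb_iff_rpow_le (by norm_num) (by norm_num)]
    have : ((2 : ℝ) ^ (3 / 2 : ℝ)) ^ 2 ≤ (16 / 5) ^ 2 := by
      rw [← Real.rpow_natCast, ← Real.rpow_mul (by norm_num)]
      norm_num
    exact (sq_le_sq₀ (by positivity) (by norm_num)).1 this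
  have h2 : (2 : ℝ) ^ n * (3 / 2) ≤ Real.logb 2 (1 / τ) := by
    have : (16 / 5 : ℝ) ^ 2 ^ n ≤ 1 / τ := by
      rw [le_one_div (by positivity) hτ, one_div, ← inv_pow]
      norm_num
      exact hn.le
    calc (2 : ℝ) ^ n * (3 / 2) ≤ 2 ^ n * Real.logb 2 (16 / 5) := by gcongr
      _ = Real.logb 2 ((16 / 5) ^ 2 ^ n) := by rw [Real.logb_pow]; push_cast; ring
      _ ≤ _ := Real.logb_le_logb_of_le (by norm_num) (by positivity) this
  rw [Real.le_logb_iff_rpow_le (by norm_num) (lt_of_lt_of_le (by positivity) h2)]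
  refine le_trans ?_ h2
  rw [Real.rpow_add (by norm_num), Real.rpow_natCast]
  gcongr
  have : ((2 : ℝ) ^ (1 / 2 : ℝ)) ^ 2 ≤ (3 / 2) ^ 2 := by
    rw [← Real.rpow_natCast, ← Real.rpow_mul (by norm_num)]
    norm_num
  exact (sq_le_sq₀ (by positivity) (by norm_num)).1 this

/-- The number of intermediate Newton steps. -/
theorem intermediate_phase {y : Vec d} (hy : y ∈ barrierDom b lam)
    (hyl : decrement (objFt b lam t) y < 1 / 4) {τ : ℝ} (hτ : 0 < τ) :
    ∃ n : ℕ, (∀ k < n, τ < decrement (objFt b lam t) ((intermediateStep (objFt b lam t))^[k] y) ^ 2) ∧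
      ¬ τ < decrement (objFt b lam t) ((intermediateStep (objFt b lam t))^[n] y) ^ 2 ∧
      (∀ k, (intermediateStep (objFt b lam t))^[k] y ∈ barrierDom b lam) ∧
      decrement (objFt b lam t) ((intermediateStep (objFt b lam t))^[n] y) < 1 / 4 ∧
      (n = 0 ∨ (n : ℝ) + 1 / 2 ≤ Real.logb 2 (Real.logb 2 (1 / τ))) := by
  have hQ := h.isDomain ht
  have e := objFt_eq (b := b) (lam := lam) (h.nonneg_of_tInit_le ht)
  rw [e] at hyl ⊢
  set R := ridge b lam (h.nonneg_of_tInit_le ht)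
  set f := R.fn with hf
  -- Below `1/4` the contraction reads `(5/4) l⁺ ≤ ((5/4) l)²`, starting from less than `5/16`.
  have hmem : ∀ k, (intermediateStep f)^[k] y ∈ barrierDom b lam ∧
      decrement f ((intermediateStep f)^[k] y) < 1 / 4 ∧
      5 / 4 * decrement f ((intermediateStep f)^[k] y) ≤ (5 / 16) ^ 2 ^ k := by
    intro k
    induction k with
    | zero => refine ⟨hy, hyl, ?_⟩; simp; linarith
    | succ k ih =>
      obtain ⟨h1, h2, h3⟩ := ih
      rw [Function.iterate_succ_apply']
      have h4 := hQ.decrement_intermediateStep_le h1 (by linarith)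
      have h0 := decrement_nonneg f ((intermediateStep f)^[k] y)
      have h5 := hQ.intermediateStep_mem h1 (by linarith)
      rw [← hf] at h4 h5
      generalize decrement f ((intermediateStep f)^[k] y) = l at *
      refine ⟨h5, by nlinarith, ?_⟩
      rw [pow_succ, pow_mul]
      calc _ ≤ (5 / 4 * l) ^ 2 := by nlinarith
        _ ≤ _ := by gcongr
  have hcount : ∀ n : ℕ, (∀ k < n, τ < decrement f ((intermediateStep f)^[k] y) ^ 2) →
      (n = 0 ∨ (n : ℝ) + 1 / 2 ≤ Real.logb 2 (Real.logb 2 (1 / τ))) := by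
    intro n hn
    rcases n with _ | j
    · left; rfl
    · right
      apply loglog_bound hτ
      -- The last successful test is the one at `j = n - 1`; that it compares the square of the
      -- decrement restores the exponent `2 ^ n`.
      have h1 := hn j (Nat.lt_succ_self j)
      have h2 := (hmem j).2.2
      have h0 := decrement_nonneg f ((intermediateStep f)^[j] y)
      generalize decrement f ((intermediateStep f)^[j] y) = l at *
      rw [pow_succ, pow_mul]
      calc τ < l ^ 2 := h1
        _ ≤ (5 / 4 * l) ^ 2 := by nlinarith
        _ ≤ _ := by gcongr
  obtain ⟨n, hn, hn'⟩ := exists_first (T := fun k => τ < decrement f ((intermediateStep f)^[k] y) ^ 2)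
    (K := max 0 (Real.logb 2 (Real.logb 2 (1 / τ)))) (by
      intro n hn
      rcases hcount n hn with h0 | h1
      · simp [h0]
      · exact le_trans (by linarith) (le_max_right _ _))
  exact ⟨n, hn, hn', fun k => (hmem k).1, (hmem n).2.1, hcount n hn⟩

end IsData

/-- The cost includes the final test that fails. -/
theorem whileRuns_seq {σ : Type} {test : σ → Counted Prop} {body : σ → Prog σ} (n : ℕ) :
    ∀ (u : ℕ → σ) (c : ℕ → ℕ), (∀ k < n, (test (u k)).val) → ¬ (test (u n)).val →
      (∀ k < n, (body (u k)).runs (u (k + 1)) (c k)) →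
      WhileRuns test body (u 0) (u n)
        (∑ k ∈ Finset.range n, ((test (u k)).cost + c k) + (test (u n)).cost) := by
  induction n with
  | zero =>
    intro u c _ h2 _
    simpa using WhileRuns.halt (u 0) h2
  | succ n ih =>
    intro u c h1 h2 h3
    have := ih (fun k => u (k + 1)) (fun k => c (k + 1)) (fun k hk => h1 _ (by omega)) h2
      (fun k hk => h3 _ (by omega))
    have h4 := WhileRuns.again _ _ _ _ _ (h1 0 (by omega)) (h3 0 (by omega)) this
    rw [Finset.sum_range_succ']
    convert h4 using 1
    ring

end

/-! ### Values and costs of the elementary routines; rank-one updates -/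

noncomputable section

variable {d : ℕ}

section
variable {α β : Type}

@[simp] theorem bind_val (m : Counted α) (f : α → Counted β) : (m >>= f).val = (f m.val).val := rfl
@[simp] theorem bind_cost (m : Counted α) (f : α → Counted β) :
    (m >>= f).cost = m.cost + (f m.val).cost := rfl
@[simp] theorem pure_val (a : α) : (pure a : Counted α).val = a := rfl
@[simp] theorem pure_cost (a : α) : (pure a : Counted α).cost = 0 := rfl

end

section
variable (x y : Counted ℝ) (r : ℝ)

@[simp] theorem rd_val : (rd r).val = r := rfl
@[simp] theorem rd_cost : (rd r).cost = 0 := rfl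
@[simp] theorem add_val : (x + y).val = x.val + y.val := rfl
@[simp] theorem add_cost : (x + y).cost = x.cost + y.cost + 1 := rfl
@[simp] theorem sub_val : (x - y).val = x.val - y.val := rfl
@[simp] theorem sub_cost : (x - y).cost = x.cost + y.cost + 1 := rfl
@[simp] theorem mul_val : (x * y).val = x.val * y.val := rfl
@[simp] theorem mul_cost : (x * y).cost = x.cost + y.cost + 1 := rfl
@[simp] theorem div_val : (x / y).val = x.val / y.val := rfl
@[simp] theorem div_cost : (x / y).cost = x.cost + y.cost + 1 := rfl
@[simp] theorem sqrtC_val : (sqrtC x).val = √x.val := rfl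
@[simp] theorem sqrtC_cost : (sqrtC x).cost = x.cost + 1 := rfl
@[simp] theorem ltC_val : (ltC x y).val = (x.val < y.val) := rfl
@[simp] theorem ltC_cost : (ltC x y).cost = x.cost + y.cost + 1 := rfl
@[simp] theorem leC_val : (leC x y).val = (x.val ≤ y.val) := rfl
@[simp] theorem leC_cost : (leC x y).cost = x.cost + y.cost + 1 := rfl

open Classical in
@[simp] theorem iteC_val (p : Counted Prop) : (iteC p x y).val = if p.val then x.val else y.val := by
  unfold iteC; split_ifs <;> rfl

theorem iteC_cost_le (p : Counted Prop) : (iteC p x y).cost ≤ p.cost + x.cost + y.cost := by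
  unfold iteC; split_ifs <;> simp only <;> omega

@[simp] theorem absC_val : (absC r).val = |r| := by
  rw [absC, iteC_val]
  by_cases h : r < 0
  · simp [h, abs_of_neg h]
  · simp [h, abs_of_nonneg (not_lt.1 h)]

theorem absC_cost_le : (absC r).cost ≤ 2 := (iteC_cost_le _ _ _).trans (by simp)

@[simp] theorem maxC_val (s : ℝ) : (maxC r s).val = max r s := by
  rw [maxC, iteC_val]
  by_cases h : r < s
  · simp [h, max_eq_right h.le]
  · simp [h, max_eq_left (not_lt.1 h)]

theorem maxC_cost_le (s : ℝ) : (maxC r s).cost ≤ 1 := (iteC_cost_le _ _ _).trans (by simp)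

end

section
variable (f : Fin d → Counted ℝ) (F : Fin d → Fin d → Counted ℝ) (M N : Mat d) (v : Vec d)

@[simp] theorem tabC_val : (tabC f).val = fun i => (f i).val := rfl
@[simp] theorem tab2C_val : (tab2C F).val = Matrix.of fun i j => (F i j).val := rfl
@[simp] theorem sumC_val : (sumC f).val = ∑ i, (f i).val := rfl
@[simp] theorem mulVecC_val : (mulVecC M v).val = M *ᵥ v := rfl
@[simp] theorem mulMatC_val : (mulMatC M N).val = M * N := rfl

variable {f F} in
theorem tabC_cost_le {c : ℕ} (h : ∀ i, (f i).cost ≤ c) : (tabC f).cost ≤ d * (c + 1) := by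
  calc ∑ i, ((f i).cost + 1) ≤ ∑ _i : Fin d, (c + 1) :=
        Finset.sum_le_sum fun i _ => Nat.succ_le_succ (h i)
    _ = _ := by simp

variable {f F} in
theorem sumC_cost_le {c : ℕ} (h : ∀ i, (f i).cost ≤ c) : (sumC f).cost ≤ d * (c + 1) :=
  tabC_cost_le h

variable {f F} in
theorem tab2C_cost_le {c : ℕ} (h : ∀ i j, (F i j).cost ≤ c) :
    (tab2C F).cost ≤ d * (d * (c + 1)) := by
  calc ∑ i, ∑ j, ((F i j).cost + 1) ≤ ∑ _i : Fin d, ∑ _j : Fin d, (c + 1) :=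
        Finset.sum_le_sum fun i _ => Finset.sum_le_sum fun j _ => Nat.succ_le_succ (h i j)
    _ = _ := by simp

theorem mulVecC_cost_le : (mulVecC M v).cost ≤ d * (d * 2 + 1) :=
  tabC_cost_le fun i => sumC_cost_le fun j => by simp

theorem mulMatC_cost_le : (mulMatC M N).cost ≤ d * (d * (d * 2 + 1)) :=
  tab2C_cost_le fun i j => sumC_cost_le fun k => by simp

theorem conjDiagC_cost_le : (conjDiagC M v).cost ≤ d * (d * (d * 3 + 1)) :=
  tab2C_cost_le fun i j => sumC_cost_le fun k => by simp

@[simp] theorem conjDiagC_val : (conjDiagC M v).val = Mᵀ * Matrix.diagonal v * M := by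
  ext i j
  rw [Matrix.mul_apply]
  simp [conjDiagC, Matrix.mul_diagonal]

theorem shermanMorrisonC_cost_le (u : Vec d) :
    (shermanMorrisonC M u).cost ≤ d * (d * 2 + 1) + (d * 2 + 1) + d * (d * 4) := by
  have h1 := mulVecC_cost_le M u
  have h2 : (sumC fun i => rd (u i) * rd ((M *ᵥ u) i)).cost ≤ d * 2 :=
    sumC_cost_le fun i => by simp
  have h3 : ∀ (s : ℝ) (w : Vec d), (tab2C fun i j : Fin d => rd (M i j) - rd (w i) * rd (w j) / rd s).cost ≤
      d * (d * 4) := fun s w => tab2C_cost_le fun i j => by simp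
  rw [shermanMorrisonC]
  simp only [bind_cost, add_cost, rd_cost, mulVecC_val]
  have := h3 (rd 1 + sumC fun i => rd (u i) * rd ((M *ᵥ u) i)).val (M *ᵥ u)
  omega

theorem shermanMorrisonC_val (u : Vec d) : (shermanMorrisonC M u).val =
    M - (1 / (1 + u ⬝ᵥ (M *ᵥ u))) • Matrix.vecMulVec (M *ᵥ u) (M *ᵥ u) := by
  ext i j
  simp only [shermanMorrisonC, bind_val, mulVecC_val, add_val, rd_val, sumC_val, mul_val, tab2C_val,
    sub_val, div_val, Matrix.of_apply, Matrix.sub_apply, Matrix.smul_apply, Matrix.vecMulVec_apply,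
    smul_eq_mul, dotProduct]
  ring

end

theorem posDef_add_vecMulVec {H : Mat d} (hH : H.PosDef) (u : Vec d) :
    (H + Matrix.vecMulVec u u).PosDef := by
  have := Matrix.posSemidef_vecMulVec_self_star u
  exact hH.add_posSemidef this

/-- Positive definiteness makes the denominator `1 + uᵀH⁻¹u` positive. It is inherited by the
updated matrix, so the update can be repeated. -/
theorem shermanMorrisonC_inv {H : Mat d} (hH : H.PosDef) (u : Vec d) :
    (shermanMorrisonC H⁻¹ u).val = (H + Matrix.vecMulVec u u)⁻¹ := by
  have hu : IsUnit H.det := (Matrix.isUnit_iff_isUnit_det _).1 hH.isUnit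
  have hsym : (H⁻¹)ᵀ = H⁻¹ := by
    have := hH.inv.isHermitian
    rwa [Matrix.IsHermitian, Matrix.conjTranspose_eq_transpose_of_trivial] at this
  symm
  apply Matrix.inv_eq_right_inv
  rw [shermanMorrisonC_val]
  set w := H⁻¹ *ᵥ u with hw
  have h1 : H *ᵥ w = u := by
    rw [hw, Matrix.mulVec_mulVec, Matrix.mul_nonsing_inv _ hu, Matrix.one_mulVec]
  have h2 : u ᵥ* H⁻¹ = w := by
    rw [hw, ← Matrix.mulVec_transpose, hsym]
  have h3 : 0 < 1 + u ⬝ᵥ w := by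
    have := hH.inv.posSemidef.dotProduct_mulVec_nonneg u
    simp only [star_trivial] at this
    linarith
  rw [add_mul, mul_sub, mul_sub, Matrix.mul_nonsing_inv _ hu, Matrix.mul_smul, Matrix.mul_smul,
    Matrix.mul_vecMulVec, h1, Matrix.vecMulVec_mul, h2, Matrix.vecMulVec_mul_vecMulVec]
  ext i j
  simp only [Matrix.add_apply, Matrix.sub_apply, Matrix.smul_apply, Matrix.vecMulVec_apply,
    smul_eq_mul, Pi.smul_apply]
  field_simp
  ring

end

/-! ### Correctness and cost of the computed Newton direction -/

noncomputable section

variable {d : ℕ}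

theorem newtonDataC_cost_le (b lam B : Vec d) (t : ℝ) (y : Vec d) (hd : 1 ≤ d) :
    (newtonDataC b lam B t y).cost ≤ 100 * d ^ 2 := by
  have c1 : (sumC fun j => rd (y j) / rd (lam j)).cost ≤ d * 2 := sumC_cost_le fun j => by simp
  have c2 : (sumC fun j => rd (y j)).cost ≤ d * 1 := sumC_cost_le fun j => by simp
  have c3 : (tabC fun i => absC (b i)).cost ≤ d * 3 := tabC_cost_le fun i => absC_cost_le _
  have c4 : (tabC fun i => sqrtC (rd (y i))).cost ≤ d * 2 := tabC_cost_le fun i => by simp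
  have c5 : ∀ (gap rS : ℝ) (a r : Vec d), (tabC fun i =>
      rd 1 / rd gap - rd 1 / (rd (y i) - rd (B i)) - rd t * rd (a i) / (rd 2 * rd (r i))
      - rd t / (rd 2 * rd rS * rd (lam i))).cost ≤ d * 13 :=
    fun gap rS a r => tabC_cost_le fun i => by simp
  have c6 : ∀ (a r : Vec d), (tabC fun i =>
      rd t * rd (a i) / (rd 4 * rd (y i) * rd (r i))
      + rd 1 / ((rd (y i) - rd (B i)) * (rd (y i) - rd (B i)))).cost ≤ d * 10 :=
    fun a r => tabC_cost_le fun i => by simp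
  have c7 : ∀ (D : Vec d), (tab2C fun i j => if i = j then rd 1 / rd (D i) else rd 0).cost ≤
      d * (d * 2) := fun D => tab2C_cost_le fun i j => by split_ifs <;> simp
  have c8 : ∀ q : ℝ, (tabC fun i => rd q / rd (lam i)).cost ≤ d * 2 :=
    fun q => tabC_cost_le fun i => by simp
  have c9 : ∀ gap : ℝ, (tabC fun _ : Fin d => rd 1 / rd gap).cost ≤ d * 2 :=
    fun q => tabC_cost_le fun i => by simp
  have c10 : ∀ g p : Vec d, (sumC fun i => rd (g i) * rd (p i)).cost ≤ d * 2 :=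
    fun g p => sumC_cost_le fun i => by simp
  have c11 := fun M : Mat d => shermanMorrisonC_cost_le M
  have c12 := fun M : Mat d => mulVecC_cost_le M
  have hdd : d ≤ d ^ 2 := Nat.le_self_pow two_ne_zero d
  have h1 : 1 ≤ d ^ 2 := hd.trans hdd
  rw [newtonDataC]
  simp only [bind_cost, pure_cost, sub_cost, sqrtC_cost, rd_cost, div_cost, mul_cost]
  refine le_trans (Nat.add_le_add c1 (Nat.add_le_add le_rfl (Nat.add_le_add (Nat.add_le_add
    (Nat.add_le_add le_rfl c2) le_rfl) (Nat.add_le_add c3 (Nat.add_le_add c4 (Nat.add_le_add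
    (c5 _ _ _ _) (Nat.add_le_add (c6 _ _) (Nat.add_le_add (c7 _) (Nat.add_le_add le_rfl
    (Nat.add_le_add (c8 _) (Nat.add_le_add (c11 _ _) (Nat.add_le_add (c9 _) (Nat.add_le_add
    (c11 _ _) (Nat.add_le_add (c12 _ _) (Nat.add_le_add (Nat.add_le_add (c10 _ _) le_rfl)
    le_rfl))))))))))))))) ?_
  nlinarith

/-- The data of `F^{(t)}` that the implementation keeps. -/
def newtonData (f : Vec d → ℝ) (y : Vec d) : NewtonState d := ⟨y, newtonDir f y, decrement f y⟩

/-- Isolates the two Sherman-Morrison calls so that they can be rewritten as inverses. -/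
theorem newtonDataC_val_eq (b lam B : Vec d) (t : ℝ) (y : Vec d) :
    (newtonDataC b lam B t y).val =
      let S := ∑ j, y j / lam j
      let gap := 1 - ∑ j, y j
      let g : Vec d := fun i => 1 / gap - 1 / (y i - B i) - t * (absC (b i)).val / (2 * √(y i))
        - t / (2 * √S * lam i)
      let D : Vec d := fun i => t * (absC (b i)).val / (4 * y i * √(y i))
        + 1 / ((y i - B i) * (y i - B i))
      let M₀ : Mat d := Matrix.of fun i j => (if i = j then rd 1 / rd (D i) else rd 0).val
      let M₁ := (shermanMorrisonC M₀ fun i => √(t / (4 * S * √S)) / lam i).val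
      let M₂ := (shermanMorrisonC M₁ fun _ => 1 / gap).val
      ⟨y, M₂ *ᵥ g, √(g ⬝ᵥ (M₂ *ᵥ g))⟩ := rfl

variable [NeZero d] {b lam : Vec d}

namespace IsData

variable (h : IsData b lam) {t : ℝ} (ht : tInit b lam ≤ t) {y : Vec d} (hy : y ∈ barrierDom b lam)
include h ht hy

/-- The terms in the single coordinates `y i` contribute the diagonal `D`. The root of `∑ y_j / λ_j`
contributes `u uᵀ`, and the logarithm of the gap `1 - ∑ y_j` a rank-one matrix with constant
entries. -/
theorem newtonDataC_val : (newtonDataC b lam (lowerB b lam) t y).val =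
    newtonData (objFt b lam t) y := by
  have ht0 := h.nonneg_of_tInit_le ht
  have hQ := h.isDomain ht
  have e := objFt_eq (b := b) (lam := lam) ht0
  have hyB : ∀ i, 0 < y i - lowerB b lam i := fun i => sub_pos.2 (hy.1 i)
  have hy0 : ∀ i, 0 < y i := fun i => (lowerB_nonneg i).trans_lt (hy.1 i)
  have hgap : 0 < 1 - ∑ j, y j := sub_pos.2 hy.2
  have hS : ∑ j, 1 / lam j * y j = ∑ j, y j / lam j := Finset.sum_congr rfl fun j _ => by ring
  have hS0 : 0 < ∑ j, y j / lam j := by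
    have : Nonempty (Fin d) := ⟨lastIdx d⟩
    exact Finset.sum_pos (fun j _ => div_pos (hy0 j) (h.lam_pos j)) Finset.univ_nonempty
  rw [newtonDataC_val_eq]
  simp only [absC_val]
  set S := ∑ j, y j / lam j
  set gap := 1 - ∑ j, y j
  set g : Vec d := fun i => 1 / gap - 1 / (y i - lowerB b lam i) - t * |b i| / (2 * √(y i))
        - t / (2 * √S * lam i) with hg
  set D : Vec d := fun i => t * |b i| / (4 * y i * √(y i))
        + 1 / ((y i - lowerB b lam i) * (y i - lowerB b lam i)) with hD
  set u : Vec d := fun i => √(t / (4 * S * √S)) / lam i with hu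
  have hgrad : grad (objFt b lam t) y = g := by
    rw [e, hQ.grad_eq hy]
    funext i
    simp only [Fintype.sum_sum_type, ridge_arg_obj, ridge_arg_obj', ridge_arg_bar, ridge_arg_bar', hS]
    simp only [ridge, Sum.elim_inl, Sum.elim_inr, Finset.univ_unique, Finset.sum_singleton,
      Pi.single_apply, mul_ite, mul_one, mul_zero, Finset.sum_ite_eq, Finset.mem_univ, if_true, hg]
    have := h.lam_pos i
    change _ + _ + (_ + -(1 / gap) * -1) = _
    have : t / (2 * √S * lam i) = t / (2 * √S) * (1 / lam i) := by
      rw [div_mul_div_comm, mul_one]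
    rw [this]
    ring
  have hhess : hess (objFt b lam t) y =
      Matrix.diagonal D + Matrix.vecMulVec u u +
        Matrix.vecMulVec (fun _ => 1 / gap) (fun _ => 1 / gap) := by
    rw [e, hQ.hess_eq hy]
    ext i j
    have huu : u i * u j = t / (4 * (S * √S)) * (1 / lam i * (1 / lam j)) := by
      have : √(t / (4 * S * √S)) * √(t / (4 * S * √S)) = t / (4 * S * √S) :=
        Real.mul_self_sqrt (by positivity)
      simp only [hu]
      rw [div_mul_div_comm, this, ← mul_assoc 4]
      ring
    rw [Matrix.add_apply, Matrix.add_apply, Matrix.vecMulVec_apply, Matrix.vecMulVec_apply, huu,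
      Matrix.diagonal_apply, Matrix.of_apply]
    simp only [Fintype.sum_sum_type, ridge_arg_obj, ridge_arg_obj', ridge_arg_bar, ridge_arg_bar', hS]
    simp only [ridge, Sum.elim_inl, Sum.elim_inr, Finset.univ_unique, Finset.sum_singleton,
      Pi.single_apply, mul_ite, mul_one, mul_zero, Finset.sum_ite_eq, Finset.mem_univ, if_true, hD]
    change _ + _ + (_ + 1 / gap ^ 2 * (-1 * -1)) = _
    have eg : 1 / gap ^ 2 * (-1 * -1) = 1 / gap * (1 / gap) := by
      rw [pow_two, div_mul_div_comm]; norm_num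
    rw [eg]
    by_cases hij : i = j
    · subst hij
      simp only [if_true]
      rw [← mul_assoc 4, pow_two (y i - lowerB b lam i)]
      ring
    · simp only [hij, if_false]
      ring
  have hM₀ : (Matrix.of fun i j => (if i = j then rd 1 / rd (D i) else rd 0).val : Mat d) =
      (Matrix.diagonal D)⁻¹ := by
    have hD0 : ∀ i, D i ≠ 0 := fun i => by
      have := hy0 i; have := hyB i
      simp only [hD]
      positivity
    symm
    apply Matrix.inv_eq_right_inv
    have : (Matrix.of fun i j => (if i = j then rd 1 / rd (D i) else rd 0).val : Mat d) =
        Matrix.diagonal fun i => 1 / D i := by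
      ext i j
      rw [Matrix.diagonal_apply, Matrix.of_apply]
      split_ifs <;> rfl
    rw [this, Matrix.diagonal_mul_diagonal, ← Matrix.diagonal_one]
    congr 1
    funext i
    exact mul_one_div_cancel (hD0 i)
  have hDpos : (Matrix.diagonal D).PosDef := by
    rw [Matrix.posDef_diagonal_iff]
    intro i
    have := hy0 i; have := hyB i
    simp only [hD]
    positivity
  rw [hM₀, shermanMorrisonC_inv hDpos, shermanMorrisonC_inv (posDef_add_vecMulVec hDpos _), ← hhess,
    ← hgrad]
  rfl

end IsData

end

/-! ### One call of Newton's method, algorithm and program in parallel -/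

noncomputable section

variable {d : ℕ} [NeZero d] {b lam : Vec d}

theorem one_le_dim : 1 ≤ d := NeZero.pos d

namespace IsData

variable (h : IsData b lam) {t : ℝ} (ht : tInit b lam ≤ t)
include h ht

theorem dampedC_val {y : Vec d} (hy : dampedStep (objFt b lam t) y ∈ barrierDom b lam) :
    (dampedC b lam (lowerB b lam) t (newtonData (objFt b lam t) y)).val =
      newtonData (objFt b lam t) (dampedStep (objFt b lam t) y) := by
  have e : dampedStep (objFt b lam t) y = (tabC fun i => rd (y i) -
      rd (1 / (1 + decrement (objFt b lam t) y)) * rd (newtonDir (objFt b lam t) y i)).val := rfl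
  rw [← h.newtonDataC_val ht hy, e]
  rfl

theorem intermediateC_val {y : Vec d} (hy : intermediateStep (objFt b lam t) y ∈ barrierDom b lam) :
    (intermediateC b lam (lowerB b lam) t (newtonData (objFt b lam t) y)).val =
      newtonData (objFt b lam t) (intermediateStep (objFt b lam t) y) := by
  have e : intermediateStep (objFt b lam t) y = (tabC fun i => rd (y i) -
      rd (1 / (1 + decrement (objFt b lam t) y * decrement (objFt b lam t) y /
        (1 + decrement (objFt b lam t) y))) * rd (newtonDir (objFt b lam t) y i)).val := by
    rw [← pow_two]; rfl
  rw [← h.newtonDataC_val ht hy, e]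
  rfl

omit h ht [NeZero d] in
theorem dampedC_cost_le (B : Vec d) (s : NewtonState d) (hd : 1 ≤ d) :
    (dampedC b lam B t s).cost ≤ 110 * d ^ 2 := by
  have c1 : ∀ x : ℝ, (tabC fun i => rd (s.pt i) - rd x * rd (s.dir i)).cost ≤ d * 3 :=
    fun x => tabC_cost_le fun i => by simp
  have hdd : d ≤ d ^ 2 := Nat.le_self_pow two_ne_zero d
  have h1 : 1 ≤ d ^ 2 := hd.trans hdd
  rw [dampedC]
  simp only [bind_cost, add_cost, rd_cost, div_cost]
  refine le_trans (Nat.add_le_add le_rfl (Nat.add_le_add (c1 _)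
    (newtonDataC_cost_le _ _ _ _ _ hd))) ?_
  omega

omit h ht [NeZero d] in
theorem intermediateC_cost_le (B : Vec d) (s : NewtonState d) (hd : 1 ≤ d) :
    (intermediateC b lam B t s).cost ≤ 110 * d ^ 2 := by
  have c1 : ∀ x : ℝ, (tabC fun i => rd (s.pt i) - rd x * rd (s.dir i)).cost ≤ d * 3 :=
    fun x => tabC_cost_le fun i => by simp
  have hdd : d ≤ d ^ 2 := Nat.le_self_pow two_ne_zero d
  have h1 : 1 ≤ d ^ 2 := hd.trans hdd
  rw [intermediateC]
  simp only [bind_cost, add_cost, rd_cost, div_cost, mul_cost]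
  refine le_trans (Nat.add_le_add le_rfl (Nat.add_le_add (c1 _)
    (newtonDataC_cost_le _ _ _ _ _ hd))) ?_
  omega

/-- A call of Newton's method: the algorithm and its implementation run alike. -/
theorem newtonMethod_runs {y : Vec d} (hy : y ∈ barrierDom b lam) {G : ℝ}
    (hG : ∀ z ∈ barrierDom b lam, objFt b lam t y - objFt b lam t z ≤ G) {τ : ℝ} (hτ : 0 < τ) :
    ∃ (y' : Vec d) (n₁ n₂ T : ℕ), (newtonMethod (objFt b lam t) y τ).runs y' (n₁ + n₂) ∧
      (newtonMethodC b lam (lowerB b lam) t y τ).runs y' T ∧ y' ∈ barrierDom b lam ∧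
      decrement (objFt b lam t) y' < 1 / 4 ∧ decrement (objFt b lam t) y' ^ 2 ≤ τ ∧
      T ≤ 120 * d ^ 2 * (n₁ + n₂ + 1) ∧ (n₁ : ℝ) ≤ 37.3 * G ∧ (n₁ : ℝ) ≤ 2.9 + 15.76 * G ∧
      (n₂ = 0 ∨ (n₂ : ℝ) + 1 / 2 ≤ Real.logb 2 (Real.logb 2 (1 / τ))) := by
  obtain ⟨n₁, hn₁, hn₁', hmem, hb₁, hb₁'⟩ := h.damped_phase ht hy hG
  set f := objFt b lam t with hf
  obtain ⟨n₂, hn₂, hn₂', hmem₂, hlt, hb₂⟩ :=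
    h.intermediate_phase ht (hmem n₁) (not_le.1 hn₁') hτ
  rw [← hf] at hn₂ hn₂' hlt hmem₂
  set y₁ := (dampedStep f)^[n₁] y with hy₁
  set c₁ : ℕ → ℕ := fun k =>
    (dampedC b lam (lowerB b lam) t (newtonData f ((dampedStep f)^[k] y))).cost with hc₁
  set c₂ : ℕ → ℕ := fun k =>
    (intermediateC b lam (lowerB b lam) t (newtonData f ((intermediateStep f)^[k] y₁))).cost with hc₂
  have r₁ := whileRuns_seq (test := fun y => (pure (1 / 4 ≤ decrement f y) : Counted Prop))
    (body := fun y => newtonStep (dampedStep f y)) n₁ (fun k => (dampedStep f)^[k] y) (fun _ => 1)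
    hn₁ hn₁' (fun k _ => ⟨Function.iterate_succ_apply' _ _ _, rfl⟩)
  have r₂ := whileRuns_seq (test := fun y => (pure (τ < decrement f y ^ 2) : Counted Prop))
    (body := fun y => newtonStep (intermediateStep f y)) n₂ (fun k => (intermediateStep f)^[k] y₁)
    (fun _ => 1) hn₂ hn₂' (fun k _ => ⟨Function.iterate_succ_apply' _ _ _, rfl⟩)
  have s₁ := whileRuns_seq (test := fun s : NewtonState d => leC (rd (1 / 4)) (rd s.dec))
    (body := fun s => (liftM (dampedC b lam (lowerB b lam) t s) : Prog (NewtonState d)))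
    n₁ (fun k => newtonData f ((dampedStep f)^[k] y)) c₁ hn₁ hn₁' (fun k _ => ⟨by
      have := hmem (k + 1)
      rw [Function.iterate_succ_apply'] at this
      simp only [Function.iterate_succ_apply']
      exact (h.dampedC_val ht this).symm, rfl⟩)
  have s₂ := whileRuns_seq
    (test := fun s : NewtonState d => ltC (rd τ) (rd s.dec * rd s.dec))
    (body := fun s => (liftM (intermediateC b lam (lowerB b lam) t s) : Prog (NewtonState d)))
    n₂ (fun k => newtonData f ((intermediateStep f)^[k] y₁)) c₂
    (fun k hk => by
      have := hn₂ k hk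
      rw [pow_two] at this
      exact this)
    (by
      rw [pow_two] at hn₂'
      exact hn₂')
    (fun k _ => ⟨by
      have := hmem₂ (k + 1)
      rw [Function.iterate_succ_apply'] at this
      simp only [Function.iterate_succ_apply']
      exact (h.intermediateC_val ht this).symm, rfl⟩)
  have hd : 1 ≤ d := one_le_dim
  refine ⟨(intermediateStep f)^[n₂] y₁, n₁, n₂, _, ⟨y₁, _, _, r₁, r₂, ?_⟩,
    ⟨newtonData f y, _, _, ⟨(h.newtonDataC_val ht hy).symm, rfl⟩,
      ⟨newtonData f y₁, _, _, s₁, ⟨newtonData f _, _, 0, s₂, ⟨rfl, rfl⟩, rfl⟩, rfl⟩, rfl⟩,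
    hmem₂ n₂, hlt, not_lt.1 hn₂', ?_, hb₁, hb₁', hb₂⟩
  · simp
  · have e₀ := newtonDataC_cost_le b lam (lowerB b lam) t y hd
    have e₁ : ∀ k, (1 + c₁ k) ≤ 112 * d ^ 2 := fun k => by
      have := dampedC_cost_le (b := b) (lam := lam) (t := t) (lowerB b lam)
        (newtonData f ((dampedStep f)^[k] y)) hd
      have := Nat.pow_le_pow_left hd 2
      simp only [hc₁]; omega
    have e₂ : ∀ k, (2 + c₂ k) ≤ 112 * d ^ 2 := fun k => by
      have := intermediateC_cost_le (b := b) (lam := lam) (t := t) (lowerB b lam)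
        (newtonData f ((intermediateStep f)^[k] y₁)) hd
      have := Nat.pow_le_pow_left hd 2
      simp only [hc₂]; omega
    have e₃ : ∑ k ∈ Finset.range n₁, (1 + c₁ k) ≤ n₁ * (112 * d ^ 2) := by
      simpa using Finset.sum_le_card_nsmul (Finset.range n₁) _ _ fun k _ => e₁ k
    have e₄ : ∑ k ∈ Finset.range n₂, (2 + c₂ k) ≤ n₂ * (112 * d ^ 2) := by
      simpa using Finset.sum_le_card_nsmul (Finset.range n₂) _ _ fun k _ => e₂ k
    have hd2 := Nat.pow_le_pow_left hd 2
    change (newtonDataC b lam (lowerB b lam) t y).cost +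
      ((∑ k ∈ Finset.range n₁, (1 + c₁ k) + 1) + ((∑ k ∈ Finset.range n₂, (2 + c₂ k) + 2) + 0)) ≤ _
    nlinarith

end IsData

end

/-! ### The barrier loop -/

noncomputable section

variable {d : ℕ} [NeZero d] {b lam : Vec d}

/-- The number of barrier phases that remain at the parameter `t`. -/
def phases (d : ℕ) (ε η t : ℝ) : ℕ := ⌈Real.log (2 * ((d : ℝ) + 1) / (ε * t)) / Real.log η⌉₊

section
variable {ε η t : ℝ} (hε : 0 < ε) (hη : 1 < η) (ht : 0 < t)
include hε hη ht

omit [NeZero d] in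
theorem phases_eq_zero (h : phases d ε η t = 0) : ((d : ℝ) + 1) / t ≤ ε / 2 := by
  rw [phases, Nat.ceil_eq_zero, div_nonpos_iff] at h
  have hl := Real.log_pos hη
  have h1 : Real.log (2 * ((d : ℝ) + 1) / (ε * t)) ≤ 0 := by
    rcases h with h | h
    · linarith [h.2]
    · exact h.1
  have h2 := (Real.log_nonpos_iff (by positivity)).1 h1
  rw [div_le_one (by positivity)] at h2
  rw [div_le_iff₀ ht]
  linarith

-- Replacing `t` by `ηt` lowers the number under the ceiling by exactly 1, so each pass of the loop
-- uses up one phase.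
omit [NeZero d] in
theorem phases_mul (h : ε / 2 < ((d : ℝ) + 1) / t) : phases d ε η t = phases d ε η (η * t) + 1 := by
  have hl := Real.log_pos hη
  have hη0 : 0 < η := by linarith
  have h1 : 1 < 2 * ((d : ℝ) + 1) / (ε * t) := by
    rw [lt_div_iff₀ ht] at h
    rw [one_lt_div (by positivity)]
    linarith
  have h2 : Real.log (2 * ((d : ℝ) + 1) / (ε * (η * t))) / Real.log η =
      Real.log (2 * ((d : ℝ) + 1) / (ε * t)) / Real.log η - 1 := by
    rw [show 2 * ((d : ℝ) + 1) / (ε * (η * t)) = 2 * ((d : ℝ) + 1) / (ε * t) / η by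
      field_simp, Real.log_div (by positivity) hη0.ne']
    field_simp
  rw [phases, phases, h2, Nat.ceil_sub_one]
  have : 0 < ⌈Real.log (2 * ((d : ℝ) + 1) / (ε * t)) / Real.log η⌉₊ :=
    Nat.ceil_pos.2 (div_pos (Real.log_pos h1) hl)
  omega

end

/-- Bound for the Newton decrement at the beginning of a phase. -/
def decBound (ε : ℝ) : ℝ := min (1 / 4) (√ε)

/-- Bound for the gap at the beginning of a phase. -/
def gapBound (d : ℕ) (ε η : ℝ) : ℝ :=
  ((d : ℝ) + 1) * (η - 1 - Real.log η) + (η - 1) * √((d : ℝ) + 1) * decBound ε +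
    η * (2 / 3 * decBound ε ^ 2)

/-- Bound for the number of Newton steps of a phase. -/
def phaseBound (d : ℕ) (ε η : ℝ) : ℝ :=
  min (37.3 * gapBound d ε η) (2.9 + 15.76 * gapBound d ε η) +
    max 0 (Real.logb 2 (Real.logb 2 (2 / ε)) - 1 / 2)

namespace IsData

variable (h : IsData b lam) {ε η : ℝ} (hε : 0 < ε) (hη : 1 < η)
include h hε hη

theorem barrier_loop (n : ℕ) : ∀ (t : ℝ) (y : Vec d), tInit b lam ≤ t → y ∈ barrierDom b lam →
    decrement (objFt b lam t) y < 1 / 4 → decrement (objFt b lam t) y ^ 2 ≤ ε →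
    phases d ε η t = n →
    ∃ (t' : ℝ) (y' : Vec d) (N T : ℕ),
      WhileRuns (σ := ℝ × Vec d) (fun s => pure (ε / 2 < ((d : ℝ) + 1) / s.1))
        (fun s => do
          let y' ← newtonMethod (objFt b lam (η * s.1)) s.2 (ε / 2)
          pure (η * s.1, y')) (t, y) (t', y') N ∧
      WhileRuns (σ := ℝ × Vec d) (fun s => ltC (rd ε / rd 2) ((rd d + rd 1) / rd s.1))
        (fun s => do
          let t ← (rd η * rd s.1 : Counted ℝ)
          let tol ← (rd ε / rd 2 : Counted ℝ)
          let y' ← newtonMethodC b lam (lowerB b lam) t s.2 tol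
          pure (t, y')) (t, y) (t', y') T ∧
      tInit b lam ≤ t' ∧ y' ∈ barrierDom b lam ∧ decrement (objFt b lam t') y' < 1 / 4 ∧
      ((d : ℝ) + 1) / t' ≤ ε / 2 ∧ (N : ℝ) ≤ n * phaseBound d ε η ∧
      T ≤ 126 * d ^ 2 * (N + n) + 4 := by
  induction n with
  | zero =>
    intro t y ht hy h1 h2 hn
    have h3 := phases_eq_zero hε hη (h.tInit_pos.trans_le ht) hn
    -- The failing test costs 4: two divisions, one addition, one comparison.
    exact ⟨t, y, 0, 4, WhileRuns.halt (t, y) (not_lt.2 h3), WhileRuns.halt (t, y) (not_lt.2 h3),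
      ht, hy, h1, h3, by simp, by simp⟩
  | succ n ih =>
    intro t y ht hy h1 h2 hn
    have ht0 := h.tInit_pos.trans_le ht
    have htest : ε / 2 < ((d : ℝ) + 1) / t := by
      by_contra hc
      rw [not_lt] at hc
      have : phases d ε η t = 0 := by
        rw [phases, Nat.ceil_eq_zero]
        apply div_nonpos_of_nonpos_of_nonneg _ (Real.log_pos hη).le
        apply Real.log_nonpos (by positivity)
        rw [div_le_one (by positivity)]
        rw [div_le_iff₀ ht0] at hc
        linarith
      omega
    have hn' : phases d ε η (η * t) = n := by
      have := phases_mul (d := d) hε hη ht0 htest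
      omega
    have hηt : tInit b lam ≤ η * t := ht.trans (by nlinarith)
    have hgap : ∀ z ∈ barrierDom b lam,
        objFt b lam (η * t) y - objFt b lam (η * t) z ≤ gapBound d ε η := by
      intro z hz
      refine (h.path_step ht hy (by linarith) hz hη).trans ?_
      have hl0 := decrement_nonneg (objFt b lam t) y
      set l := decrement (objFt b lam t) y
      -- The bound `1/4` comes from the damped phase of the previous call, `√ε` from its tolerance.
      have hl : l ≤ decBound ε := le_min h1.le (Real.le_sqrt_of_sq_le h2)
      have hq : l ^ 2 / (2 * (1 - l)) ≤ 2 / 3 * decBound ε ^ 2 := by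
        -- `1 - l ≥ 3/4`.
        calc l ^ 2 / (2 * (1 - l)) ≤ 2 / 3 * l ^ 2 := by
              rw [div_le_iff₀ (by linarith)]; nlinarith [sq_nonneg l]
          _ ≤ _ := by gcongr
      rw [gapBound]
      have : 0 ≤ η - 1 := by linarith
      gcongr
    obtain ⟨y₁, n₁, n₂, T₁, r₁, s₁, hy₁, hd₁, hd₁', hT₁, hb₁, hb₁', hb₂⟩ :=
      h.newtonMethod_runs hηt hy hgap (half_pos hε)
    -- The calls in the loop stop at tolerance `ε/2`, which is stronger than the `ε` guaranteed by
    -- the first centering.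
    obtain ⟨t', y', N, T, r, s, h3, h4, h5, h6, h7, h8⟩ :=
      ih (η * t) y₁ hηt hy₁ hd₁ (by linarith) hn'
    refine ⟨t', y', n₁ + n₂ + N, 4 + (1 + (1 + (T₁ + 0))) + T, ?_, ?_, h3, h4, h5, h6, ?_, ?_⟩
    · have := WhileRuns.again (σ := ℝ × Vec d)
        (test := fun s => (pure (ε / 2 < ((d : ℝ) + 1) / s.1) : Counted Prop))
        (body := fun s => do
          let y' ← newtonMethod (objFt b lam (η * s.1)) s.2 (ε / 2)
          pure (η * s.1, y')) (t, y) (η * t, y₁) (t', y') (n₁ + n₂) N htest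
          ⟨y₁, n₁ + n₂, 0, r₁, ⟨rfl, rfl⟩, rfl⟩ r
      simpa using this
    · exact WhileRuns.again (σ := ℝ × Vec d)
        (test := fun s => ltC (rd ε / rd 2) ((rd d + rd 1) / rd s.1))
        (body := fun s => do
          let t ← (rd η * rd s.1 : Counted ℝ)
          let tol ← (rd ε / rd 2 : Counted ℝ)
          let y' ← newtonMethodC b lam (lowerB b lam) t s.2 tol
          pure (t, y')) (t, y) (η * t, y₁) (t', y') (1 + (1 + (T₁ + 0))) T htest
          ⟨η * t, 1, _, ⟨rfl, rfl⟩, ⟨ε / 2, 1, _, ⟨rfl, rfl⟩, ⟨y₁, T₁, 0, s₁, ⟨rfl, rfl⟩, rfl⟩,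
            rfl⟩, rfl⟩ s
    · have e1 : (n₁ : ℝ) ≤ min (37.3 * gapBound d ε η) (2.9 + 15.76 * gapBound d ε η) :=
        le_min hb₁ hb₁'
      have e2 : (n₂ : ℝ) ≤ max 0 (Real.logb 2 (Real.logb 2 (2 / ε)) - 1 / 2) := by
        rcases hb₂ with h0 | h0
        · simp [h0]
        · rw [one_div_div] at h0
          exact le_trans (by linarith) (le_max_right _ _)
      push_cast
      rw [phaseBound] at *
      linarith
    · have hd2 := Nat.pow_le_pow_left (one_le_dim (d := d)) 2
      nlinarith

/-- The barrier method: the algorithm and its implementation run alike. -/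
theorem barrierMethod_runs : ∃ (t : ℝ) (y : Vec d) (n₁ n₂ N T : ℕ),
    (barrierMethod b lam ε η).runs y (n₁ + n₂ + N) ∧
    (barrierMethodC b lam (lowerB b lam) (initY b lam) (tInit b lam) ε η).runs y T ∧
    tInit b lam ≤ t ∧ y ∈ barrierDom b lam ∧ decrement (objFt b lam t) y < 1 / 4 ∧
    ((d : ℝ) + 1) / t ≤ ε / 2 ∧
    (n₁ : ℝ) ≤ 37.3 * (centeringBound b lam / 38) ∧
    (n₂ = 0 ∨ (n₂ : ℝ) + 1 / 2 ≤ Real.logb 2 (Real.logb 2 (1 / ε))) ∧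
    (N : ℝ) ≤ phases d ε η (tInit b lam) * phaseBound d ε η ∧
    T ≤ 130 * d ^ 2 * (n₁ + n₂ + N + phases d ε η (tInit b lam) + 1) := by
  obtain ⟨y₁, n₁, n₂, T₁, r₁, s₁, hy₁, hd₁, hd₁', hT₁, hb₁, -, hb₂⟩ :=
    h.newtonMethod_runs le_rfl h.initY_mem (G := centeringBound b lam / 38)
      (fun z hz => by linarith [h.init_gap hz]) hε
  obtain ⟨t', y', N, T, r, s, h3, h4, h5, h6, h7, h8⟩ :=
    h.barrier_loop hε hη _ _ y₁ le_rfl hy₁ hd₁ hd₁' rfl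
  refine ⟨t', y', n₁, n₂, N, T₁ + (T + 0), ⟨y₁, _, _, r₁, ⟨(t', y'), N, 0, r, ⟨rfl, rfl⟩, rfl⟩, rfl⟩,
    ⟨y₁, _, _, s₁, ⟨(t', y'), T, 0, s, ⟨rfl, rfl⟩, rfl⟩, rfl⟩, h3, h4, h5, h6, hb₁, hb₂, h7, ?_⟩
  have hd2 := Nat.pow_le_pow_left (one_le_dim (d := d)) 2
  nlinarith

end IsData

end

/-! ### From gaps to the stated bounds -/

noncomputable section

variable {d : ℕ} [NeZero d] {b lam : Vec d}

/-- `sub_log_one_add_le` at `P = -x / (1 + x)`, where `1 + P = 1 / (1 + x)`. -/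
theorem half_sq_div_le {x : ℝ} (hx : 0 ≤ x) :
    x ^ 2 / (2 * (1 + x)) ≤ x - Real.log (1 + x) := by
  have h0 : (0 : ℝ) < 1 + x := by linarith
  have h1 := sub_log_one_add_le (κ := x / (1 + x)) (P := -(x / (1 + x)))
    (by rw [div_lt_one h0]; linarith) (by rw [abs_neg, abs_of_nonneg (by positivity)])
  rw [show 1 + -(x / (1 + x)) = (1 + x)⁻¹ by field_simp; ring,
    show 1 - x / (1 + x) = (1 + x)⁻¹ by field_simp; ring, Real.log_inv] at h1
  have h2 : (-(x / (1 + x))) ^ 2 / (2 * (1 + x)⁻¹) = x ^ 2 / (2 * (1 + x)) := by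
    field_simp
  have h3 : x ^ 2 / (2 * (1 + x)) * 2 + x / (1 + x) = x := by field_simp; ring
  linarith

/-- With `s = √(d+1)` this charges the cross term `(η - 1)√(d+1) l` of the gap to the main term,
uniformly in `η`: for `η - 1 ≤ 1` the main term is quadratic in `s(η - 1)`, for larger `η` it grows
linearly. -/
theorem mul_le_four_mul {η s : ℝ} (hη : 1 < η) (hs : 1 ≤ s) :
    (η - 1) * s ≤ 4 * (s ^ 2 * (η - 1 - Real.log η)) + 1 := by
  have h1 := half_sq_div_le (x := η - 1) (by linarith)
  rw [show 1 + (η - 1) = η by ring] at h1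
  set x := η - 1 with hx
  have hx0 : 0 < x := by rw [hx]; linarith
  have h2 : 4 * (s ^ 2 * (x ^ 2 / (2 * η))) ≤ 4 * (s ^ 2 * (x - Real.log η)) := by gcongr
  refine le_trans ?_ (add_le_add_left h2 1)
  have hη' : η = 1 + x := by rw [hx]; ring
  rw [hη']
  rcases le_total x 1 with h | h
  · have : x ^ 2 / (2 * 2) ≤ x ^ 2 / (2 * (1 + x)) := by gcongr; linarith
    nlinarith [sq_nonneg (s * x - 1)]
  · have : x / 4 ≤ x ^ 2 / (2 * (1 + x)) := by
      rw [div_le_div_iff₀ (by norm_num) (by positivity)]; nlinarith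
    nlinarith [mul_nonneg hx0.le (mul_nonneg (by linarith : (0 : ℝ) ≤ s) (sub_nonneg.2 hs))]

theorem sub_log_le_half_sq {x : ℝ} (hx : 0 ≤ x) : x - Real.log (1 + x) ≤ x ^ 2 / 2 := by
  have h1 := Real.le_log_one_add_of_nonneg hx
  have h2 : x - x ^ 2 / 2 ≤ 2 * x / (x + 2) := by
    rw [le_div_iff₀ (by linarith)]
    nlinarith [mul_nonneg hx (sq_nonneg x)]
  linarith

section
variable {ε η : ℝ} (hε : 0 < ε)
include hε

theorem one_le_loglog (hε2 : ε ≤ 1 / 2) : 1 ≤ Real.logb 2 (Real.logb 2 (2 / ε)) := by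
  have h1 : 2 ≤ Real.logb 2 (2 / ε) := by
    rw [Real.le_logb_iff_rpow_le (by norm_num) (by positivity), le_div_iff₀ hε]
    norm_num; linarith
  rw [Real.le_logb_iff_rpow_le (by norm_num) (by linarith)]
  simpa using h1

theorem loglog_nonneg (hε2 : ε ≤ 1 / 2) : 0 ≤ Real.logb 2 (Real.logb 2 (1 / ε)) := by
  have h1 : 1 ≤ Real.logb 2 (1 / ε) := by
    rw [Real.le_logb_iff_rpow_le (by norm_num) (by positivity), le_div_iff₀ hε]
    norm_num; linarith
  exact Real.logb_nonneg (by norm_num) h1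

theorem loglog_pos (hε2 : ε ≤ 1 / 10 ^ 6) : 0 < Real.logb 2 (Real.logb 2 (1 / ε)) := by
  have h1 : 2 ≤ Real.logb 2 (1 / ε) := by
    rw [Real.le_logb_iff_rpow_le (by norm_num) (by positivity), le_div_iff₀ hε]
    norm_num at hε2 ⊢; linarith
  exact Real.logb_pos (by norm_num) (by linarith)

theorem loglog_le (hε2 : ε ≤ 1 / 2) :
    Real.logb 2 (Real.logb 2 (1 / ε)) ≤ Real.logb 2 (Real.logb 2 (2 / ε)) := by
  have h1 : 1 ≤ Real.logb 2 (1 / ε) := by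
    rw [Real.le_logb_iff_rpow_le (by norm_num) (by positivity), le_div_iff₀ hε]
    norm_num; linarith
  apply Real.logb_le_logb_of_le (by norm_num) (by linarith)
  apply Real.logb_le_logb_of_le (by norm_num) (by positivity)
  gcongr
  norm_num

omit hε in
theorem decBound_nonneg : 0 ≤ decBound ε := le_min (by norm_num) (Real.sqrt_nonneg _)

-- Inexact centering with decrement at most `δ` multiplies the main term by `1 + O(δ)` and adds
-- `O(δ)`.
omit hε in
omit [NeZero d] in
theorem phaseBound_le_small (hη : 1 < η) (hε2 : 1 ≤ Real.logb 2 (Real.logb 2 (2 / ε))) {δ : ℝ}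
    (hδ : decBound ε ≤ δ) : phaseBound d ε η ≤
      37.3 * (((d : ℝ) + 1) * (η - 1 - Real.log η) * (1 + 4 * δ + 8 / 3 * δ ^ 2) + δ + 4 / 3 * δ ^ 2)
        + Real.logb 2 (Real.logb 2 (2 / ε)) - 1 / 2 := by
  have h0 := decBound_nonneg (ε := ε)
  have hd : (0 : ℝ) ≤ d := Nat.cast_nonneg d
  have hs : 1 ≤ √((d : ℝ) + 1) := by rw [Real.one_le_sqrt]; linarith
  have h1 := mul_le_four_mul hη hs
  rw [Real.sq_sqrt (by linarith)] at h1
  have hE : 0 ≤ η - 1 - Real.log η := by linarith [Real.log_le_sub_one_of_pos (x := η) (by linarith)]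
  -- The case `s = 1` bounds `η` itself by `4X + 2`.
  have h2 := mul_le_four_mul hη le_rfl
  have hX : η - 1 - Real.log η ≤ ((d : ℝ) + 1) * (η - 1 - Real.log η) :=
    le_mul_of_one_le_left hE (by linarith)
  set X := ((d : ℝ) + 1) * (η - 1 - Real.log η)
  have h3 : η ≤ 4 * X + 2 := by linarith
  have h4 : gapBound d ε η ≤ X * (1 + 4 * δ + 8 / 3 * δ ^ 2) + δ + 4 / 3 * δ ^ 2 := by
    have e1 : (η - 1) * √((d : ℝ) + 1) * decBound ε ≤ (4 * X + 1) * δ := by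
      have : 0 ≤ 4 * X + 1 := by linarith
      gcongr
    have e2 : η * (2 / 3 * decBound ε ^ 2) ≤ (4 * X + 2) * (2 / 3 * δ ^ 2) := by
      have : 0 ≤ 4 * X + 2 := by linarith
      gcongr
    rw [gapBound]
    linarith
  have h5 := min_le_left (37.3 * gapBound d ε η) (2.9 + 15.76 * gapBound d ε η)
  rw [phaseBound, max_eq_right (by linarith)]
  linarith

-- `ε ≤ 10⁻⁶` gives `δ = 1/1000`: then `37.3(1 + 4δ + 8δ²/3) < 38`, and the additive error is below
-- the spare `1/2`.
omit [NeZero d] in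
theorem phaseBound_lt (hη : 1 < η) (hε2 : ε ≤ 1 / 10 ^ 6) : phaseBound d ε η ≤
    38 * ((d : ℝ) + 1) * (η - 1 - Real.log η) + Real.logb 2 (Real.logb 2 (2 / ε)) := by
  have h1 : decBound ε ≤ 1 / 1000 := by
    refine (min_le_right _ _).trans ?_
    rw [Real.sqrt_le_left (by norm_num)]
    norm_num at hε2 ⊢; linarith
  have h2 := phaseBound_le_small (d := d) hη
    (one_le_loglog hε (hε2.trans (by norm_num))) h1
  have hE : 0 ≤ η - 1 - Real.log η := by linarith [Real.log_le_sub_one_of_pos (x := η) (by linarith)]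
  have hX : 0 ≤ ((d : ℝ) + 1) * (η - 1 - Real.log η) := by positivity
  rw [mul_assoc]
  norm_num at h2
  linarith

-- With only `δ = 1/4` available a constant factor is lost, which is harmless for the running time.
-- The additive constant is charged to the double logarithm, which is at least 1.
omit [NeZero d] in
theorem phaseBound_le (hη : 1 < η) (hε2 : ε ≤ 1 / 2) : phaseBound d ε η ≤
    14 * (38 * ((d : ℝ) + 1) * (η - 1 - Real.log η) + Real.logb 2 (Real.logb 2 (2 / ε))) := by
  have h2 := phaseBound_le_small (d := d) hη (one_le_loglog hε hε2)
    (min_le_left (1 / 4) (√ε))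
  have hE : 0 ≤ η - 1 - Real.log η := by linarith [Real.log_le_sub_one_of_pos (x := η) (by linarith)]
  have hX : 0 ≤ ((d : ℝ) + 1) * (η - 1 - Real.log η) := by positivity
  have h3 := one_le_loglog hε hε2
  rw [mul_assoc]
  norm_num at h2
  linarith

-- For this `η` the gap is at most `1/2 + 1/4 + 1/12 < 1`, and `2.9 + 15.76 - 1/2 < 19`.
omit [NeZero d] in
theorem phaseBound_sqrt_le (hε2 : ε ≤ 1 / 2) : phaseBound d ε (1 + 1 / √((d : ℝ) + 1)) ≤
    19 + Real.logb 2 (Real.logb 2 (2 / ε)) := by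
  have hd : (0 : ℝ) ≤ d := Nat.cast_nonneg d
  have hs : 1 ≤ √((d : ℝ) + 1) := by rw [Real.one_le_sqrt]; linarith
  have hsq := Real.sq_sqrt (show (0 : ℝ) ≤ d + 1 by linarith)
  have h0 := decBound_nonneg (ε := ε)
  have h1 : decBound ε ≤ 1 / 4 := min_le_left _ _
  have h3 := one_le_loglog hε hε2
  have h4 : gapBound d ε (1 + 1 / √((d : ℝ) + 1)) ≤ 1 := by
    rw [gapBound]
    set s := √((d : ℝ) + 1)
    have hs0 : 0 < s := by linarith
    have e1 : ((d : ℝ) + 1) * (1 + 1 / s - 1 - Real.log (1 + 1 / s)) ≤ 1 / 2 := by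
      have := sub_log_le_half_sq (x := 1 / s) (by positivity)
      calc _ ≤ ((d : ℝ) + 1) * ((1 / s) ^ 2 / 2) := by
            gcongr; linarith
        _ = 1 / 2 := by rw [← hsq]; field_simp
    have e2 : (1 + 1 / s - 1) * s = 1 := by field_simp; ring
    have e3 : 1 + 1 / s ≤ 2 := by
      have : 1 / s ≤ 1 := by rw [div_le_one hs0]; exact hs
      linarith
    have e4 : (1 + 1 / s) * (2 / 3 * decBound ε ^ 2) ≤ 2 * (2 / 3 * (1 / 4) ^ 2) := by gcongr
    rw [e2]
    linarith
  have h5 := min_le_right (37.3 * gapBound d ε (1 + 1 / √((d : ℝ) + 1)))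
    (2.9 + 15.76 * gapBound d ε (1 + 1 / √((d : ℝ) + 1)))
  rw [phaseBound, max_eq_right (by linarith)]
  linarith

-- Bernoulli's inequality `2^{1/s} ≤ 1 + 1/s` with `s = √(d+1)`; if the logarithm in the numerator
-- is not positive, there are no phases.
omit hε in
omit [NeZero d] in
theorem phases_sqrt_le {t : ℝ} : phases d ε (1 + 1 / √((d : ℝ) + 1)) t ≤
    ⌈√((d : ℝ) + 1) * Real.logb 2 (2 * ((d : ℝ) + 1) / (ε * t))⌉₊ := by
  have hd : (0 : ℝ) ≤ d := Nat.cast_nonneg d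
  have hs : 1 ≤ √((d : ℝ) + 1) := by rw [Real.one_le_sqrt]; linarith
  rw [phases]
  set s := √((d : ℝ) + 1)
  have hs0 : 0 < s := by linarith
  have hl2 : 0 < Real.log 2 := Real.log_pos (by norm_num)
  have hlog : 1 / s * Real.log 2 ≤ Real.log (1 + 1 / s) := by
    rw [← Real.log_rpow (by norm_num)]
    apply Real.log_le_log (by positivity)
    have := rpow_one_add_le_one_add_mul_self (s := (1 : ℝ)) (by norm_num) (p := 1 / s)
      (by positivity) (by rw [div_le_one hs0]; exact hs)
    norm_num at this ⊢
    exact this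
  set L := Real.log (2 * ((d : ℝ) + 1) / (ε * t)) with hL
  rcases le_or_gt L 0 with h | h
  · have : ⌈L / Real.log (1 + 1 / s)⌉₊ = 0 := by
      rw [Nat.ceil_eq_zero]
      exact div_nonpos_of_nonpos_of_nonneg h (le_trans (by positivity) hlog)
    rw [this]; exact Nat.zero_le _
  · apply Nat.ceil_mono
    rw [Real.logb, ← hL]
    calc L / Real.log (1 + 1 / s) ≤ L / (1 / s * Real.log 2) := by gcongr
      _ = _ := by field_simp

end

namespace IsData

variable (h : IsData b lam) {ε η : ℝ} (hε : 0 < ε) {n₁ n₂ N : ℕ}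
  (h₁ : (n₁ : ℝ) ≤ 37.3 * (centeringBound b lam / 38))
  (h₂ : n₂ = 0 ∨ (n₂ : ℝ) + 1 / 2 ≤ Real.logb 2 (Real.logb 2 (1 / ε)))
  (h₃ : (N : ℝ) ≤ phases d ε η (tInit b lam) * phaseBound d ε η)
include h hε h₁ h₂ h₃

/-- Strictness comes from the first double logarithm: it exceeds `n₂` by `1/2`, or is positive when
`n₂ = 0`. -/
theorem steps_lt_nTot (hη : 1 < η) (hε2 : ε ≤ 1 / 10 ^ 6) :
    ((n₁ + n₂ + N : ℕ) : ℝ) < nTot b lam ε η := by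
  have hc := h.centeringBound_nonneg
  have e2 : (n₂ : ℝ) < Real.logb 2 (Real.logb 2 (1 / ε)) := by
    rcases h₂ with h0 | h0
    · rw [h0, Nat.cast_zero]; exact loglog_pos hε hε2
    · linarith
  have e3 : (phases d ε η (tInit b lam) : ℝ) * phaseBound d ε η ≤ phases d ε η (tInit b lam) *
      (38 * ((d : ℝ) + 1) * (η - 1 - Real.log η) + Real.logb 2 (Real.logb 2 (2 / ε))) := by
    gcongr
    exact phaseBound_lt hε hη hε2
  rw [nTot]
  change _ < _ + _ + _ * (phases d ε η (tInit b lam) : ℝ)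
  push_cast
  linarith

/-- The `+ 1` in the last factor pays for the `n₂` intermediate steps of the first centering. -/
theorem steps_lt_nTotSqrt (hη : η = 1 + 1 / √((d : ℝ) + 1)) (hε2 : ε ≤ 1 / 2) :
    ((n₁ + n₂ + N : ℕ) : ℝ) < nTotSqrt b lam ε := by
  have hc := h.centeringBound_nonneg
  have hl := one_le_loglog hε hε2
  have e2 : (n₂ : ℝ) < 19 + Real.logb 2 (Real.logb 2 (2 / ε)) := by
    rcases h₂ with h0 | h0
    · rw [h0, Nat.cast_zero]; linarith
    · linarith [loglog_le hε hε2]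
  have e3 : (phases d ε η (tInit b lam) : ℝ) * phaseBound d ε η ≤
      ⌈√((d : ℝ) + 1) * Real.logb 2 (2 * ((d : ℝ) + 1) / (ε * tInit b lam))⌉₊ *
        (19 + Real.logb 2 (Real.logb 2 (2 / ε))) := by
    rw [hη]
    calc _ ≤ (phases d ε (1 + 1 / √((d : ℝ) + 1)) (tInit b lam) : ℝ) *
          (19 + Real.logb 2 (Real.logb 2 (2 / ε))) := by
            gcongr; exact phaseBound_sqrt_le hε hε2
      _ ≤ _ := by
            gcongr; exact phases_sqrt_le
  rw [nTotSqrt]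
  push_cast
  linarith

/-- `15 = 14 + 1`: a phase has a cost even if it takes no Newton step, and the number of phases is
charged to the double logarithm in its factor. -/
theorem steps_add_phases_le (hη : 1 < η) (hε2 : ε ≤ 1 / 2) :
    ((n₁ + n₂ + N + phases d ε η (tInit b lam) : ℕ) : ℝ) ≤ 15 * nTot b lam ε η := by
  have hc := h.centeringBound_nonneg
  have hl := one_le_loglog hε hε2
  have hl' := loglog_nonneg hε hε2
  have e2 : (n₂ : ℝ) ≤ Real.logb 2 (Real.logb 2 (1 / ε)) := by
    rcases h₂ with h0 | h0
    · rw [h0, Nat.cast_zero]; exact hl'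
    · linarith
  have hE : 0 ≤ η - 1 - Real.log η := by linarith [Real.log_le_sub_one_of_pos (x := η) (by linarith)]
  have hX : 0 ≤ 38 * ((d : ℝ) + 1) * (η - 1 - Real.log η) := by positivity
  set K := (phases d ε η (tInit b lam) : ℝ) with hK
  have hK0 : 0 ≤ K := Nat.cast_nonneg _
  have e3 : K * phaseBound d ε η ≤ K *
      (14 * (38 * ((d : ℝ) + 1) * (η - 1 - Real.log η) + Real.logb 2 (Real.logb 2 (2 / ε)))) := by
    gcongr
    exact phaseBound_le hε hη hε2
  have e4 : K * 1 ≤ K *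
      (38 * ((d : ℝ) + 1) * (η - 1 - Real.log η) + Real.logb 2 (Real.logb 2 (2 / ε))) := by
    gcongr; linarith
  rw [nTot]
  change _ ≤ 15 * (_ + _ + _ * (phases d ε η (tInit b lam) : ℝ))
  push_cast
  rw [← hK]
  linarith

end IsData

end

/-! ### Eigenvalue decompositions and reduction of the bilinear problem to `F` -/

noncomputable section

variable {d : ℕ}

namespace IsEigenDecomp

variable {M U : Mat d} {lam : Vec d} (h : IsEigenDecomp M U lam)
include h

theorem transpose_mul : Uᵀ * U = 1 := mul_eq_one_comm.1 h.orthogonal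

theorem conj_mul_conj (v w : Vec d) :
    (Uᵀ * Matrix.diagonal v * U) * (Uᵀ * Matrix.diagonal w * U) =
      Uᵀ * Matrix.diagonal (fun i => v i * w i) * U := by
  rw [← Matrix.diagonal_mul_diagonal]
  calc _ = Uᵀ * Matrix.diagonal v * (U * Uᵀ) * Matrix.diagonal w * U := by
        simp only [Matrix.mul_assoc]
    _ = _ := by rw [h.orthogonal, Matrix.mul_one, Matrix.mul_assoc Uᵀ]

theorem conj_one : Uᵀ * Matrix.diagonal (fun _ => (1 : ℝ)) * U = 1 := by
  rw [Matrix.diagonal_one, Matrix.mul_one, h.transpose_mul]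

theorem diagonal_eq : Matrix.diagonal lam = U * M * Uᵀ := by
  rw [h.eq]
  calc Matrix.diagonal lam = 1 * Matrix.diagonal lam * 1 := by simp
    _ = _ := by rw [← h.orthogonal]; simp only [Matrix.mul_assoc]

theorem pos (hM : M.PosDef) (i : Fin d) : 0 < lam i := by
  have hU : Function.Injective U.vecMul := by
    intro v w hvw
    have := congrArg (fun z => z ᵥ* Uᵀ) hvw
    simpa [Matrix.vecMul_vecMul, h.orthogonal] using this
  have h1 := hM.mul_mul_conjTranspose_same hU
  rw [Matrix.conjTranspose_eq_transpose_of_trivial, ← h.diagonal_eq, Matrix.posDef_diagonal_iff] at h1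
  exact h1 i

theorem inv_eq (hM : M.PosDef) : M⁻¹ = Uᵀ * Matrix.diagonal (fun i => 1 / lam i) * U := by
  apply Matrix.inv_eq_right_inv
  rw [h.eq, h.conj_mul_conj]
  have e : (fun i => lam i * (1 / lam i)) = fun _ => (1 : ℝ) :=
    funext fun i => mul_one_div_cancel (h.pos hM i).ne'
  rw [e, h.conj_one]

open scoped MatrixOrder in
theorem rootMat_eq (hM : M.PosDef) :
    rootMat M = Uᵀ * Matrix.diagonal (fun i => √(lam i)) * U := by
  apply CFC.sqrt_unique
  · rw [h.conj_mul_conj]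
    conv_rhs => rw [h.eq]
    congr 3
    funext i
    exact Real.mul_self_sqrt (h.pos hM i).le
  · rw [Matrix.nonneg_iff_posSemidef]
    have h1 : (Matrix.diagonal fun i => √(lam i)).PosSemidef :=
      Matrix.posSemidef_diagonal_iff.2 fun i => Real.sqrt_nonneg _
    have := h1.conjTranspose_mul_mul_same U
    rwa [Matrix.conjTranspose_eq_transpose_of_trivial] at this

theorem rootMat_inv_eq (hM : M.PosDef) :
    (rootMat M)⁻¹ = Uᵀ * Matrix.diagonal (fun i => 1 / √(lam i)) * U := by
  apply Matrix.inv_eq_right_inv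
  rw [h.rootMat_eq hM, h.conj_mul_conj]
  have e : (fun i => √(lam i) * (1 / √(lam i))) = fun _ => (1 : ℝ) :=
    funext fun i => mul_one_div_cancel (Real.sqrt_pos.2 (h.pos hM i)).ne'
  rw [e, h.conj_one]

end IsEigenDecomp

theorem isSymm_of_posDef {A : Mat d} (hA : A.PosDef) : A.IsSymm := by
  have := hA.isHermitian
  rwa [Matrix.IsHermitian, Matrix.conjTranspose_eq_transpose_of_trivial] at this

section
variable {A : Mat d} (hA : A.PosDef)
include hA

theorem rootMat_transpose : (rootMat A)ᵀ = rootMat A := by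
  obtain ⟨p, hp⟩ := exists_eigenDecomp A (isSymm_of_posDef hA)
  rw [hp.rootMat_eq hA]
  simp only [Matrix.transpose_mul, Matrix.transpose_transpose, Matrix.diagonal_transpose,
    Matrix.mul_assoc]

theorem rootMat_mul_self : rootMat A * rootMat A = A := by
  obtain ⟨p, hp⟩ := exists_eigenDecomp A (isSymm_of_posDef hA)
  rw [hp.rootMat_eq hA, hp.conj_mul_conj]
  conv_rhs => rw [hp.eq]
  congr 3
  funext i
  exact Real.mul_self_sqrt (hp.pos hA i).le

theorem isUnit_det_rootMat : IsUnit (rootMat A).det := by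
  have h1 : IsUnit A.det := (Matrix.isUnit_iff_isUnit_det _).1 hA.isUnit
  rw [← rootMat_mul_self hA, Matrix.det_mul] at h1
  exact isUnit_of_mul_isUnit_left h1

theorem rootMat_inv_transpose : ((rootMat A)⁻¹)ᵀ = (rootMat A)⁻¹ := by
  rw [Matrix.transpose_nonsing_inv, rootMat_transpose hA]

theorem posDef_conj {W : Mat d} (hW : W.PosDef) : (rootMat A * W * rootMat A).PosDef := by
  have hinj : Function.Injective (rootMat A).vecMul := by
    intro v w hvw
    have := congrArg (fun z => z ᵥ* (rootMat A)⁻¹) hvw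
    simpa [Matrix.vecMul_vecMul, Matrix.mul_nonsing_inv _ (isUnit_det_rootMat hA)] using this
  have := hW.mul_mul_conjTranspose_same hinj
  rwa [Matrix.conjTranspose_eq_transpose_of_trivial, rootMat_transpose hA] at this

theorem rootMat_inv_mul_self : (rootMat A)⁻¹ * (rootMat A)⁻¹ = A⁻¹ := by
  rw [← Matrix.mul_inv_rev, rootMat_mul_self hA]

/-- The Cauchy-Schwarz inequality for `‖·‖_A` and the dual norm. -/
theorem dotProduct_le_wnorm_mul_wnorm (x z : Vec d) : x ⬝ᵥ z ≤ wnorm A⁻¹ x * wnorm A z := by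
  have h1 : x ⬝ᵥ z = ((rootMat A)⁻¹ *ᵥ x) ⬝ᵥ (rootMat A *ᵥ z) := by
    rw [Matrix.dotProduct_mulVec, ← Matrix.mulVec_transpose, rootMat_transpose hA,
      Matrix.mulVec_mulVec, Matrix.mul_nonsing_inv _ (isUnit_det_rootMat hA), Matrix.one_mulVec]
  have h2 : x ⬝ᵥ (A⁻¹ *ᵥ x) = ((rootMat A)⁻¹ *ᵥ x) ⬝ᵥ ((rootMat A)⁻¹ *ᵥ x) := by
    rw [Matrix.dotProduct_mulVec ((rootMat A)⁻¹ *ᵥ x), ← Matrix.mulVec_transpose,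
      rootMat_inv_transpose hA, Matrix.mulVec_mulVec, rootMat_inv_mul_self hA, dotProduct_comm]
  have h3 : z ⬝ᵥ (A *ᵥ z) = (rootMat A *ᵥ z) ⬝ᵥ (rootMat A *ᵥ z) := by
    rw [Matrix.dotProduct_mulVec (rootMat A *ᵥ z), ← Matrix.mulVec_transpose,
      rootMat_transpose hA, Matrix.mulVec_mulVec, rootMat_mul_self hA, dotProduct_comm]
  rw [wnorm, wnorm, h1, h2, h3]
  have := Real.sum_mul_le_sqrt_mul_sqrt Finset.univ ((rootMat A)⁻¹ *ᵥ x) (rootMat A *ᵥ z)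
  simpa only [dotProduct, pow_two] using this

end

section
variable {A W : Mat d} {c : Vec d} (eig : EigenRoutine d) (hA : A.PosDef) (hW : W.PosDef)
include hA hW

theorem decomp_conj : IsEigenDecomp (rootMat A * W * rootMat A) (basisOf eig A W) (lamOf eig A W) :=
  eig.spec _ (isSymm_of_posDef (posDef_conj hA hW))

theorem isData_of [NeZero d] (hc : c ≠ 0) : IsData (centerOf eig A W c) (lamOf eig A W) := by
  have hD := decomp_conj eig hA hW
  refine ⟨hD.pos (posDef_conj hA hW), hD.antitone, ?_⟩
  by_contra hb
  push Not at hb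
  have hb0 : centerOf eig A W c = 0 := funext hb
  apply hc
  have h1 : (rootMat A * (basisOf eig A W)ᵀ) *ᵥ centerOf eig A W c = c := by
    rw [centerOf, Matrix.mulVec_mulVec, Matrix.mulVec_mulVec, Matrix.mul_assoc (rootMat A),
      hD.transpose_mul, Matrix.mul_one, Matrix.mul_nonsing_inv _ (isUnit_det_rootMat hA),
      Matrix.one_mulVec]
  rw [← h1, hb0, Matrix.mulVec_zero]

/-- The change of variables `x = A^{-1/2} Uᵀ w`. -/
def coord (w : Vec d) : Vec d := (rootMat A)⁻¹ *ᵥ ((basisOf eig A W)ᵀ *ᵥ w)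

omit hW in
theorem coord_dot (w v : Vec d) : coord (A := A) (W := W) eig w ⬝ᵥ v =
    w ⬝ᵥ (basisOf eig A W *ᵥ ((rootMat A)⁻¹ *ᵥ v)) := by
  rw [coord, dotProduct_comm, Matrix.dotProduct_mulVec, ← Matrix.mulVec_transpose,
    rootMat_inv_transpose hA, Matrix.dotProduct_mulVec, ← Matrix.mulVec_transpose,
    Matrix.transpose_transpose, dotProduct_comm]

/-- In the coordinates `w` the matrix `A` becomes the identity; in `coord_inv` the matrix `W⁻¹`
becomes `diag(1/λ)`. -/
theorem coord_root (w : Vec d) : coord (A := A) (W := W) eig w ⬝ᵥ (A *ᵥ coord (A := A) (W := W) eig w)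
    = ∑ i, w i ^ 2 := by
  have hD := decomp_conj eig hA hW
  rw [coord_dot eig hA, coord, Matrix.mulVec_mulVec, Matrix.mulVec_mulVec, Matrix.mulVec_mulVec,
    Matrix.mulVec_mulVec]
  have hu := isUnit_det_rootMat hA
  have e : basisOf eig A W * (rootMat A)⁻¹ * A * (rootMat A)⁻¹ * (basisOf eig A W)ᵀ = 1 := by
    have : (rootMat A)⁻¹ * A * (rootMat A)⁻¹ = 1 := by
      calc _ = (rootMat A)⁻¹ * (rootMat A * rootMat A) * (rootMat A)⁻¹ := by
            rw [rootMat_mul_self hA]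
        _ = ((rootMat A)⁻¹ * rootMat A) * (rootMat A * (rootMat A)⁻¹) := by
            simp only [Matrix.mul_assoc]
        _ = 1 := by rw [Matrix.nonsing_inv_mul _ hu, Matrix.mul_nonsing_inv _ hu, Matrix.mul_one]
    calc _ = basisOf eig A W * ((rootMat A)⁻¹ * A * (rootMat A)⁻¹) * (basisOf eig A W)ᵀ := by
          simp only [Matrix.mul_assoc]
      _ = 1 := by rw [this, Matrix.mul_one, hD.orthogonal]
  rw [e, Matrix.one_mulVec, dotProduct]
  exact Finset.sum_congr rfl fun i _ => by ring

theorem coord_inv (w : Vec d) :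
    coord (A := A) (W := W) eig w ⬝ᵥ (W⁻¹ *ᵥ coord (A := A) (W := W) eig w)
      = ∑ i, 1 / lamOf eig A W i * w i ^ 2 := by
  have hD := decomp_conj eig hA hW
  have hP := posDef_conj hA hW
  rw [coord_dot eig hA, coord, Matrix.mulVec_mulVec, Matrix.mulVec_mulVec, Matrix.mulVec_mulVec,
    Matrix.mulVec_mulVec]
  have e : basisOf eig A W * (rootMat A)⁻¹ * W⁻¹ * (rootMat A)⁻¹ * (basisOf eig A W)ᵀ =
      Matrix.diagonal fun i => 1 / lamOf eig A W i := by
    have h1 : (rootMat A)⁻¹ * W⁻¹ * (rootMat A)⁻¹ = (rootMat A * W * rootMat A)⁻¹ := by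
      rw [Matrix.mul_inv_rev, Matrix.mul_inv_rev, Matrix.mul_assoc]
    calc _ = basisOf eig A W * ((rootMat A)⁻¹ * W⁻¹ * (rootMat A)⁻¹) * (basisOf eig A W)ᵀ := by
          simp only [Matrix.mul_assoc]
      _ = (basisOf eig A W * (basisOf eig A W)ᵀ) * Matrix.diagonal (fun i => 1 / lamOf eig A W i) *
          (basisOf eig A W * (basisOf eig A W)ᵀ) := by
          rw [h1, hD.inv_eq hP]; simp only [Matrix.mul_assoc]
      _ = _ := by rw [hD.orthogonal, Matrix.mul_one, Matrix.one_mul]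
  rw [e, dotProduct]
  refine Finset.sum_congr rfl fun i _ => ?_
  rw [Matrix.mulVec_diagonal]; ring

theorem coord_surj (x : Vec d) : ∃ w, coord (A := A) (W := W) eig w = x := by
  have hD := decomp_conj eig hA hW
  refine ⟨basisOf eig A W *ᵥ (rootMat A *ᵥ x), ?_⟩
  rw [coord, Matrix.mulVec_mulVec (rootMat A *ᵥ x), hD.transpose_mul, Matrix.one_mulVec,
    Matrix.mulVec_mulVec, Matrix.nonsing_inv_mul _ (isUnit_det_rootMat hA), Matrix.one_mulVec]

omit hA hW in
theorem sgn_sq (r : ℝ) : sgn r ^ 2 = 1 := by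
  unfold sgn; split_ifs <;> norm_num

omit hA hW in
theorem mul_sgn (r : ℝ) : r * sgn r = |r| := by
  unfold sgn
  split_ifs with h
  · rw [abs_of_neg h]; ring
  · rw [abs_of_nonneg (not_lt.1 h)]; ring

/-- A nearly optimal `y` gives a nearly optimal pair. -/
theorem isEpsSolution_of {ε : ℝ} {y : Vec d} (hy : ∀ i, 0 ≤ y i) (hy1 : ∑ i, y i ≤ 1)
    (hopt : ∀ w : Vec d, ∑ i, w i ^ 2 ≤ 1 → ∑ i, |centerOf eig A W c i| * |w i| +
      √(∑ i, 1 / lamOf eig A W i * w i ^ 2) ≤ -objF (centerOf eig A W c) (lamOf eig A W) y + ε)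
    {x : Vec d} (hx : x = (rootMat A)⁻¹ *ᵥ
      ((basisOf eig A W)ᵀ *ᵥ fun i => √(y i) * sgn (centerOf eig A W c i))) :
    IsEpsSolution A W c ε x (c + (1 / wnorm W⁻¹ x) • (W⁻¹ *ᵥ x)) := by
  set b := centerOf eig A W c with hb
  set w₀ : Vec d := fun i => √(y i) * sgn (b i) with hw₀
  have hx' : x = coord (A := A) (W := W) eig w₀ := hx
  have hw₀2 : ∀ i, w₀ i ^ 2 = y i := fun i => by
    simp only [hw₀]; rw [mul_pow, sgn_sq, mul_one, Real.sq_sqrt (hy i)]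
  have hWu : IsUnit W.det := (Matrix.isUnit_iff_isUnit_det _).1 hW.isUnit
  have hn : wnorm W⁻¹ x = √(∑ i, 1 / lamOf eig A W i * y i) := by
    rw [wnorm, hx', coord_inv eig hA hW]; simp only [hw₀2]
  have hxx : x ⬝ᵥ (W⁻¹ *ᵥ x) = wnorm W⁻¹ x ^ 2 := by
    rw [wnorm, Real.sq_sqrt]
    have := hW.inv.posSemidef.dotProduct_mulVec_nonneg x
    simpa only [star_trivial] using this
  set n := wnorm W⁻¹ x with hndef
  have hn0 : 0 ≤ n := Real.sqrt_nonneg _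
  refine ⟨?_, ?_, ?_⟩
  · change wnorm A (x - 0) ≤ 1
    rw [sub_zero, wnorm, hx', coord_root eig hA hW]
    simp only [hw₀2]
    exact Real.sqrt_le_one.2 hy1
  · change wnorm W (c + (1 / n) • (W⁻¹ *ᵥ x) - c) ≤ 1
    rw [add_sub_cancel_left, wnorm]
    apply Real.sqrt_le_one.2
    rw [Matrix.mulVec_smul, Matrix.mulVec_mulVec, Matrix.mul_nonsing_inv _ hWu, Matrix.one_mulVec,
      smul_dotProduct, dotProduct_smul, dotProduct_comm, hxx, smul_eq_mul, smul_eq_mul]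
    -- If `n = 0`, then `1 / n = 0` and `θ` is the center `c`.
    rcases hn0.eq_or_lt with h0 | h0
    · rw [← h0]; norm_num
    · apply le_of_eq; field_simp
  · intro x' hx'mem θ' hθ'
    change wnorm A (x' - 0) ≤ 1 at hx'mem
    change wnorm W (θ' - c) ≤ 1 at hθ'
    -- `θ` attains equality in Cauchy-Schwarz for `x`, and the signs in `w₀` turn `w₀ᵀb` into `∑ |b
    -- i| √(y i)`.
    have hval : x ⬝ᵥ (c + (1 / n) • (W⁻¹ *ᵥ x)) = -objF b (lamOf eig A W) y := by
      rw [dotProduct_add, dotProduct_smul, hxx, smul_eq_mul, objF, ← hn]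
      have e1 : x ⬝ᵥ c = ∑ i, |b i| * √(y i) := by
        rw [hx', coord_dot eig hA]
        change w₀ ⬝ᵥ b = _
        refine Finset.sum_congr rfl fun i _ => ?_
        rw [← mul_sgn]; simp only [hw₀]; ring
      have e2 : 1 / n * n ^ 2 = n := by
        rcases hn0.eq_or_lt with h0 | h0
        · rw [← h0]; norm_num
        · field_simp
      rw [e1, e2]; ring
    rw [hval]
    obtain ⟨w, rfl⟩ := coord_surj eig hA hW x'
    rw [sub_zero, wnorm, coord_root eig hA hW, Real.sqrt_le_one] at hx'mem
    have h1 := hopt w hx'mem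
    have h2 := dotProduct_le_wnorm_mul_wnorm hW (coord (A := A) (W := W) eig w) (θ' - c)
    have h3 : wnorm W⁻¹ (coord (A := A) (W := W) eig w) = √(∑ i, 1 / lamOf eig A W i * w i ^ 2) := by
      rw [wnorm, coord_inv eig hA hW]
    have h4 : coord (A := A) (W := W) eig w ⬝ᵥ c ≤ ∑ i, |b i| * |w i| := by
      rw [coord_dot eig hA]
      change w ⬝ᵥ b ≤ _
      refine Finset.sum_le_sum fun i _ => ?_
      rw [← abs_mul, mul_comm]; exact le_abs_self _
    have h5 : wnorm W⁻¹ (coord (A := A) (W := W) eig w) * wnorm W (θ' - c) ≤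
        wnorm W⁻¹ (coord (A := A) (W := W) eig w) :=
      mul_le_of_le_one_right (Real.sqrt_nonneg _) hθ'
    have h6 : coord (A := A) (W := W) eig w ⬝ᵥ θ' = coord (A := A) (W := W) eig w ⬝ᵥ c +
        coord (A := A) (W := W) eig w ⬝ᵥ (θ' - c) := by
      rw [← dotProduct_add, add_sub_cancel]
    rw [h6]
    linarith

end

end

/-! ### Setup and output of the program -/

noncomputable section

variable {d : ℕ}

section
variable {f : Fin d → Counted ℝ}

/-- The maximum is described by its upper bounds, which lets it be compared with a supremum over the
subtype `b i ≠ 0`. -/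
theorem foldlM_maxC_val_le_iff (l : List (Fin d)) (m s : ℝ) :
    (l.foldlM (fun m i => do let v ← f i; maxC m v) m).val ≤ s ↔
      m ≤ s ∧ ∀ i ∈ l, (f i).val ≤ s := by
  induction l generalizing m with
  | nil => simp
  | cons i l ih =>
    rw [List.foldlM_cons, bind_val, ih]
    simp [and_assoc]

theorem maxLoopC_val_le_iff (s : ℝ) : (maxLoopC f).val ≤ s ↔ 0 ≤ s ∧ ∀ i, (f i).val ≤ s := by
  rw [maxLoopC, foldlM_maxC_val_le_iff]; simp

theorem foldlM_maxC_cost_le {c : ℕ} (h : ∀ i, (f i).cost ≤ c) (l : List (Fin d)) (m : ℝ) :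
    (l.foldlM (fun m i => do let v ← f i; maxC m v) m).cost ≤ l.length * (c + 1) := by
  induction l generalizing m with
  | nil => simp
  | cons i l ih =>
    rw [List.foldlM_cons, bind_cost, bind_cost, List.length_cons, Nat.succ_mul]
    have h1 := h i
    have h2 := maxC_cost_le m (f i).val
    have h3 := ih ((do let v ← f i; maxC m v : Counted ℝ)).val
    omega

theorem maxLoopC_cost_le {c : ℕ} (h : ∀ i, (f i).cost ≤ c) : (maxLoopC f).cost ≤ d * (c + 1) :=
  (foldlM_maxC_cost_le h (List.finRange d) 0).trans_eq (by rw [List.length_finRange])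

end

variable [NeZero d] {b lam : Vec d}

namespace IsData
variable (h : IsData b lam)
include h

/-- The start value 0 and the value 0 at indices with `b i = 0` do no harm, since the remaining
values are nonnegative and there is at least one. -/
theorem maxLoopC_inv_sqrt : (maxLoopC fun i => do
      let a ← absC (b i)
      iteC (ltC (rd 0) (rd a)) (rd 1 / sqrtC (rd (b i) * rd (b i) * rd (lowerB b lam i)))
        (rd 0)).val =
    ⨆ i : {i : Fin d // b i ≠ 0}, 1 / √((b i) ^ 2 * lowerB b lam i) := by
  obtain ⟨i₀, hi₀⟩ := h.b_ne
  have : Nonempty {i : Fin d // b i ≠ 0} := ⟨⟨i₀, hi₀⟩⟩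
  refine eq_of_forall_ge_iff fun s => ?_
  rw [maxLoopC_val_le_iff, ciSup_le_iff (Set.finite_range _).bddAbove]
  simp only [bind_val, absC_val, iteC_val, ltC_val, rd_val, abs_pos, div_val, sqrtC_val, mul_val,
    ← pow_two, Subtype.forall]
  constructor
  · rintro ⟨-, h2⟩ i hi
    simpa [hi] using h2 i
  · intro h2
    have h0 : 0 ≤ s := le_trans (by positivity) (h2 i₀ hi₀)
    refine ⟨h0, fun i => ?_⟩
    split_ifs with hi
    · exact h2 i hi
    · exact h0

/-- The minimum of the inverse roots is the inverse root of the maximum. Indices with `b i = 0` have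
`B i = 0` and cannot attain a positive maximum, so the loop may run over all indices. -/
theorem one_div_sqrt_maxLoopC :
    1 / √(maxLoopC fun i => (rd 1 / rd (lam i)) * rd (lowerB b lam i)).val =
      ⨅ i : {i : Fin d // b i ≠ 0}, 1 / √((1 / lam i) * lowerB b lam i) := by
  obtain ⟨j, hj⟩ := h.b_ne
  have : Nonempty {i : Fin d // b i ≠ 0} := ⟨⟨j, hj⟩⟩
  set m := (maxLoopC fun i => (rd 1 / rd (lam i)) * rd (lowerB b lam i)).val with hm
  have hle := fun s => maxLoopC_val_le_iff (f := fun i => (rd 1 / rd (lam i)) * rd (lowerB b lam i)) s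
  simp only [← hm, mul_val, div_val, rd_val] at hle
  have hmi := ((hle m).1 le_rfl).2
  have hpos : ∀ i, b i ≠ 0 → 0 < 1 / lam i * lowerB b lam i := fun i hi =>
    mul_pos (one_div_pos.2 (h.lam_pos i)) (h.lowerB_pos hi)
  apply le_antisymm
  · refine le_ciInf fun i => ?_
    exact one_div_le_one_div_of_le (Real.sqrt_pos.2 (hpos i i.2)) (Real.sqrt_le_sqrt (hmi i))
  · obtain ⟨i, -, hi⟩ := Finset.exists_max_image Finset.univ
      (fun i => 1 / lam i * lowerB b lam i) ⟨j, Finset.mem_univ j⟩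
    have hvi : 0 < 1 / lam i * lowerB b lam i := (hpos j hj).trans_le (hi j (Finset.mem_univ j))
    have hbi : b i ≠ 0 := by
      intro hb
      rw [lowerB, hb] at hvi
      simp at hvi
    have hm' : m ≤ 1 / lam i * lowerB b lam i :=
      (hle _).2 ⟨hvi.le, fun k => hi k (Finset.mem_univ k)⟩
    have hm0 : 0 < m := hvi.trans_le (hmi i)
    exact (ciInf_le (Set.finite_range _).bddBelow (⟨i, hbi⟩ : {i : Fin d // b i ≠ 0})).trans
      (one_div_le_one_div_of_le (Real.sqrt_pos.2 hm0) (Real.sqrt_le_sqrt hm'))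

end IsData

omit [NeZero d] in
theorem conjDiagC_rootMat {eig : EigenRoutine d} {A : Mat d} (hA : A.PosDef) :
    (conjDiagC (eig.run A).1 fun i => √((eig.run A).2 i)).val = rootMat A := by
  rw [conjDiagC_val, (eig.spec A (isSymm_of_posDef hA)).rootMat_eq hA]

omit [NeZero d] in
theorem conjDiagC_rootMat_inv {eig : EigenRoutine d} {A : Mat d} (hA : A.PosDef) :
    (conjDiagC (eig.run A).1 fun i => 1 / √((eig.run A).2 i)).val = (rootMat A)⁻¹ := by
  rw [conjDiagC_val, (eig.spec A (isSymm_of_posDef hA)).rootMat_inv_eq hA]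

omit [NeZero d] in
theorem conjDiagC_inv {eig : EigenRoutine d} {A : Mat d} (hA : A.PosDef) :
    (conjDiagC (eig.run A).1 fun i => 1 / (eig.run A).2 i).val = A⁻¹ := by
  rw [conjDiagC_val, (eig.spec A (isSymm_of_posDef hA)).inv_eq hA]

theorem setupC_val (eig : EigenRoutine d) {A W : Mat d} {c : Vec d} (hA : A.PosDef) (hW : W.PosDef)
    (hc : c ≠ 0) : (setupC eig A W c).val =
      ⟨rootMat A, (rootMat A)⁻¹, basisOf eig A W, lamOf eig A W, centerOf eig A W c,
        lowerB (centerOf eig A W c) (lamOf eig A W), initY (centerOf eig A W c) (lamOf eig A W),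
        tInit (centerOf eig A W c) (lamOf eig A W)⟩ := by
  have h := isData_of eig hA hW hc
  have h1 := h.maxLoopC_inv_sqrt
  have h2 := h.one_div_sqrt_maxLoopC
  rw [setupC]
  simp only [bind_val, pure_val, eigC, tabC_val, sqrtC_val, rd_val, div_val, mulMatC_val,
    mulVecC_val, conjDiagC_rootMat hA, conjDiagC_rootMat_inv hA, add_val, sumC_val, mul_val,
    maxC_val]
  have e1 : (eig.run (rootMat A * W * rootMat A)).1 = basisOf eig A W := rfl
  have e2 : (eig.run (rootMat A * W * rootMat A)).2 = lamOf eig A W := rfl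
  simp only [e1, e2]
  have e3 : basisOf eig A W *ᵥ ((rootMat A)⁻¹ *ᵥ c) = centerOf eig A W c := rfl
  simp only [e3]
  set b := centerOf eig A W c
  set lam := lamOf eig A W
  have e4 : √(∑ i, b i * b i) + 1 / √(lam (lastIdx d)) = radius b lam := rfl
  simp only [e4]
  have e5 : ∀ i, b i / radius b lam * (b i / radius b lam) = lowerB b lam i := fun i => by
    rw [lowerB, pow_two]
  simp only [e5]
  rw [h1, h2, tInit]
  congr 1
  funext i
  rw [initY, pow_two]
  rfl

theorem setupC_cost_le (eig : EigenRoutine d) (A W : Mat d) (c : Vec d) :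
    (setupC eig A W c).cost ≤ 100 * d ^ 3 := by
  have hd : 1 ≤ d := one_le_dim
  have c1 : ∀ v : Vec d, (tabC fun i => sqrtC (rd (v i))).cost ≤ d * 2 :=
    fun v => tabC_cost_le fun i => by simp
  have c2 : ∀ v : Vec d, (tabC fun i => rd 1 / rd (v i)).cost ≤ d * 2 :=
    fun v => tabC_cost_le fun i => by simp
  have c3 := fun (M : Mat d) v => conjDiagC_cost_le M v
  have c4 := fun M N : Mat d => mulMatC_cost_le M N
  have c5 := fun (M : Mat d) v => mulVecC_cost_le M v
  have c6 : ∀ v : Vec d, (sumC fun i => rd (v i) * rd (v i)).cost ≤ d * 2 :=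
    fun v => sumC_cost_le fun i => by simp
  have c7 : ∀ (v : Vec d) r, (tabC fun i => (rd (v i) / rd r) * (rd (v i) / rd r)).cost ≤ d * 4 :=
    fun v r => tabC_cost_le fun i => by simp
  have c8 : ∀ (v : Vec d) l r, (tabC fun i =>
      rd (v i) + (rd 1 / rd l) / (rd 2 * rd d * (rd r * rd r))).cost ≤ d * 7 :=
    fun v l r => tabC_cost_le fun i => by simp
  have c9 : ∀ v w : Vec d, (maxLoopC fun i => do
      let a ← absC (v i)
      iteC (ltC (rd 0) (rd a)) (rd 1 / sqrtC (rd (v i) * rd (v i) * rd (w i))) (rd 0)).cost ≤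
      d * 8 := fun v w => maxLoopC_cost_le fun i => by
    rw [bind_cost]
    exact Nat.add_le_add (absC_cost_le _) (iteC_cost_le _ _ _)
  have c10 : ∀ v w : Vec d, (maxLoopC fun i => (rd 1 / rd (v i)) * rd (w i)).cost ≤ d * 3 :=
    fun v w => maxLoopC_cost_le fun i => by simp
  have c11 := maxC_cost_le
  have hdd : d ≤ d ^ 2 := Nat.le_self_pow two_ne_zero d
  have hd3 : d ^ 2 ≤ d ^ 3 := Nat.pow_le_pow_right hd (by norm_num)
  rw [setupC]
  simp only [bind_cost, pure_cost, sqrtC_cost, rd_cost, div_cost, mul_cost, add_cost]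
  refine le_trans (Nat.add_le_add le_rfl (Nat.add_le_add (c1 _) (Nat.add_le_add (c2 _)
    (Nat.add_le_add (c3 _ _) (Nat.add_le_add (c3 _ _) (Nat.add_le_add (c4 _ _)
    (Nat.add_le_add (c4 _ _) (Nat.add_le_add le_rfl (Nat.add_le_add (c5 _ _) (Nat.add_le_add
    (c5 _ _) (Nat.add_le_add (Nat.add_le_add (Nat.add_le_add (Nat.add_le_add (c6 _) le_rfl)
    le_rfl) le_rfl) (Nat.add_le_add (c7 _ _) (Nat.add_le_add (c8 _ _ _) (Nat.add_le_add (c9 _ _)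
    (Nat.add_le_add (c10 _ _) (Nat.add_le_add le_rfl (Nat.add_le_add (Nat.add_le_add
    (Nat.add_le_add le_rfl (c11 _ _)) le_rfl) le_rfl))))))))))))))))) ?_
  simp only [eigC]
  ring_nf at *
  omega

omit [NeZero d] in
theorem outputC_val (eig : EigenRoutine d) {W : Mat d} (c : Vec d) (hW : W.PosDef) (S : Setup d)
    (y : Vec d) {x : Vec d}
    (hx : x = S.rootInv *ᵥ (S.basisᵀ *ᵥ fun i => √(y i) * sgn (S.b i))) :
    (outputC eig W c S y).val = (x, c + (1 / wnorm W⁻¹ x) • (W⁻¹ *ᵥ x)) := by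
  have e : (fun i => √(y i) * (iteC (ltC (rd (S.b i)) (rd 0)) (rd (-1)) (rd 1)).val) =
      fun i => √(y i) * sgn (S.b i) := by
    funext i
    rw [iteC_val, sgn]
    rfl
  rw [outputC]
  simp only [bind_val, pure_val, eigC, tabC_val, sqrtC_val, rd_val, div_val, mul_val, mulVecC_val,
    conjDiagC_inv hW, add_val, sumC_val, e, ← hx]
  congr 1
  funext i
  rw [Pi.add_apply, Pi.smul_apply, smul_eq_mul, one_div_mul_eq_div]
  rfl

theorem outputC_cost_le (eig : EigenRoutine d) (W : Mat d) (c : Vec d) (S : Setup d) (y : Vec d) :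
    (outputC eig W c S y).cost ≤ 100 * d ^ 3 := by
  have hd : 1 ≤ d := one_le_dim
  have c1 : (tabC fun i => sqrtC (rd (y i)) *
      iteC (ltC (rd (S.b i)) (rd 0)) (rd (-1)) (rd 1)).cost ≤ d * 4 :=
    tabC_cost_le fun i => by
      have := iteC_cost_le (rd (-1)) (rd 1) (ltC (rd (S.b i)) (rd 0))
      simp only [ltC_cost, rd_cost] at this
      simp only [mul_cost, sqrtC_cost, rd_cost]
      omega
  have c2 : ∀ v : Vec d, (tabC fun i => rd 1 / rd (v i)).cost ≤ d * 2 :=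
    fun v => tabC_cost_le fun i => by simp
  have c3 := fun (M : Mat d) v => conjDiagC_cost_le M v
  have c5 := fun (M : Mat d) v => mulVecC_cost_le M v
  have c6 : ∀ v w : Vec d, (sumC fun i => rd (v i) * rd (w i)).cost ≤ d * 2 :=
    fun v w => sumC_cost_le fun i => by simp
  have c7 : ∀ (w : Vec d) r, (tabC fun i => rd (c i) + rd (w i) / rd r).cost ≤ d * 3 :=
    fun w r => tabC_cost_le fun i => by simp
  have hdd : d ≤ d ^ 2 := Nat.le_self_pow two_ne_zero d
  have hd3 : d ^ 2 ≤ d ^ 3 := Nat.pow_le_pow_right hd (by norm_num)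
  rw [outputC]
  simp only [bind_cost, pure_cost, sqrtC_cost]
  refine le_trans (Nat.add_le_add c1 (Nat.add_le_add (c5 _ _) (Nat.add_le_add (c5 _ _)
    (Nat.add_le_add le_rfl (Nat.add_le_add (c2 _) (Nat.add_le_add (c3 _ _) (Nat.add_le_add
    (c5 _ _) (Nat.add_le_add (Nat.add_le_add (c6 _ _) le_rfl) (Nat.add_le_add (c7 _ _)
    le_rfl))))))))) ?_
  simp only [eigC]
  ring_nf at *
  omega

end

end BilinearNewton

/-! ### Assembly of the theorem -/

open BilinearNewton
theorem mainTheorem2 :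
    ∃ C : ℝ, 0 < C ∧
      ∀ (d : ℕ) [NeZero d] (A W : Mat d) (c : Vec d) (eig : EigenRoutine d) (ε η : ℝ),
        A.PosDef → W.PosDef → c ≠ 0 → 0 < ε → 1 < η →
        ∃ (x θ : Vec d) (N T : ℕ),
          (newtonAlgorithm eig A W c ε η).runs (x, θ) N ∧
          (newtonProgram eig A W c ε η).runs (x, θ) T ∧
          IsEpsSolution A W c ε x θ ∧
          (ε ≤ 1 / 10 ^ 6 →
            (N : ℝ) < nTot (centerOf eig A W c) (lamOf eig A W) ε η) ∧
          (ε ≤ 1 / 2 → η = 1 + 1 / √((d : ℝ) + 1) →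
            (N : ℝ) < nTotSqrt (centerOf eig A W c) (lamOf eig A W) ε) ∧
          (ε ≤ 1 / 2 →
            (T : ℝ) ≤ C * ((d : ℝ) ^ 2 * nTot (centerOf eig A W c) (lamOf eig A W) ε η
              + (d : ℝ) ^ 3)) := by
  -- `1950 = 130 * 15`: at most `130 d²` units per Newton step or phase, and at most `15 nTot` of
  -- these. The `d³` terms, `130 + 200`, fit as well.
  refine ⟨1950, by norm_num, fun d _ A W c eig ε η hA hW hc hε hη => ?_⟩
  have h := isData_of eig hA hW hc
  set b := centerOf eig A W c with hb
  set lam := lamOf eig A W with hlam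
  obtain ⟨t, y, n₁, n₂, N, T, r₁, r₂, ht, hy, hdec, htε, h₁, h₂, h₃, hT⟩ :=
    h.barrierMethod_runs hε hη
  set x : Vec d := (rootMat A)⁻¹ *ᵥ ((basisOf eig A W)ᵀ *ᵥ fun i => √(y i) * sgn (b i)) with hx
  have hS := setupC_val eig hA hW hc
  have hsC := setupC_cost_le eig A W c
  have hoC := outputC_cost_le eig W c (setupC eig A W c).val y
  have hout : (outputC eig W c (setupC eig A W c).val y).val =
      (x, c + (1 / wnorm W⁻¹ x) • (W⁻¹ *ᵥ x)) :=
    outputC_val eig c hW _ y (by rw [hS])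
  refine ⟨x, c + (1 / wnorm W⁻¹ x) • (W⁻¹ *ᵥ x), n₁ + n₂ + N,
    (setupC eig A W c).cost + (T + (outputC eig W c (setupC eig A W c).val y).cost),
    ⟨y, _, 0, r₁, ⟨rfl, rfl⟩, rfl⟩, ?_, ?_, ?_, ?_, ?_⟩
  · refine ⟨(setupC eig A W c).val, _, _, ⟨rfl, rfl⟩, ⟨y, T, _, ?_, ⟨hout.symm, rfl⟩, rfl⟩, rfl⟩
    rw [hS]
    exact r₂
  · have hy0 : ∀ i, 0 ≤ y i := fun i => (IsData.lowerB_nonneg i).trans (hy.1 i).le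
    exact isEpsSolution_of eig hA hW hy0 hy.2.le
      (fun w hw => h.nearly_optimal ht htε hy hdec hw) hx
  · exact fun hε2 => h.steps_lt_nTot hε h₁ h₂ h₃ hη hε2
  · exact fun hε2 hη' => h.steps_lt_nTotSqrt hε h₁ h₂ h₃ hη' hε2
  · intro hε2
    have h4 := h.steps_add_phases_le hε h₁ h₂ h₃ hη hε2
    have hd : (1 : ℝ) ≤ d := by exact_mod_cast (one_le_dim : 1 ≤ d)
    have hT' : ((setupC eig A W c).cost + (T + (outputC eig W c (setupC eig A W c).val y).cost) : ℕ)
        ≤ 130 * d ^ 2 * (n₁ + n₂ + N + phases d ε η (tInit b lam) + 1) + 200 * d ^ 3 := by omega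
    have hT'' : (((setupC eig A W c).cost +
        (T + (outputC eig W c (setupC eig A W c).val y).cost) : ℕ) : ℝ) ≤
        130 * (d : ℝ) ^ 2 * (((n₁ + n₂ + N + phases d ε η (tInit b lam) : ℕ) : ℝ) + 1)
          + 200 * (d : ℝ) ^ 3 := by exact_mod_cast hT'
    have hd23 : (d : ℝ) ^ 2 ≤ (d : ℝ) ^ 3 := pow_le_pow_right₀ hd (by norm_num)
    have h5 := mul_le_mul_of_nonneg_left h4 (by positivity : 0 ≤ 130 * (d : ℝ) ^ 2)
    have hd3 : (0 : ℝ) ≤ (d : ℝ) ^ 3 := by positivity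
    linarith
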